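/- **Setting.** Let $n\ge 0$, $L\ge 1$, $M\ge 1$, $n_t\ge 0$ be integers, $t_0<t$, $\Delta t=t-t_0$. Let $H(\tau)=\sum_{j=1}^{L}\alpha_j(\tau)H_j$ on $[t_0,t]$, with $H_j\in\mathbb C^{2^n\times 2^n}$ Hermitian and $\alpha_j:[t_0,t]\to\mathbb R$ of class $C^\infty$, and let $U(t,t_0)$ be the propagator of $i\,\partial_\tau U(\tau,t_0)=H(\tau)U(\tau,t_0)$, $U(t_0,t_0)=1$. Let $\Lambda:[t_0,t]\to(0,\infty)$ be continuous with $\Lambda(\tau)\ge\sup_{p\ge 0}\|\partial_\tau^pH(\tau)\|^{1/(p+1)}$ (spectral norm). Let $\kappa\ge1$ be a number with $\|H_j\|\le\kappa$ for all $j$ and $$\sum_{j}|\partial_\tau^p\alpha_j(\tau)|\,\|H_j\|\le\bigl(\kappa\max_{[t_0,t]}\Lambda\bigr)^{p+1}\qquad(0\le p\le 2M+1,\ \tau\in[t_0,t]);$$ such a $\kappa$ always exists. **Oracles.** Put $t_q=t_0+q\,\Delta t/(2^{n_t}-1)$ for $0\le q<2^{n_t}$ ($t_0$ if $n_t=0$).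 $U_\alpha$ is a self-inverse unitary with $U_\alpha|j\rangle|q\rangle|\tau\rangle|0\rangle=|j\rangle|q\rangle|\tau\rangle|\alpha_j(t_q)\tau\rangle$ and $U_H$ is a unitary with $U_H|j\rangle|v\rangle|\psi\rangle=|j\rangle|v\rangle e^{-iH_jv}|\psi\rangle$ for all $|\psi\rangle\in\mathbb C^{2^n}$ and all values $v=\alpha_j(t_q)\tau$. Here $\tau$ runs over finitely many step lengths in $[0,\Delta t]$ chosen by the algorithm, and the values $v$ are assumed to be exactly encoded by the bit strings of the value register. A query circuit is a product of oracle-independent unitaries on these registers, the system and any number of work qubits, and of applications of $U_\alpha$, $U_H$ and $U_H^{-1}$, each of which counts as one query. **Lemma.** There are absolute constants $c_1,c_2,e$ and, for every $M\ge1$, integers $1\le k_1,\dots,k_M\le 3M^2$, weights $a\in\mathbb R^M$ with $\sum_ja_j=1$, $\sum_ja_jk_j^{-2i}=0$ for $1\le i<M$ and $\|a\|_1\le c_1(1+\log M)$, and a constant $C_M$ such that the following holds. For all $n,L,n_t,t_0,t$ (and every length of the value register) there is a query circuit, which does not depend on the $H_j$, the $\alpha_j$, $\Lambda$, $\kappa$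 or the behaviour of the oracles, that makes at most $$c_2\,M^2L\,\bigl(1+\log(M^2L)\bigr)^{e},\qquad\text{that is, }\widetilde O(M^2L),$$ queries to $U_H$ and $U_\alpha$, and for which the operator $\widetilde W(t,t_0)=(\langle0|\otimes1)\,\mathrm{Circ}^{U_\alpha,U_H}\,(|0\rangle\otimes1)$ satisfies $$\bigl\|\widetilde W(t,t_0)-U(t,t_0)\bigr\|\le C_M\,\|a\|_1\Bigl(\kappa\max_{\tau\in[t_0,t]}\Lambda(\tau)\,\Delta t\Bigr)^{2M+1}$$ for all $H_j,\alpha_j,\Lambda,\kappa$ and oracles as above, whenever $$n_t\ \ge\ \log_2\!\left(\frac{10M^2L\,\max_{j,\tau}|\partial_\tau\alpha_j(\tau)|\,\Delta t^2}{\bigl(41\max_{\tau\in[t_0,t]}\Lambda(\tau)\,\Delta t\bigr)^{2M+1}}\right)$$ (no condition if all $\alpha_j$ are constant). In particular, for fixed $M$ and a fixed Hamiltonian $\sum_j\alpha_jH_j$ the error is in $O\bigl(\|a\|_1(\max\Lambda\,\Delta t)^{2M+1}\bigr)$. -/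

import Mathlib

open scoped Matrix.Norms.L2Operator ContDiff

noncomputable section

namespace TDMPF

/-- Operators on `n` qubits. Their norm is the spectral norm (the scoped `L2Operator` instances). -/
abbrev QOp (n : ℕ) := Matrix (Fin (2 ^ n)) (Fin (2 ^ n)) ℂ

/-! ### The Hamiltonian, its propagator and the `Λ` bound -/

/-- `H(τ) = ∑ j, α j τ • H j`. -/
def hamiltonian {n L : ℕ} (Hs : Fin L → QOp n) (α : Fin L → ℝ → ℝ) (τ : ℝ) : QOp n :=
  ∑ j, ((α j τ : ℝ) : ℂ) • Hs j

/-- `U τ` is the propagator `U(τ, t₀)` for `τ ∈ [t₀, t]`: the solution of the Schrödinger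
equation `∂_τ U = - i H(τ) U`, `U(t₀, t₀) = 1`. -/
def IsPropagator {n : ℕ} (H : ℝ → QOp n) (t₀ t : ℝ) (U : ℝ → QOp n) : Prop :=
  U t₀ = 1 ∧
    ∀ τ ∈ Set.Icc t₀ t, HasDerivWithinAt U (-(Complex.I • (H τ * U τ))) (Set.Icc t₀ t) τ

/-- `Λ` is a positive continuous function on `[t₀, t]` dominating
`sup_p ‖H^(p)(τ)‖ ^ (1 / (p + 1))`. -/
def IsLambdaBound {n : ℕ} (H : ℝ → QOp n) (t₀ t : ℝ) (Λ : ℝ → ℝ) : Prop :=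
  ContinuousOn Λ (Set.Icc t₀ t) ∧ ∀ τ ∈ Set.Icc t₀ t, 0 < Λ τ ∧
    ∀ p : ℕ, ‖iteratedDerivWithin p H (Set.Icc t₀ t) τ‖ ^ (1 / ((p : ℝ) + 1)) ≤ Λ τ

/-- `max_{τ ∈ [t₀, t]} Λ(τ)`; used for continuous `Λ` and `t₀ < t`, so that it is a maximum. -/
def lambdaMax (Λ : ℝ → ℝ) (t₀ t : ℝ) : ℝ := sSup (Λ '' Set.Icc t₀ t)

/-- `max_{j, τ} |∂_τ α j τ|` over all `j` and `τ ∈ [t₀, t]`; used for smooth `α j`, `t₀ < t` and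
`L ≥ 1`, so that it is a maximum. -/
def maxDeriv {L : ℕ} (α : Fin L → ℝ → ℝ) (t₀ t : ℝ) : ℝ :=
  sSup {x | ∃ j, ∃ τ ∈ Set.Icc t₀ t, x = |derivWithin (α j) (Set.Icc t₀ t) τ|}

/-- `κ ≥ 1` compares the individual terms `α j • H j` with the bound `Λ` on their sum: the terms
satisfy the derivative bounds up to order `2 M + 1` with `κ * max Λ` in place of `Λ`, and
`‖H j‖ ≤ κ`. -/
def IsTermRatio {n L : ℕ} (M : ℕ) (Hs : Fin L → QOp n) (α : Fin L → ℝ → ℝ) (Λ : ℝ → ℝ)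
    (t₀ t κ : ℝ) : Prop :=
  1 ≤ κ ∧ (∀ j, ‖Hs j‖ ≤ κ) ∧
    ∀ p ≤ 2 * M + 1, ∀ τ ∈ Set.Icc t₀ t,
      ∑ j, |iteratedDerivWithin p (α j) (Set.Icc t₀ t) τ| * ‖Hs j‖
        ≤ (κ * lambdaMax Λ t₀ t) ^ (p + 1)

/-! ### Coefficients of a multiproduct formula -/

/-- `k` and `a` are the step numbers and weights of a multiproduct formula of order `2 M`:
`∑ j, a j = 1` and `∑ j, a j / k j ^ (2 i) = 0` for `0 < i < M`. -/
def IsMPF {M : ℕ} (k : Fin M → ℕ) (a : Fin M → ℝ) : Prop :=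
  (∀ j, 0 < k j) ∧
    ∀ i < M, ∑ j, a j * (((k j : ℝ) ^ (2 * i))⁻¹) = if i = 0 then 1 else 0

/-- `‖a‖₁`. -/
def l1norm {M : ℕ} (a : Fin M → ℝ) : ℝ := ∑ j, |a j|

/-! ### The oracles -/

/-- Mesh point `t_q = t₀ + q (t - t₀) / (2 ^ n_t - 1)`. -/
def meshPoint (t₀ t : ℝ) (nt : ℕ) (q : Fin (2 ^ nt)) : ℝ :=
  t₀ + (q : ℝ) * ((t - t₀) / ((2 : ℝ) ^ nt - 1))

/-- Basis labels `|j⟩|q⟩|τ⟩|v⟩`: term, mesh point, encoded time step, `b`-bit encoded value. -/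
abbrev CoeffIdx (L nt m b : ℕ) := Fin L × Fin (2 ^ nt) × Fin (2 ^ m) × Fin (2 ^ b)

/-- Basis labels `|j⟩|v⟩|x⟩`: term, encoded value, system. -/
abbrev HamIdx (L b n : ℕ) := Fin L × Fin (2 ^ b) × Fin (2 ^ n)

/-- In the value register the code `enc j q s` stands for the real number `α j (t_q) * τ`, where
`τ = dur s` is the time step with code `s` and `val` decodes the value register. -/
def IsEncoding {L nt m b : ℕ} (α : Fin L → ℝ → ℝ) (t₀ t : ℝ) (dur : Fin (2 ^ m) → ℝ)
    (val : Fin (2 ^ b) → ℝ) (enc : Fin L → Fin (2 ^ nt) → Fin (2 ^ m) → Fin (2 ^ b)) : Prop :=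
  ∀ j q s, val (enc j q s) = α j (meshPoint t₀ t nt q) * dur s

/-- `U_α` is a self-inverse unitary with `U_α |j⟩|q⟩|τ⟩|0⟩ = |j⟩|q⟩|τ⟩|α j (t_q) τ⟩`. -/
def IsCoeffOracle {L nt m b : ℕ} (enc : Fin L → Fin (2 ^ nt) → Fin (2 ^ m) → Fin (2 ^ b))
    (Uα : Matrix (CoeffIdx L nt m b) (CoeffIdx L nt m b) ℂ) : Prop :=
  Uα ∈ Matrix.unitaryGroup (CoeffIdx L nt m b) ℂ ∧ Uα * Uα = 1 ∧
    ∀ j q s, Uα.mulVec (Pi.single (j, q, s, 0) 1) = Pi.single (j, q, s, enc j q s) 1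

/-- The vector `|j⟩|v⟩|ψ⟩`. -/
def tensorState {L b n : ℕ} (j : Fin L) (v : Fin (2 ^ b)) (ψ : Fin (2 ^ n) → ℂ) :
    HamIdx L b n → ℂ :=
  fun r => if r.1 = j ∧ r.2.1 = v then ψ r.2.2 else 0

/-- `U_H` is a unitary with `U_H |j⟩|v⟩|ψ⟩ = |j⟩|v⟩ e^{-i H_j v}|ψ⟩` for all encoded values
`v = α j (t_q) τ` and all `ψ`. -/
def IsHamOracle {n L nt m b : ℕ} (Hs : Fin L → QOp n) (val : Fin (2 ^ b) → ℝ)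
    (enc : Fin L → Fin (2 ^ nt) → Fin (2 ^ m) → Fin (2 ^ b))
    (UH : Matrix (HamIdx L b n) (HamIdx L b n) ℂ) : Prop :=
  UH ∈ Matrix.unitaryGroup (HamIdx L b n) ℂ ∧
    ∀ j q s (ψ : Fin (2 ^ n) → ℂ),
      UH.mulVec (tensorState j (enc j q s) ψ) =
        tensorState j (enc j q s)
          ((NormedSpace.exp ((-(Complex.I * (val (enc j q s) : ℂ))) • Hs j) : QOp n).mulVec ψ)

/-! ### Query circuits -/

/-- Basis labels of the whole machine: `w` work qubits, the oracle registers `|j⟩|q⟩|τ⟩|v⟩`, and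
the `n` system qubits. -/
abbrev FullIdx (w L nt m b n : ℕ) :=
  Fin (2 ^ w) × Fin L × Fin (2 ^ nt) × Fin (2 ^ m) × Fin (2 ^ b) × Fin (2 ^ n)

/-- A shortcut for instance search on the long product type. -/
instance instDecidableEqFullIdx (w L nt m b n : ℕ) : DecidableEq (FullIdx w L nt m b n) :=
  instDecidableEqProd

/-- A shortcut for instance search on the long product type. -/
instance instFintypeFullIdx (w L nt m b n : ℕ) : Fintype (FullIdx w L nt m b n) :=
  instFintypeProd _ _

/-- A gate is an oracle-independent unitary, or one application of `U_α` (which is its own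
inverse), of `U_H`, or of `U_H⁻¹`. -/
inductive Gate (w L nt m b n : ℕ) where
  | free (G : Matrix.unitaryGroup (FullIdx w L nt m b n) ℂ)
  | coeff
  | ham
  | hamInv

/-- A query circuit: the gates in their order of application. -/
abbrev Circuit (w L nt m b n : ℕ) := List (Gate w L nt m b n)

/-- Number of oracle queries made by a gate. -/
def Gate.queries {w L nt m b n : ℕ} : Gate w L nt m b n → ℕ
  | .free _ => 0
  | .coeff => 1
  | .ham => 1
  | .hamInv => 1

/-- Number of queries to `U_α` and `U_H` made by a circuit. -/
def Circuit.queries {w L nt m b n : ℕ} (c : Circuit w L nt m b n) : ℕ :=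
  (c.map Gate.queries).sum

/-- `U_α` acting on the whole machine. -/
def liftCoeff (w n : ℕ) {L nt m b : ℕ} (U : Matrix (CoeffIdx L nt m b) (CoeffIdx L nt m b) ℂ) :
    Matrix (FullIdx w L nt m b n) (FullIdx w L nt m b n) ℂ :=
  Matrix.of fun (w₁, j, q, s, v, x) (w₂, j', q', s', v', x') =>
    if w₁ = w₂ ∧ x = x' then U (j, q, s, v) (j', q', s', v') else 0

/-- `U_H` acting on the whole machine. -/
def liftHam (w nt m : ℕ) {L b n : ℕ} (U : Matrix (HamIdx L b n) (HamIdx L b n) ℂ) :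
    Matrix (FullIdx w L nt m b n) (FullIdx w L nt m b n) ℂ :=
  Matrix.of fun (w₁, j, q, s, v, x) (w₂, j', q', s', v', x') =>
    if w₁ = w₂ ∧ q = q' ∧ s = s' then U (j, v, x) (j', v', x') else 0

/-- The operator of a gate for given oracles. -/
def Gate.eval {w L nt m b n : ℕ} (Uα : Matrix (CoeffIdx L nt m b) (CoeffIdx L nt m b) ℂ)
    (UH : Matrix (HamIdx L b n) (HamIdx L b n) ℂ) :
    Gate w L nt m b n → Matrix (FullIdx w L nt m b n) (FullIdx w L nt m b n) ℂ
  | .free G => (G : Matrix (FullIdx w L nt m b n) (FullIdx w L nt m b n) ℂ)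
  | .coeff => liftCoeff w n Uα
  | .ham => liftHam w nt m UH
  | .hamInv => liftHam w nt m UH.conjTranspose

/-- The operator of a circuit for given oracles (the head of the list is applied first). -/
def Circuit.eval {w L nt m b n : ℕ} (Uα : Matrix (CoeffIdx L nt m b) (CoeffIdx L nt m b) ℂ)
    (UH : Matrix (HamIdx L b n) (HamIdx L b n) ℂ) :
    Circuit w L nt m b n → Matrix (FullIdx w L nt m b n) (FullIdx w L nt m b n) ℂ
  | [] => 1
  | g :: c => Circuit.eval Uα UH c * g.eval Uα UH

/-- The operator `(⟨0| ⊗ 1) A (|0⟩ ⊗ 1)` on the system, where `|0⟩` is the all-zero state of all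
other registers. -/
def block {w L nt m b n : ℕ} [NeZero L]
    (A : Matrix (FullIdx w L nt m b n) (FullIdx w L nt m b n) ℂ) : QOp n :=
  Matrix.of fun x x' => A (0, 0, 0, 0, 0, x) (0, 0, 0, 0, 0, x')

end TDMPF

end

noncomputable section

namespace TDMPF

set_option linter.unusedSectionVars false

/-! ### Polynomial functions on `ℤ` with vector coefficients -/

section Poly

variable {V : Type*} [NormedRing V] [NormedAlgebra ℂ V]

/-! Rescale the interval to unit length and put `x = κ * max Λ * Δt`. If `x ≥ 1 / 2`, the bound is
trivial, since both operators have norm at most one. Let `x ≤ 1 / 2`, and replace every coefficient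
by the first `2 M` terms of its Taylor expansion at `t₀`. The symmetric second-order product
`F_k(z)` of `k` steps of length `z`, with coefficients taken at midpoints, is then an entire
function of a complex `z`.

The order of the multiproduct formula comes from algebra, without commutator expansions. The
coefficient of `z ^ p` in `F_k(z)` is a polynomial in `k` of degree at most `p`: in one step the
coefficient of `z ^ (p + 1)` has degree at most `p` in the step index (`NearId`), and multiplying
the steps together is a discrete integration (`stepProdInt_polyLead`). Its leading coefficient obeys
the recursion of the Taylor coefficients of the exact solution. Time symmetry of a step extends
`F_k` to all integers by `F_{-k}(z) = F_k(-z)`, so the polynomial has the parity of `p`. In the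
coefficients of `F_k(z / k)` only even powers of `1 / k` are left, and the weights cancel all of
them but the constant (`PolyLead.mpf_sum`, `tcoeff_mpf`) for `p ≤ 2 M`.

On the disc of radius `1 / x` the combination is bounded by `‖a‖₁ * e ^ (2 M)`, so Cauchy's estimate
bounds its Taylor remainder at `z = 1` by a multiple of `x ^ (2 M + 1)` (`norm_mpf_sub_taylor_le`).
Gronwall's inequality compares the same Taylor polynomial with the propagator
(`norm_ode_sub_taylor_le`). Rounding midpoints to the mesh and truncating the coefficients only
perturbs the phases of unitary factors, and these errors add up (`norm_mpf_mesh_sub_propagator_le`).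

The weights are those of Lagrange extrapolation to zero in the variable `1 / k ^ 2`, with `k_j` the
integer part of `3 M ^ 2 / (2 j + 1)`. For the unrounded nodes the weights are explicit quotients of
factorials; rounding costs a bounded factor, and a decay like `1 / (2 j + 1)` gives `‖a‖₁ = O(log
M)` (`exists_wellConditioned_mpf`).

The circuit is a linear combination of unitaries in which all branches run the same `3 M ^ 2` steps,
padded by steps of zero duration. It encodes the formula scaled by exactly `sin (π / (2 * 3 ^ d))`,
so `d` rounds of oblivious amplitude amplification, each tripling the angle, bring the amplitude to
one. As `3 ^ d = O(‖a‖₁)`, only a logarithmic factor is added to the `O(M ^ 2 L)` queries. -/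

/-- Polynomial functions `ℤ → V` of degree `< d`. -/
def polyLT (V : Type*) [NormedRing V] [NormedAlgebra ℂ V] (d : ℕ) : Submodule ℂ (ℤ → V) :=
  Submodule.span ℂ {f | ∃ i < d, ∃ v : V, f = fun k : ℤ => (k : ℂ) ^ i • v}

/-- Polynomial functions `ℤ → V` of degree `≤ d` whose coefficient of `k ^ d` is `c`. -/
def PolyLead (d : ℕ) (c : V) (f : ℤ → V) : Prop :=
  f - (fun k : ℤ => (k : ℂ) ^ d • c) ∈ polyLT V d

lemma monomial_mem_polyLT {d i : ℕ} (h : i < d) (v : V) :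
    (fun k : ℤ => (k : ℂ) ^ i • v) ∈ polyLT V d :=
  Submodule.subset_span ⟨i, h, v, rfl⟩

lemma polyLT_mono {d e : ℕ} (h : d ≤ e) : polyLT V d ≤ polyLT V e := by
  apply Submodule.span_mono
  rintro f ⟨i, hi, v, rfl⟩
  exact ⟨i, hi.trans_le h, v, rfl⟩

lemma PolyLead.mem {d : ℕ} {c : V} {f : ℤ → V} (h : PolyLead d c f) : f ∈ polyLT V (d + 1) := by
  have := Submodule.add_mem _ (polyLT_mono (Nat.le_succ d) h) (monomial_mem_polyLT (Nat.lt_succ_self d) c)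
  simpa using this

lemma polyLT_eq_zero {f : ℤ → V} (h : f ∈ polyLT V 0) : f = 0 := by
  have : {f : ℤ → V | ∃ i < 0, ∃ v : V, f = fun k : ℤ => (k : ℂ) ^ i • v} = ∅ := by
    ext; simp
  rw [polyLT, this, Submodule.span_empty] at h
  simpa using h

lemma exists_polyLead {d : ℕ} {f : ℤ → V} (h : f ∈ polyLT V (d + 1)) : ∃ c, PolyLead d c f := by
  induction h using Submodule.span_induction with
  | mem f hf =>
    obtain ⟨i, hi, v, rfl⟩ := hf
    rcases Nat.lt_succ_iff_lt_or_eq.1 hi with hi | rfl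
    · exact ⟨0, by simpa [PolyLead, Pi.sub_def] using monomial_mem_polyLT hi v⟩
    · exact ⟨v, by simp [PolyLead]⟩
  | zero => exact ⟨0, by simp [PolyLead]; exact Submodule.zero_mem _⟩
  | add f g _ _ hf hg =>
    obtain ⟨c, hc⟩ := hf
    obtain ⟨c', hc'⟩ := hg
    refine ⟨c + c', ?_⟩
    have := Submodule.add_mem _ hc hc'
    refine (congrArg (· ∈ polyLT V d) ?_).mp this
    ext k; simp; abel
  | smul a f _ hf =>
    obtain ⟨c, hc⟩ := hf
    refine ⟨a • c, ?_⟩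
    have := Submodule.smul_mem _ a hc
    refine (congrArg (· ∈ polyLT V d) ?_).mp this
    ext k; simp [smul_sub, smul_comm a]

lemma polyLT_eq_sum {d : ℕ} {f : ℤ → V} (h : f ∈ polyLT V d) :
    ∃ c : ℕ → V, ∀ k : ℤ, f k = ∑ i ∈ Finset.range d, (k : ℂ) ^ i • c i := by
  induction d generalizing f with
  | zero => exact ⟨0, fun k => by simp [polyLT_eq_zero h]⟩
  | succ d ih =>
    obtain ⟨v, hv⟩ := exists_polyLead h
    obtain ⟨c, hc⟩ := ih hv
    refine ⟨fun i => if i = d then v else c i, fun k => ?_⟩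
    have h1 := hc k
    have h2 : ∑ i ∈ Finset.range d, (k : ℂ) ^ i • (if i = d then v else c i)
        = ∑ i ∈ Finset.range d, (k : ℂ) ^ i • c i :=
      Finset.sum_congr rfl fun i hi => by rw [if_neg (Finset.mem_range.1 hi).ne]
    rw [Finset.sum_range_succ, h2, ← h1]
    simp

lemma mul_mem_polyLT {d e : ℕ} {f g : ℤ → V} (hf : f ∈ polyLT V (d + 1)) (hg : g ∈ polyLT V e) :
    f * g ∈ polyLT V (d + e) ∧ g * f ∈ polyLT V (d + e) := by
  induction hf using Submodule.span_induction with
  | mem f hf =>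
    obtain ⟨i, hi, v, rfl⟩ := hf
    induction hg using Submodule.span_induction with
    | mem g hg =>
      obtain ⟨j, hj, w, rfl⟩ := hg
      have hij : i + j < d + e := by omega
      refine ⟨(congrArg (· ∈ polyLT V (d + e)) ?_).mp (monomial_mem_polyLT hij (v * w)),
        (congrArg (· ∈ polyLT V (d + e)) ?_).mp (monomial_mem_polyLT hij (w * v))⟩
      · ext k; simp [pow_add, smul_smul, mul_comm]
      · ext k; simp [pow_add, smul_smul]
    | zero => simp
    | add g h _ _ hg hh =>
      rw [mul_add, add_mul]
      exact ⟨Submodule.add_mem _ hg.1 hh.1, Submodule.add_mem _ hg.2 hh.2⟩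
    | smul a g _ hg =>
      rw [mul_smul_comm, smul_mul_assoc]
      exact ⟨Submodule.smul_mem _ a hg.1, Submodule.smul_mem _ a hg.2⟩
  | zero => simp
  | add g h _ _ hg hh =>
    rw [mul_add, add_mul]
    exact ⟨Submodule.add_mem _ hg.1 hh.1, Submodule.add_mem _ hg.2 hh.2⟩
  | smul a g _ hg =>
    rw [mul_smul_comm, smul_mul_assoc]
    exact ⟨Submodule.smul_mem _ a hg.1, Submodule.smul_mem _ a hg.2⟩

/-- Replace `f` by its leading monomial and then `g` by its own; each replacement changes the
product by terms of degree below `d + e`. -/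
lemma PolyLead.mul {d e : ℕ} {c c' : V} {f g : ℤ → V} (hf : PolyLead d c f)
    (hg : PolyLead e c' g) : PolyLead (d + e) (c * c') (f * g) := by
  have h1 := (mul_mem_polyLT hg.mem hf).2
  have h2 := (mul_mem_polyLT (monomial_mem_polyLT (Nat.lt_succ_self d) c) hg).1
  rw [add_comm e d] at h1
  refine (congrArg (· ∈ polyLT V (d + e)) ?_).mp (Submodule.add_mem _ h1 h2)
  ext k
  simp [sub_mul, mul_sub, pow_add, smul_smul, mul_comm]

lemma PolyLead.add {d : ℕ} {c c' : V} {f g : ℤ → V} (hf : PolyLead d c f)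
    (hg : PolyLead d c' g) : PolyLead d (c + c') (f + g) := by
  refine (congrArg (· ∈ polyLT V d) ?_).mp (Submodule.add_mem _ hf hg)
  ext k; simp; abel

lemma PolyLead.smul {d : ℕ} {c : V} {f : ℤ → V} (a : ℂ) (hf : PolyLead d c f) :
    PolyLead d (a • c) (a • f) := by
  refine (congrArg (· ∈ polyLT V d) ?_).mp (Submodule.smul_mem _ a hf)
  ext k; simp [smul_sub, smul_comm a]

lemma PolyLead.sum {ι : Type*} {s : Finset ι} {d : ℕ} {c : ι → V} {f : ι → ℤ → V}
    (h : ∀ i ∈ s, PolyLead d (c i) (f i)) : PolyLead d (∑ i ∈ s, c i) (∑ i ∈ s, f i) := by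
  refine (congrArg (· ∈ polyLT V d) ?_).mp (Submodule.sum_mem _ h)
  ext k; simp [Finset.smul_sum]

lemma PolyLead.of_mem {d : ℕ} {f : ℤ → V} (h : f ∈ polyLT V d) : PolyLead d 0 f := by
  simpa [PolyLead, Pi.sub_def] using h

lemma polyLead_const (c : V) : PolyLead 0 c (fun _ => c) := by
  simp only [PolyLead, pow_zero, one_smul, sub_self]; exact Submodule.zero_mem _

lemma polyLead_shift_pow (i : ℕ) (x : ℂ) (v : V) :
    PolyLead i v (fun k : ℤ => ((k : ℂ) + x) ^ i • v) := by
  induction i with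
  | zero => simpa using polyLead_const v
  | succ i ih =>
    have h1 : PolyLead 1 (1 : V) (fun k : ℤ => ((k : ℂ) + x) • (1 : V)) := by
      refine (congrArg (· ∈ polyLT V 1) ?_).mp (monomial_mem_polyLT Nat.zero_lt_one (x • (1 : V)))
      ext k; simp [add_smul]
    have := h1.mul ih
    rw [one_mul, add_comm 1 i] at this
    convert this using 1
    ext k; simp [pow_succ, smul_smul]

lemma polyLT_diff_monomial (d : ℕ) (v : V) :
    PolyLead d (((d : ℂ) + 1) • v)
      (fun k : ℤ => ((k + 1 : ℤ) : ℂ) ^ (d + 1) • v - (k : ℂ) ^ (d + 1) • v) := by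
  have h : (∑ m ∈ Finset.range d, ((d + 1).choose m : ℂ) • fun k : ℤ => (k : ℂ) ^ m • v)
      ∈ polyLT V d := Submodule.sum_mem _ fun m hm =>
    Submodule.smul_mem _ _ (monomial_mem_polyLT (Finset.mem_range.1 hm) v)
  refine (congrArg (· ∈ polyLT V d) ?_).mp h
  ext k
  simp only [Finset.sum_apply, Pi.smul_apply, Pi.sub_apply, Int.cast_add, Int.cast_one]
  rw [add_pow, Finset.sum_range_succ, Finset.sum_range_succ]
  simp only [one_pow, mul_one, Nat.choose_self, Nat.cast_one, add_smul, Finset.sum_smul,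
    Nat.choose_succ_self_right, Nat.cast_add, smul_smul]
  simp only [mul_comm (((d+1).choose _ : ℕ) : ℂ), mul_add, add_smul, mul_one, smul_add, one_smul]
  rw [smul_smul]
  abel

/-- Discrete integration: subtract the monomial whose difference has the same leading term, and
induct on the degree. The difference equation must hold on all of `ℤ`, since at degree zero it has
to propagate in both directions. -/
lemma polyLT_of_diff {d : ℕ} {f : ℤ → V} (h : (fun k => f (k + 1) - f k) ∈ polyLT V d) :
    f ∈ polyLT V (d + 1) := by
  induction d generalizing f with
  | zero =>
    have h0 : ∀ k, f (k + 1) = f k := fun k => sub_eq_zero.1 (congrFun (polyLT_eq_zero h) k)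
    have h1 : ∀ k, f k = f 0 := by
      intro k
      induction k using Int.induction_on with
      | zero => rfl
      | succ i hi => rw [h0, hi]
      | pred i hi => rw [← hi, ← h0]; simp
    convert monomial_mem_polyLT (Nat.zero_lt_one) (f 0) using 1
    ext k; simp [h1 k]
  | succ d ih =>
    obtain ⟨c, hc⟩ := exists_polyLead h
    set c' : V := ((d : ℂ) + 1)⁻¹ • c with hc'
    have hd : ((d : ℂ) + 1) ≠ 0 := by exact_mod_cast Nat.succ_ne_zero d
    have hcc : ((d : ℂ) + 1) • c' = c := by rw [hc', smul_smul, mul_inv_cancel₀ hd, one_smul]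
    have h1 := polyLT_diff_monomial d c'
    rw [hcc] at h1
    have h2 : f - (fun k : ℤ => (k : ℂ) ^ (d + 1) • c') ∈ polyLT V (d + 1) := by
      apply ih
      refine (congrArg (· ∈ polyLT V d) ?_).mp (Submodule.sub_mem _ hc h1)
      ext k; simp; abel
    exact PolyLead.mem (c := c') h2

lemma PolyLead.of_diff {d : ℕ} {c : V} {f : ℤ → V}
    (h : PolyLead d (((d : ℂ) + 1) • c) (fun k => f (k + 1) - f k)) : PolyLead (d + 1) c f := by
  apply polyLT_of_diff
  refine (congrArg (· ∈ polyLT V d) ?_).mp (Submodule.sub_mem _ h (polyLT_diff_monomial d c))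
  ext k; simp; abel

/-- If `g` is a polynomial of degree `≤ p` with the parity of `p`, `p < 2 M`, then the weights of a
multiproduct formula extract the leading coefficient from the values `g k / k ^ p`. -/
lemma PolyLead.mpf_sum {M p : ℕ} (hp : p ≤ 2 * M) {k : Fin M → ℕ} {a : Fin M → ℝ}
    (ha : IsMPF k a) {c : V} {g : ℤ → V} (hg : PolyLead p c g)
    (hpar : ∀ r, g (-r) = (-1 : ℂ) ^ p • g r) (h0 : 0 < p → g 0 = 0) (hM : 0 < M) :
    ∑ j, ((a j : ℂ) * ((k j : ℂ)⁻¹) ^ p) • g (k j) = c := by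
  obtain ⟨b, hb⟩ := polyLT_eq_sum hg
  have hg' : ∀ r : ℤ, g r = (r : ℂ) ^ p • c + ∑ i ∈ Finset.range p, (r : ℂ) ^ i • b i := by
    intro r; rw [← hb r]; simp
  -- Averaging `g` with its reflection multiplies the coefficient of `r ^ i` by `(1 + (-1) ^ (p +
  -- i)) / 2`, which removes the wrong parity.
  have hsym : ∀ r : ℤ, g r = (r : ℂ) ^ p • c
      + ∑ i ∈ Finset.range p, ((1 + (-1) ^ (p + i)) / 2 * (r : ℂ) ^ i) • b i := by
    intro r
    have h1 : g r = (1 / 2 : ℂ) • (g r + (-1 : ℂ) ^ p • g (-r)) := by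
      rw [hpar, smul_smul, ← mul_pow]; simp [← two_smul ℂ (g r), smul_smul]
    rw [h1, hg' r, hg' (-r), smul_add ((-1 : ℂ) ^ p), Finset.smul_sum, smul_smul]
    rw [show ((1/2 : ℂ) • ((r : ℂ) ^ p • c + ∑ i ∈ Finset.range p, (r : ℂ) ^ i • b i
      + (((-1 : ℂ) ^ p * ((-r : ℤ) : ℂ) ^ p) • c
        + ∑ i ∈ Finset.range p, (-1 : ℂ) ^ p • ((-r : ℤ) : ℂ) ^ i • b i)))
      = ((1/2 : ℂ) * ((r : ℂ) ^ p + ((-1 : ℂ) ^ p * ((-r : ℤ) : ℂ) ^ p))) • c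
       + ((1/2 : ℂ) • ∑ i ∈ Finset.range p, (r : ℂ) ^ i • b i
        + (1/2 : ℂ) • ∑ i ∈ Finset.range p, (-1 : ℂ) ^ p • ((-r : ℤ) : ℂ) ^ i • b i) by
        module]
    congr 1
    · congr 1
      rw [← mul_pow]; push_cast; ring
    · rw [Finset.smul_sum, Finset.smul_sum, ← Finset.sum_add_distrib]
      refine Finset.sum_congr rfl fun i _ => ?_
      rw [smul_smul, smul_smul, smul_smul, ← add_smul]
      congr 1
      push_cast
      rw [neg_pow (r : ℂ) i, pow_add]; ring
  have hk : ∀ j, (k j : ℂ) ≠ 0 := fun j => by exact_mod_cast (ha.1 j).ne'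
  have hmom : ∀ i < M, ∑ j, (a j : ℂ) * ((k j : ℂ)⁻¹) ^ (2 * i) = if i = 0 then 1 else 0 := by
    intro i hi
    have := congrArg (fun x : ℝ => (x : ℂ)) (ha.2 i hi)
    simp only [Complex.ofReal_sum, Complex.ofReal_mul, Complex.ofReal_inv, Complex.ofReal_pow,
      Complex.ofReal_natCast] at this
    simp only [inv_pow]
    rw [this]; split_ifs <;> simp
  have h00 : ∑ j, (a j : ℂ) = 1 := by simpa using hmom 0 hM
  have hexp : ∀ j, ((a j : ℂ) * ((k j : ℂ)⁻¹) ^ p) • g (k j) = (a j : ℂ) • c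
      + ∑ i ∈ Finset.range p,
        (((a j : ℂ) * ((k j : ℂ)⁻¹) ^ (p - i)) * ((1 + (-1) ^ (p + i)) / 2)) • b i := by
    intro j
    rw [hsym, smul_add, smul_smul, Finset.smul_sum]
    congr 1
    · congr 1
      have := hk j
      push_cast
      rw [inv_pow, mul_assoc, inv_mul_cancel₀ (pow_ne_zero _ this), mul_one]
    · refine Finset.sum_congr rfl fun i hi => ?_
      rw [smul_smul]
      congr 1
      have := hk j
      have hi' := Finset.mem_range.1 hi
      obtain ⟨e, rfl⟩ := Nat.exists_eq_add_of_lt hi'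
      rw [show i + e + 1 - i = e + 1 by omega, show i + e + 1 = i + (e + 1) by omega, pow_add _ i]
      push_cast
      have h4 : ((k j : ℂ)⁻¹) ^ i * (k j : ℂ) ^ i = 1 := by
        rw [← mul_pow, inv_mul_cancel₀ this, one_pow]
      linear_combination ((a j : ℂ) * ((k j : ℂ)⁻¹) ^ (e + 1)
        * ((1 + (-1) ^ (i + (e + 1) + i)) / 2)) * h4
  rw [Finset.sum_congr rfl (fun j _ => hexp j), Finset.sum_add_distrib, ← Finset.sum_smul, h00,
    one_smul, Finset.sum_comm]
  rw [add_eq_left]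
  refine Finset.sum_eq_zero fun i hi => ?_
  have hi' := Finset.mem_range.1 hi
  rw [← Finset.sum_smul, ← Finset.sum_mul]
  -- For `0 < i < p` of the right parity, `p - i = 2 e` with `0 < e < M`, a moment that vanishes.
  -- The constant term is removed by `g 0 = 0` instead: for `p = 2 M` it would meet the moment of
  -- order `2 M`, which is not controlled.
  rcases Nat.even_or_odd (p + i) with he | ho
  · rcases Nat.eq_zero_or_pos i with rfl | hi0
    · have hp0 : 0 < p := hi'
      have h2 := h0 hp0
      have h3 := hg' 0
      rw [h2, Finset.sum_eq_single 0] at h3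
      · simp [hp0.ne'] at h3
        rw [← h3, smul_zero]
      · intro x _ hx; simp [hx]
      · intro hx; simp at hx; omega
    · obtain ⟨e, he'⟩ : ∃ e, p - i = 2 * e := by
        obtain ⟨s, hs⟩ := he
        exact ⟨s - i, by omega⟩
      rw [he', hmom e (by omega), if_neg (by omega)]
      simp
  · rw [ho.neg_one_pow]; simp

end Poly

/-! ### Taylor coefficients of entire functions -/

section Taylor

variable {V : Type*} [NormedRing V] [NormedAlgebra ℂ V]

/-- The `p`-th Taylor coefficient at `0`. -/
def tcoeff (p : ℕ) (f : ℂ → V) : V := ((p.factorial : ℂ)⁻¹) • iteratedDeriv p f 0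

lemma tcoeff_zero (f : ℂ → V) : tcoeff 0 f = f 0 := by simp [tcoeff]

lemma tcoeff_succ (p : ℕ) (f : ℂ → V) :
    ((p : ℂ) + 1) • tcoeff (p + 1) f = tcoeff p (deriv f) := by
  have : ((p : ℂ) + 1) ≠ 0 := by exact_mod_cast Nat.succ_ne_zero p
  rw [tcoeff, tcoeff, iteratedDeriv_succ', smul_smul, Nat.factorial_succ]
  congr 1
  push_cast
  field_simp

lemma tcoeff_comp_neg (p : ℕ) (f : ℂ → V) :
    tcoeff p (fun z => f (-z)) = (-1 : ℂ) ^ p • tcoeff p f := by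
  rw [tcoeff, iteratedDeriv_comp_neg, tcoeff, neg_zero, smul_comm]

lemma iteratedDeriv_smul_right (p : ℕ) {φ : ℂ → ℂ} (hφ : Differentiable ℂ φ) (v : V) (z : ℂ) :
    iteratedDeriv p (fun z => φ z • v) z = iteratedDeriv p φ z • v := by
  induction p generalizing φ with
  | zero => simp
  | succ p ih =>
    rw [iteratedDeriv_succ', iteratedDeriv_succ']
    have h : deriv (fun z => φ z • v) = fun z => deriv φ z • v := by
      ext z; exact ((hφ z).hasDerivAt.smul_const v).deriv
    rw [h, ih (hφ.contDiff.differentiable_deriv_two)]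

variable [CompleteSpace V]

lemma tcoeff_mul (p : ℕ) {f g : ℂ → V} (hf : Differentiable ℂ f) (hg : Differentiable ℂ g) :
    tcoeff p (f * g) = ∑ i ∈ Finset.range (p + 1), tcoeff i f * tcoeff (p - i) g := by
  rw [tcoeff, iteratedDeriv_mul hf.contDiff.contDiffAt hg.contDiff.contDiffAt, Finset.smul_sum]
  refine Finset.sum_congr rfl fun i hi => ?_
  have hi' := Nat.lt_succ_iff.1 (Finset.mem_range.1 hi)
  rw [tcoeff, tcoeff, smul_mul_smul_comm, ← nsmul_eq_mul, ← Nat.cast_smul_eq_nsmul ℂ,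
    smul_mul_assoc, smul_smul, Nat.cast_choose ℂ hi']
  congr 1
  have := Nat.factorial_ne_zero p
  have h3 : (p.factorial : ℂ) ≠ 0 := by exact_mod_cast this
  field_simp

lemma tcoeff_comp_mul (p : ℕ) {f : ℂ → V} (hf : Differentiable ℂ f) (c : ℂ) :
    tcoeff p (fun z => f (c * z)) = c ^ p • tcoeff p f := by
  rw [tcoeff, iteratedDeriv_comp_const_smul hf.contDiff, tcoeff]
  simp only [mul_zero]
  rw [smul_comm]

lemma tcoeff_sum {ι : Type*} (s : Finset ι) (p : ℕ) (c : ι → ℂ) {f : ι → ℂ → V}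
    (hf : ∀ i ∈ s, Differentiable ℂ (f i)) :
    tcoeff p (fun z => ∑ i ∈ s, c i • f i z) = ∑ i ∈ s, c i • tcoeff p (f i) := by
  have h : (fun z => ∑ i ∈ s, c i • f i z) = ∑ i ∈ s, c i • f i := by ext; simp
  rw [tcoeff, h, iteratedDeriv_sum (fun i hi => ((hf i hi).const_smul (c i)).contDiff.contDiffAt),
    Finset.smul_sum]
  refine Finset.sum_congr rfl fun i hi => ?_
  rw [iteratedDeriv_const_smul (hf i hi).contDiff.contDiffAt, smul_comm, tcoeff]

lemma tcoeff_monomial (p i : ℕ) (v : V) :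
    tcoeff p (fun z : ℂ => z ^ i • v) = if p = i then v else 0 := by
  rw [tcoeff, iteratedDeriv_smul_right p (by fun_prop), iteratedDeriv_fun_pow_zero]
  split_ifs with h
  · subst h
    have h3 : (p.factorial : ℂ) ≠ 0 := by exact_mod_cast Nat.factorial_ne_zero p
    rw [smul_smul, inv_mul_cancel₀ h3, one_smul]
  · simp

lemma tcoeff_poly (p n : ℕ) (v : ℕ → V) :
    tcoeff p (fun z : ℂ => ∑ i ∈ Finset.range n, z ^ i • v i) = if p < n then v p else 0 := by
  have := tcoeff_sum (Finset.range n) p (fun _ => 1) (f := fun i z => z ^ i • v i)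
    (fun i _ => by fun_prop)
  simp only [one_smul, tcoeff_monomial] at this
  rw [this]
  simp

/-- Cauchy's estimate for the Taylor remainder at `1` of an entire function bounded by `B` on the
disc of radius `ρ ≥ 2`. -/
lemma norm_taylor_remainder_le {f : ℂ → V} (hf : Differentiable ℂ f) {x B : ℝ} (hx : 0 < x)
    (hx2 : x ≤ 1 / 2) (hB : ∀ z : ℂ, ‖z‖ ≤ x⁻¹ → ‖f z‖ ≤ B) (N : ℕ) :
    ‖f 1 - ∑ p ∈ Finset.range N, tcoeff p f‖ ≤ 2 * B * x ^ N := by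
  have hB0 : 0 ≤ B := (norm_nonneg _).trans (hB 0 (by simp; positivity))
  have hc : ∀ p, ‖tcoeff p f‖ ≤ B * x ^ p := by
    intro p
    have h := Complex.norm_iteratedDeriv_le_of_forall_mem_sphere_norm_le (c := 0) (f := f) p
      (inv_pos.2 hx) hf.diffContOnCl (fun z hz => hB z (by simpa using (mem_sphere_zero_iff_norm.1 hz).le))
    rw [tcoeff, norm_smul, norm_inv, Complex.norm_natCast]
    have h3 : (0 : ℝ) < p.factorial := by exact_mod_cast Nat.factorial_pos p
    calc _ ≤ (p.factorial : ℝ)⁻¹ * (p.factorial * B / x⁻¹ ^ p) := by gcongr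
      _ = B * x ^ p := by rw [inv_pow]; field_simp
  have hs : HasSum (fun p => tcoeff p f) (f 1) := by
    simpa [tcoeff] using Complex.hasSum_taylorSeries_of_entire hf 0 1
  have h1 := (hasSum_nat_add_iff' N).2 hs
  have hg : HasSum (fun n => B * x ^ (n + N)) (B * x ^ N * (1 - x)⁻¹) := by
    have := (hasSum_geometric_of_lt_one hx.le (by linarith : x < 1)).mul_left (B * x ^ N)
    refine (congrArg (HasSum · _) ?_).mp this
    ext n; ring
  have h2 := tsum_of_norm_bounded hg (fun n => hc (n + N))
  rw [h1.tsum_eq] at h2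
  refine h2.trans ?_
  have : (1 - x)⁻¹ ≤ 2 := by
    rw [inv_le_comm₀ (by linarith) (by norm_num)]; linarith
  calc _ ≤ B * x ^ N * 2 := by gcongr
    _ = _ := by ring

/-! ### Families of near-identity functions with polynomial Taylor coefficients -/

/-- Entire functions `f r`, `r ∈ ℤ`, with `f r 0 = 1`, whose Taylor coefficient of order `p + 1` is
a polynomial in `r` of degree `p` with leading coefficient `A p`. -/
def NearId (A : ℕ → V) (f : ℤ → ℂ → V) : Prop :=
  (∀ r, Differentiable ℂ (f r)) ∧ (∀ r, f r 0 = 1) ∧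
    ∀ p, PolyLead p (A p) (fun r => tcoeff (p + 1) (f r))

lemma nearId_one : NearId 0 (fun _ _ => (1 : V)) := by
  refine ⟨fun r => by fun_prop, fun r => rfl, fun p => ?_⟩
  have h : (fun r : ℤ => tcoeff (p + 1) (fun _ : ℂ => (1 : V))) = 0 := by
    ext r
    have := tcoeff_monomial (p + 1) 0 (1 : V)
    simpa using this
  rw [h]
  exact PolyLead.of_mem (Submodule.zero_mem _)

/-- Besides the two outer terms, the coefficient of order `p + 1` contains products of coefficients
of orders `i + 1` and `p - i`, of degree at most `i + (p - i - 1) = p - 1` in `r`. They do not reach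
the leading coefficients, which therefore add even though the factors do not commute. -/
lemma NearId.mul {A A' : ℕ → V} {f g : ℤ → ℂ → V} (hf : NearId A f) (hg : NearId A' g) :
    NearId (A + A') (f * g) := by
  refine ⟨fun r => (hf.1 r).mul (hg.1 r), fun r => by simp [hf.2.1, hg.2.1], fun p => ?_⟩
  have h : (fun r => tcoeff (p + 1) ((f * g) r)) = ((fun r => tcoeff (p + 1) (f r))
      + fun r => tcoeff (p + 1) (g r))
      + ∑ i ∈ Finset.range p, (fun r => tcoeff (i + 1) (f r)) * fun r => tcoeff (p - i) (g r) := by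
    ext r
    rw [Pi.mul_apply, tcoeff_mul _ (hf.1 r) (hg.1 r), Finset.sum_range_succ, Finset.sum_range_succ']
    simp only [Nat.sub_zero, Nat.sub_self, tcoeff_zero, hf.2.1, hg.2.1, one_mul, mul_one,
      Pi.add_apply, Finset.sum_apply, Pi.mul_apply, Nat.add_sub_add_right]
    abel
  rw [h, ← add_zero ((A + A') p)]
  refine ((hf.2.2 p).add (hg.2.2 p)).add (PolyLead.of_mem (Submodule.sum_mem _ fun i hi => ?_))
  obtain ⟨q, rfl⟩ := Nat.exists_eq_add_of_lt (Finset.mem_range.1 hi)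
  have := (mul_mem_polyLT (hf.2.2 i).mem (hg.2.2 q).mem).1
  rwa [show i + q + 1 - i = q + 1 by omega]

lemma NearId.list_prod {ι : Type*} {A : ι → ℕ → V} {f : ι → ℤ → ℂ → V}
    (h : ∀ i, NearId (A i) (f i)) (l : List ι) :
    NearId (l.map A).sum (l.map f).prod := by
  induction l with
  | nil => exact nearId_one
  | cons i l ih => simpa using (h i).mul ih

/-- `exp (z p(c z) B)` for the polynomial `p` with coefficients `a i`, `i < n`. -/
def polyExp (n : ℕ) (a : ℕ → ℂ) (B : V) (c z : ℂ) : V :=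
  NormedSpace.exp ((∑ i ∈ Finset.range n, a i * c ^ i * z ^ (i + 1)) • B)

lemma hasDerivAt_polyExp (n : ℕ) (a : ℕ → ℂ) (B : V) (c z : ℂ) :
    HasDerivAt (polyExp n a B c)
      ((∑ i ∈ Finset.range n, z ^ i • (((i : ℂ) + 1) * (a i * c ^ i)) • B) * polyExp n a B c z) z := by
  have h1 : HasDerivAt (fun z : ℂ => ∑ i ∈ Finset.range n, a i * c ^ i * z ^ (i + 1))
      (∑ i ∈ Finset.range n, a i * c ^ i * (((i + 1 : ℕ) : ℂ) * z ^ i)) z := by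
    refine HasDerivAt.fun_sum fun i _ => HasDerivAt.const_mul _ ?_
    simpa using hasDerivAt_pow (i + 1) z
  have h2 := (hasDerivAt_exp_smul_const' (𝕂 := ℂ) B
    (∑ i ∈ Finset.range n, a i * c ^ i * z ^ (i + 1))).scomp z h1
  refine h2.congr_deriv ?_
  rw [polyExp, ← smul_mul_assoc, Finset.sum_smul]
  congr 1
  refine Finset.sum_congr rfl fun i _ => ?_
  rw [smul_smul]; congr 1; push_cast; ring

/-- The differential equation of the exponential gives a recursion for its Taylor coefficients. Its
last term is `(p + 1) a_p (r + x) ^ p B`; by induction the other terms have degree below `p` in `r`.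
-/
lemma nearId_polyExp (n : ℕ) (a : ℕ → ℂ) (B : V) (x : ℂ) :
    NearId (fun i => if i < n then a i • B else 0) (fun r => polyExp n a B ((r : ℂ) + x)) := by
  have hd : ∀ c, Differentiable ℂ (polyExp n a B c) :=
    fun c z => (hasDerivAt_polyExp n a B c z).differentiableAt
  have h0 : ∀ c, polyExp n a B c 0 = 1 := fun c => by simp [polyExp]
  have hrec : ∀ (c : ℂ) (p : ℕ), ((p : ℂ) + 1) • tcoeff (p + 1) (polyExp n a B c) =
      ∑ i ∈ Finset.range (p + 1), (if i < n then (((i : ℂ) + 1) * (a i * c ^ i)) • B else 0)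
        * tcoeff (p - i) (polyExp n a B c) := by
    intro c p
    have hderiv : deriv (polyExp n a B c) =
        (fun z : ℂ => ∑ i ∈ Finset.range n, z ^ i • (((i : ℂ) + 1) * (a i * c ^ i)) • B)
          * polyExp n a B c := by
      ext z; exact (hasDerivAt_polyExp n a B c z).deriv
    rw [tcoeff_succ, hderiv, tcoeff_mul p (by fun_prop) (hd c)]
    simp only [tcoeff_poly]
  refine ⟨fun r => hd _, fun r => h0 _, fun p => ?_⟩
  induction p using Nat.strong_induction_on with
  | _ p ih =>
    have hp : ((p : ℂ) + 1) ≠ 0 := by exact_mod_cast Nat.succ_ne_zero p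
    have hl : ∀ i, PolyLead i (if i < n then (((i : ℂ) + 1) * a i) • B else 0)
        (fun r : ℤ => if i < n then (((i : ℂ) + 1) * (a i * ((r : ℂ) + x) ^ i)) • B else 0) := by
      intro i
      split_ifs with h
      · convert polyLead_shift_pow i x ((((i : ℂ) + 1) * a i) • B) using 1
        ext r; rw [smul_smul]; congr 1; ring
      · exact PolyLead.of_mem (Submodule.zero_mem _)
    have h : (fun r : ℤ => tcoeff (p + 1) (polyExp n a B ((r : ℂ) + x))) = ((p : ℂ) + 1)⁻¹ •
        ((fun r : ℤ => if p < n then (((p : ℂ) + 1) * (a p * ((r : ℂ) + x) ^ p)) • B else 0)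
        + ∑ i ∈ Finset.range p,
          (fun r : ℤ => if i < n then (((i : ℂ) + 1) * (a i * ((r : ℂ) + x) ^ i)) • B else 0)
          * fun r : ℤ => tcoeff (p - i) (polyExp n a B ((r : ℂ) + x))) := by
      ext r
      have := hrec ((r : ℂ) + x) p
      rw [Finset.sum_range_succ, Nat.sub_self, tcoeff_zero, h0, mul_one] at this
      simp only [Pi.smul_apply, Pi.add_apply, Finset.sum_apply, Pi.mul_apply]
      rw [eq_inv_smul_iff₀ hp, this]
      exact add_comm _ _
    rw [h]
    have h1 := ((hl p).add (PolyLead.of_mem (Submodule.sum_mem (polyLT V p) (t := Finset.range p)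
      (f := fun i => (fun r : ℤ => if i < n then (((i : ℂ) + 1) * (a i * ((r : ℂ) + x) ^ i)) • B else 0)
          * fun r : ℤ => tcoeff (p - i) (polyExp n a B ((r : ℂ) + x))) fun i hi => by
        obtain ⟨q, rfl⟩ := Nat.exists_eq_add_of_lt (Finset.mem_range.1 hi)
        have := (mul_mem_polyLT (hl i).mem (ih q (by omega)).mem).1
        rwa [show i + q + 1 - i = q + 1 by omega]))).smul ((p : ℂ) + 1)⁻¹
    change PolyLead p (if p < n then a p • B else 0) _
    convert h1 using 1
    split_ifs
    · rw [add_zero, smul_smul, ← mul_assoc, inv_mul_cancel₀ hp, one_mul]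
    · simp

/-! ### Products of steps, continued to negative step numbers -/

/-- `S (k - 1) z * ⋯ * S 0 z`. -/
def stepProd (S : ℤ → ℂ → V) : ℕ → ℂ → V
  | 0 => 1
  | k + 1 => S k * stepProd S k

/-- The extension of `stepProd S` to `k ∈ ℤ` by `stepProd S (-k) z = stepProd S k (-z)`. -/
def stepProdInt (S : ℤ → ℂ → V) : ℤ → ℂ → V
  | .ofNat k => stepProd S k
  | .negSucc k => fun z => stepProd S (k + 1) (-z)

lemma stepProdInt_natCast (S : ℤ → ℂ → V) (k : ℕ) : stepProdInt S k = stepProd S k := rfl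

lemma stepProdInt_neg_natCast (S : ℤ → ℂ → V) (k : ℕ) :
    stepProdInt S (-(k : ℤ)) = fun z => stepProd S k (-z) := by
  cases k with
  | zero => ext z; simp [stepProdInt, stepProd]
  | succ k => rfl

lemma stepProdInt_neg (S : ℤ → ℂ → V) (k : ℤ) :
    stepProdInt S (-k) = fun z => stepProdInt S k (-z) := by
  obtain ⟨m, rfl | rfl⟩ := Int.eq_nat_or_neg k
  · rw [stepProdInt_neg_natCast, stepProdInt_natCast]
  · ext z; rw [neg_neg, stepProdInt_neg_natCast, stepProdInt_natCast]; simp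

/-- At negative integers this is time symmetry: the factor `S (-k - 1) z` cancels the outermost
factor `S k (-z)` of the reflected product. -/
lemma stepProdInt_succ {S : ℤ → ℂ → V} (hS : ∀ r z, S (-r - 1) z * S r (-z) = 1) (k : ℤ) :
    stepProdInt S (k + 1) = S k * stepProdInt S k := by
  cases k with
  | ofNat k => rfl
  | negSucc k =>
    have h1 : Int.negSucc k + 1 = -(k : ℤ) := by rw [Int.negSucc_eq]; ring
    have h2 : Int.negSucc k = -(k : ℤ) - 1 := by rw [Int.negSucc_eq]; ring
    rw [h1, stepProdInt_neg_natCast]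
    ext z
    have : stepProdInt S (Int.negSucc k) z = S k (-z) * stepProd S k (-z) := rfl
    rw [Pi.mul_apply, this, h2, ← mul_assoc, hS, one_mul]

lemma stepProd_differentiable {S : ℤ → ℂ → V} (hS : ∀ r, Differentiable ℂ (S r)) (k : ℕ) :
    Differentiable ℂ (stepProd S k) := by
  induction k with
  | zero => exact differentiable_const (1 : V)
  | succ k ih => exact (hS k).mul ih

lemma stepProdInt_differentiable {S : ℤ → ℂ → V} (hS : ∀ r, Differentiable ℂ (S r)) (k : ℤ) :
    Differentiable ℂ (stepProdInt S k) := by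
  cases k with
  | ofNat k => exact stepProd_differentiable hS k
  | negSucc k => exact (stepProd_differentiable hS (k + 1)).comp differentiable_neg

/-- Taylor coefficients of the solution of `u' = (∑ i, A i z ^ i) u`, `u 0 = 1`. -/
def odeCoeff (A : ℕ → V) : ℕ → V
  | 0 => 1
  | p + 1 => ((p : ℂ) + 1)⁻¹ • ∑ i : Fin (p + 1), A i * odeCoeff A (p - i)
  decreasing_by omega

lemma odeCoeff_succ (A : ℕ → V) (p : ℕ) : ((p : ℂ) + 1) • odeCoeff A (p + 1)
    = ∑ i ∈ Finset.range (p + 1), A i * odeCoeff A (p - i) := by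
  have hp : ((p : ℂ) + 1) ≠ 0 := by exact_mod_cast Nat.succ_ne_zero p
  rw [odeCoeff, smul_smul, mul_inv_cancel₀ hp, one_smul,
    Finset.sum_range (fun i => A i * odeCoeff A (p - i))]

/-- Since `S k 0 = 1`, one more step changes the coefficient of order `p + 1` by a sum of products
of degree `i + (p - i) = p`. Their leading coefficients sum to `(p + 1) * odeCoeff A (p + 1)`, by
the recursion of the differential equation, and discrete integration divides by `p + 1`. -/
lemma stepProdInt_polyLead {A : ℕ → V} {S : ℤ → ℂ → V} (hA : NearId A S)
    (hS : ∀ r z, S (-r - 1) z * S r (-z) = 1) (p : ℕ) :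
    PolyLead p (odeCoeff A p) (fun k => tcoeff p (stepProdInt S k)) := by
  induction p using Nat.strong_induction_on with
  | _ p ih =>
    cases p with
    | zero =>
      have h : (fun k => tcoeff 0 (stepProdInt S k)) = fun _ => (1 : V) := by
        have h1 : ∀ k : ℕ, stepProd S k 0 = 1 := by
          intro k
          induction k with
          | zero => rfl
          | succ k ih => rw [stepProd, Pi.mul_apply, ih, hA.2.1, one_mul]
        ext k
        rw [tcoeff_zero]
        cases k with
        | ofNat k => exact h1 k
        | negSucc k => simpa [stepProdInt] using h1 (k + 1)
      rw [h, odeCoeff]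
      exact polyLead_const 1
    | succ p =>
      apply PolyLead.of_diff
      have h : (fun k => tcoeff (p + 1) (stepProdInt S (k + 1)) - tcoeff (p + 1) (stepProdInt S k))
          = ∑ i ∈ Finset.range (p + 1), (fun k => tcoeff (i + 1) (S k))
            * fun k => tcoeff (p - i) (stepProdInt S k) := by
        ext k
        rw [stepProdInt_succ hS, tcoeff_mul _ (hA.1 k) (stepProdInt_differentiable hA.1 k),
          Finset.sum_range_succ']
        simp [tcoeff_zero, hA.2.1]
      rw [h, odeCoeff_succ]
      refine PolyLead.sum fun i hi => ?_
      have hi' := Nat.lt_succ_iff.1 (Finset.mem_range.1 hi)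
      have := (hA.2.2 i).mul (ih (p - i) (by omega))
      rwa [Nat.add_sub_cancel' hi'] at this

/-- The multiproduct combination of time-symmetric products has the Taylor coefficients of the
solution of the limiting differential equation, up to order `2 M`. -/
lemma tcoeff_mpf {A : ℕ → V} {S : ℤ → ℂ → V} (hA : NearId A S)
    (hS : ∀ r z, S (-r - 1) z * S r (-z) = 1) {M p : ℕ} (hM : 0 < M) (hp : p ≤ 2 * M)
    {k : Fin M → ℕ} {a : Fin M → ℝ} (ha : IsMPF k a) :
    tcoeff p (fun z => ∑ j, (a j : ℂ) • stepProd S (k j) ((k j : ℂ)⁻¹ * z)) = odeCoeff A p := by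
  have hd : ∀ j, Differentiable ℂ (fun z => stepProd S (k j) ((k j : ℂ)⁻¹ * z)) := fun j =>
    (stepProd_differentiable hA.1 (k j)).comp (differentiable_id.const_mul _)
  rw [tcoeff_sum _ _ _ fun j _ => hd j]
  rw [← (stepProdInt_polyLead hA hS p).mpf_sum hp ha (fun r => ?_) (fun h0 => ?_) hM]
  · refine Finset.sum_congr rfl fun j _ => ?_
    rw [tcoeff_comp_mul _ (stepProd_differentiable hA.1 _), smul_smul, stepProdInt_natCast]
  · rw [stepProdInt_neg, tcoeff_comp_neg]
  -- The empty product is constant, so its Taylor coefficients of positive order vanish.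
  · have : stepProdInt S 0 = fun z : ℂ => z ^ 0 • (1 : V) := by ext; simp [stepProdInt, stepProd]
    rw [this, tcoeff_monomial, if_neg h0.ne']

end Taylor

/-! ### Symmetric product formulas with polynomial coefficients -/

section Strang

variable {V : Type*} [NormedRing V] [NormedAlgebra ℂ V] [CompleteSpace V]

lemma list_map_prod_apply₂ {ι : Type*} (f : ι → ℤ → ℂ → V) (l : List ι) (r : ℤ) (z : ℂ) :
    (l.map f).prod r z = (l.map fun i => f i r z).prod := by
  induction l with
  | nil => rfl
  | cons i l ih => simp [ih]

lemma list_map_prod_mul_reverse {ι : Type*} (f g : ι → V) (h : ∀ i, f i * g i = 1) (l : List ι) :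
    (l.map f).prod * (l.reverse.map g).prod = 1 := by
  induction l with
  | nil => simp
  | cons i l ih =>
    simp only [List.map_cons, List.prod_cons, List.reverse_cons, List.map_append, List.prod_append,
      List.map_nil, List.prod_nil, mul_one]
    rw [mul_assoc, ← mul_assoc _ _ (g i), ih, one_mul, h]

/-- The order of the exponentials in one step of the second-order product formula. -/
def palindrome (L : ℕ) : List (Fin L) := List.finRange L ++ (List.finRange L).reverse

lemma palindrome_reverse (L : ℕ) : (palindrome L).reverse = palindrome L := by
  simp [palindrome]

lemma sum_palindrome {L : ℕ} {W : Type*} [AddCommMonoid W] (f : Fin L → W) :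
    ((palindrome L).map f).sum = 2 • ∑ l, f l := by
  rw [palindrome, List.map_append, List.sum_append, List.map_reverse, List.sum_reverse,
    ← Fin.sum_univ_def, two_nsmul]

/-- One step of the symmetric product formula of step size `z`, with coefficients evaluated at the
midpoint `(r + 1 / 2) z`. -/
def symStep (n : ℕ) {L : ℕ} (a : Fin L → ℕ → ℂ) (B : Fin L → V) : ℤ → ℂ → V :=
  ((palindrome L).map fun l (r : ℤ) => polyExp n (a l) ((1 / 2 : ℂ) • B l) ((r : ℂ) + 1 / 2)).prod

/-- Coefficients of the generator `∑ l, p_l(z) B l`. -/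
def genCoeff (n : ℕ) {L : ℕ} (a : Fin L → ℕ → ℂ) (B : Fin L → V) (i : ℕ) : V :=
  if i < n then ∑ l, a l i • B l else 0

lemma nearId_symStep (n : ℕ) {L : ℕ} (a : Fin L → ℕ → ℂ) (B : Fin L → V) :
    NearId (genCoeff n a B) (symStep n a B) := by
  have h := NearId.list_prod (fun l => nearId_polyExp n (a l) ((1 / 2 : ℂ) • B l) (1 / 2))
    (palindrome L)
  refine (congrArg (NearId · _) ?_).mp h
  symm
  ext i
  rw [sum_palindrome]
  simp only [genCoeff, Pi.smul_apply, Finset.sum_apply]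
  split_ifs
  · rw [Finset.smul_sum]
    refine Finset.sum_congr rfl fun l _ => ?_
    rw [← Nat.cast_smul_eq_nsmul ℂ, smul_smul, smul_smul]; congr 1; push_cast; ring
  · simp

/-- The midpoints `(-r - 1) + 1 / 2` and `r + 1 / 2` are opposite, so each exponent changes sign; as
the order of the factors is a palindrome, the second product is the inverse of the first. -/
lemma symStep_symm (n : ℕ) {L : ℕ} (a : Fin L → ℕ → ℂ) (B : Fin L → V) (r : ℤ) (z : ℂ) :
    symStep n a B (-r - 1) z * symStep n a B r (-z) = 1 := by
  rw [symStep, list_map_prod_apply₂, list_map_prod_apply₂]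
  nth_rw 2 [← palindrome_reverse]
  refine list_map_prod_mul_reverse _ _ (fun l => ?_) _
  rw [polyExp, polyExp]
  have h : (∑ i ∈ Finset.range n, a l i * ((r : ℂ) + 1 / 2) ^ i * (-z) ^ (i + 1))
    = -∑ i ∈ Finset.range n, a l i * (((-r - 1 : ℤ) : ℂ) + 1 / 2) ^ i * z ^ (i + 1) := by
    rw [← Finset.sum_neg_distrib]
    refine Finset.sum_congr rfl fun i _ => ?_
    rw [show (((-r - 1 : ℤ) : ℂ) + 1 / 2) = -((r : ℂ) + 1 / 2) by push_cast; ring,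
      neg_pow ((r : ℂ) + 1 / 2), neg_pow z, pow_succ]
    ring
  rw [h, neg_smul]
  set X := (∑ i ∈ Finset.range n, a l i * (((-r - 1 : ℤ) : ℂ) + 1 / 2) ^ i * z ^ (i + 1))
    • (1 / 2 : ℂ) • B l
  let _ : NormedAlgebra ℚ V := NormedAlgebra.restrictScalars ℚ ℂ V
  rw [← NormedSpace.exp_add_of_commute (Commute.neg_right (Commute.refl X))]
  simp

variable [NormOneClass V]

/-! ### Bounds on the disc of radius `x⁻¹` -/

lemma norm_exp_le_exp_norm (X : V) : ‖(NormedSpace.exp X : V)‖ ≤ Real.exp ‖X‖ := by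
  rw [Real.exp_eq_exp_ℝ, NormedSpace.exp_eq_tsum ℂ, NormedSpace.exp_eq_tsum ℝ]
  refine tsum_of_norm_bounded (NormedSpace.expSeries_summable' (𝕂 := ℝ) ‖X‖).hasSum fun n => ?_
  rw [norm_smul, smul_eq_mul, norm_inv, Complex.norm_natCast]
  gcongr
  exact norm_pow_le X n

lemma norm_list_prod_le_exp {ι : Type*} (f : ι → V) (c : ι → ℝ) (h : ∀ i, ‖f i‖ ≤ Real.exp (c i))
    (l : List ι) : ‖(l.map f).prod‖ ≤ Real.exp ((l.map c).sum) := by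
  induction l with
  | nil => simp
  | cons i l ih =>
    rw [List.map_cons, List.map_cons, List.prod_cons, List.sum_cons, Real.exp_add]
    exact (norm_mul_le _ _).trans (mul_le_mul (h i) ih (norm_nonneg _) (Real.exp_pos _).le)

/-- The midpoint factor is at most `k ^ i` and the step factor at most `(k x) ^ (-(i + 1))`, which
leaves `x ^ (-(i + 1)) / k`. Summing over the terms compensates `x ^ (i + 1)`, so each of the `n`
orders contributes `1 / k` to the exponent and `k` steps cost `e ^ n`, whatever `k` is. -/
lemma norm_symStep_le {n L : ℕ} {a : Fin L → ℕ → ℂ} {B : Fin L → V} {x : ℝ} (hx : 0 < x)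
    (h : ∀ i < n, ∑ l, ‖a l i‖ * ‖B l‖ ≤ x ^ (i + 1)) {k r : ℕ} (hr : r < k) {z : ℂ}
    (hz : ‖z‖ ≤ x⁻¹) : ‖symStep n a B r ((k : ℂ)⁻¹ * z)‖ ≤ Real.exp (n / k) := by
  have hk : (0 : ℝ) < k := by exact_mod_cast (Nat.zero_le r).trans_lt hr
  rw [symStep, list_map_prod_apply₂]
  have hc : ‖(((r : ℤ) : ℂ) + 1 / 2)‖ ≤ k := by
    refine (norm_add_le _ _).trans ?_
    have : (r : ℝ) + 1 ≤ k := by exact_mod_cast hr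
    simp; linarith
  refine (norm_list_prod_le_exp _ (fun l => (∑ i ∈ Finset.range n, ‖a l i‖ * (x⁻¹ ^ (i + 1) / k))
    * (1 / 2 * ‖B l‖)) (fun l => ?_) _).trans ?_
  · refine (norm_exp_le_exp_norm _).trans (Real.exp_le_exp.2 ?_)
    rw [norm_smul, norm_smul]
    have : ‖(1 / 2 : ℂ)‖ = 1 / 2 := by simp
    rw [this]
    gcongr
    refine (norm_sum_le _ _).trans (Finset.sum_le_sum fun i _ => ?_)
    rw [norm_mul, norm_mul, norm_pow, norm_pow, norm_mul, norm_inv, Complex.norm_natCast, mul_assoc]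
    gcongr
    calc ‖(((r : ℤ) : ℂ) + 1 / 2)‖ ^ i * ((k : ℝ)⁻¹ * ‖z‖) ^ (i + 1)
        ≤ (k : ℝ) ^ i * ((k : ℝ)⁻¹ * x⁻¹) ^ (i + 1) := by gcongr
      _ = x⁻¹ ^ (i + 1) / k := by
        rw [mul_pow, pow_succ (k : ℝ)⁻¹, inv_pow (k : ℝ)]; field_simp
  · rw [sum_palindrome]
    refine Real.exp_le_exp.2 ?_
    have h1 : (2 • ∑ l, (∑ i ∈ Finset.range n, ‖a l i‖ * (x⁻¹ ^ (i + 1) / k)) * (1 / 2 * ‖B l‖))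
        = ∑ i ∈ Finset.range n, (x⁻¹ ^ (i + 1) / k) * ∑ l, ‖a l i‖ * ‖B l‖ := by
      simp only [Finset.mul_sum, Finset.sum_mul, Finset.smul_sum]
      rw [Finset.sum_comm]
      refine Finset.sum_congr rfl fun i _ => Finset.sum_congr rfl fun l _ => ?_
      simp only [nsmul_eq_mul]; push_cast; ring
    rw [h1]
    calc _ ≤ ∑ i ∈ Finset.range n, (x⁻¹ ^ (i + 1) / k) * x ^ (i + 1) :=
          Finset.sum_le_sum fun i hi => by
            have := h i (Finset.mem_range.1 hi)
            gcongr
      _ = ∑ i ∈ Finset.range n, 1 / (k : ℝ) := by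
          refine Finset.sum_congr rfl fun i _ => ?_
          rw [inv_pow]; field_simp
      _ = n / k := by simp; ring

lemma norm_stepProd_symStep_le {n L : ℕ} {a : Fin L → ℕ → ℂ} {B : Fin L → V} {x : ℝ} (hx : 0 < x)
    (h : ∀ i < n, ∑ l, ‖a l i‖ * ‖B l‖ ≤ x ^ (i + 1)) {k : ℕ} (hk : 0 < k) {z : ℂ}
    (hz : ‖z‖ ≤ x⁻¹) : ‖stepProd (symStep n a B) k ((k : ℂ)⁻¹ * z)‖ ≤ Real.exp n := by
  have hk' : (k : ℝ) ≠ 0 := by exact_mod_cast hk.ne'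
  have : ∀ r ≤ k, ‖stepProd (symStep n a B) r ((k : ℂ)⁻¹ * z)‖ ≤ Real.exp (r * (n / k)) := by
    intro r hr
    induction r with
    | zero => simp [stepProd]
    | succ r ih =>
      rw [stepProd, Pi.mul_apply, Nat.cast_succ, add_mul, one_mul, add_comm, Real.exp_add]
      exact (norm_mul_le _ _).trans (mul_le_mul (norm_symStep_le hx h hr hz) (ih (by omega))
        (norm_nonneg _) (Real.exp_pos _).le)
  have h1 := this k le_rfl
  rwa [mul_div_cancel₀ _ hk'] at h1

/-- A multiproduct combination of symmetric product formulas agrees with the Taylor polynomial of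
the exact evolution up to order `2 M`. -/
theorem norm_mpf_sub_taylor_le {M L : ℕ} (hM : 0 < M) {k : Fin M → ℕ} {w : Fin M → ℝ}
    (hw : IsMPF k w) {a : Fin L → ℕ → ℂ} {B : Fin L → V} {x : ℝ} (hx : 0 < x) (hx2 : x ≤ 1 / 2)
    (h : ∀ i < 2 * M, ∑ l, ‖a l i‖ * ‖B l‖ ≤ x ^ (i + 1)) :
    ‖∑ j, (w j : ℂ) • stepProd (symStep (2 * M) a B) (k j) ((k j : ℂ)⁻¹)
        - ∑ p ∈ Finset.range (2 * M + 1), odeCoeff (genCoeff (2 * M) a B) p‖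
      ≤ 2 * (l1norm w * Real.exp (2 * M)) * x ^ (2 * M + 1) := by
  set S := symStep (2 * M) a B
  have hA : NearId (genCoeff (2 * M) a B) S := nearId_symStep (2 * M) a B
  have hd' : ∀ j, Differentiable ℂ (fun z => stepProd S (k j) ((k j : ℂ)⁻¹ * z)) := fun j =>
    (stepProd_differentiable hA.1 (k j)).comp (differentiable_id.const_mul _)
  have hd : Differentiable ℂ (fun z => ∑ j, (w j : ℂ) • stepProd S (k j) ((k j : ℂ)⁻¹ * z)) :=
    Differentiable.fun_sum fun j _ => (hd' j).fun_const_smul (w j : ℂ)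
  have h1 := norm_taylor_remainder_le hd hx hx2 (B := l1norm w * Real.exp (2 * M)) (fun z hz => ?_)
    (2 * M + 1)
  · rw [Finset.sum_congr rfl fun p hp => tcoeff_mpf hA (symStep_symm (2 * M) a B) hM
      (Nat.lt_succ_iff.1 (Finset.mem_range.1 hp)) hw] at h1
    simpa only [mul_one] using h1
  · refine (norm_sum_le _ _).trans ?_
    rw [l1norm, Finset.sum_mul]
    refine Finset.sum_le_sum fun j _ => ?_
    rw [norm_smul, Complex.norm_real, Real.norm_eq_abs]
    have := norm_stepProd_symStep_le hx h (hw.1 j) hz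
    push_cast at this
    gcongr

/-! ### Taylor polynomial of the exact evolution -/

lemma norm_genCoeff_le {n L : ℕ} {a : Fin L → ℕ → ℂ} {B : Fin L → V} {x : ℝ} (hx : 0 < x)
    (h : ∀ i < n, ∑ l, ‖a l i‖ * ‖B l‖ ≤ x ^ (i + 1)) (i : ℕ) :
    ‖genCoeff n a B i‖ ≤ x ^ (i + 1) := by
  rw [genCoeff]
  split_ifs with hi
  · refine (norm_sum_le _ _).trans ((Finset.sum_le_sum fun l _ => ?_).trans (h i hi))
    exact (norm_smul _ _).le
  · simp; positivity

/-- The recursion has `p + 1` terms of size at most `x ^ (p + 1)`, and its factor `p + 1` on the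
left compensates their number. -/
lemma norm_odeCoeff_le {A : ℕ → V} {x : ℝ} (hx : 0 < x) (h : ∀ i, ‖A i‖ ≤ x ^ (i + 1)) (p : ℕ) :
    ‖odeCoeff A p‖ ≤ x ^ p := by
  induction p using Nat.strong_induction_on with
  | _ p ih =>
    cases p with
    | zero => simp [odeCoeff]
    | succ p =>
      have hp : (0 : ℝ) < (p : ℝ) + 1 := by positivity
      have h1 := congrArg norm (odeCoeff_succ A p)
      rw [norm_smul, show ‖((p : ℂ) + 1)‖ = (p : ℝ) + 1 by
        exact_mod_cast Complex.norm_natCast (p + 1)] at h1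
      refine le_of_mul_le_mul_left ?_ hp
      rw [h1]
      refine (norm_sum_le _ _).trans ?_
      calc _ ≤ ∑ i ∈ Finset.range (p + 1), x ^ (p + 1) := by
            refine Finset.sum_le_sum fun i hi => ?_
            have hi' := Nat.lt_succ_iff.1 (Finset.mem_range.1 hi)
            calc _ ≤ x ^ (i + 1) * x ^ (p - i) := (norm_mul_le _ _).trans
                  (mul_le_mul (h i) (ih _ (by omega)) (norm_nonneg _) (by positivity))
              _ = x ^ (p + 1) := by rw [← pow_add]; congr 1; omega
        _ = _ := by simp

/-- Residual of the Taylor polynomial in the differential equation. -/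
lemma norm_ode_residual_le {A : ℕ → V} {x : ℝ} (hx : 0 < x) (hx2 : x ≤ 1 / 2)
    (h : ∀ i, ‖A i‖ ≤ x ^ (i + 1)) (n : ℕ) {s : ℝ} (hs : s ∈ Set.Icc (0 : ℝ) 1) :
    ‖∑ p ∈ Finset.range n, (s : ℂ) ^ p • (((p : ℂ) + 1) • odeCoeff A (p + 1))
      - (∑ i ∈ Finset.range n, (s : ℂ) ^ i • A i)
        * ∑ p ∈ Finset.range (n + 1), (s : ℂ) ^ p • odeCoeff A p‖ ≤ n * (n + 1) * x ^ (n + 1) := by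
  set g : ℕ → ℕ → V := fun i q => (s : ℂ) ^ (i + q) • (A i * odeCoeff A q) with hg
  have h1 : ∑ p ∈ Finset.range n, (s : ℂ) ^ p • (((p : ℂ) + 1) • odeCoeff A (p + 1))
      = ∑ i ∈ Finset.range n, ∑ q ∈ Finset.range (n - i), g i q := by
    rw [← Finset.sum_range_diag_flip]
    refine Finset.sum_congr rfl fun p _ => ?_
    rw [odeCoeff_succ, Finset.smul_sum]
    refine Finset.sum_congr rfl fun i hi => ?_
    have hi' := Nat.lt_succ_iff.1 (Finset.mem_range.1 hi)
    simp only [hg]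
    rw [Nat.add_sub_cancel' hi']
  have h2 : (∑ i ∈ Finset.range n, (s : ℂ) ^ i • A i)
        * ∑ p ∈ Finset.range (n + 1), (s : ℂ) ^ p • odeCoeff A p
      = ∑ i ∈ Finset.range n, ∑ q ∈ Finset.range (n + 1), g i q := by
    rw [Finset.sum_mul_sum]
    refine Finset.sum_congr rfl fun i _ => Finset.sum_congr rfl fun q _ => ?_
    rw [smul_mul_smul_comm, ← pow_add]
  -- The derivative accounts for the products with `i + q < n`. The residual keeps those with `i + q
  -- ≥ n`: at most `n * (n + 1)` of them, each at most `x ^ (n + 1)`.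
  have h3 : ∀ i ∈ Finset.range n, ∑ q ∈ Finset.range (n - i), g i q
      - ∑ q ∈ Finset.range (n + 1), g i q = -∑ q ∈ Finset.Ico (n - i) (n + 1), g i q := by
    intro i _
    rw [← Finset.sum_range_add_sum_Ico _ (show n - i ≤ n + 1 by omega)]
    abel
  rw [h1, h2, ← Finset.sum_sub_distrib, Finset.sum_congr rfl h3]
  have hs1 : ∀ m, ‖(s : ℂ) ^ m‖ ≤ 1 := fun m => by
    rw [norm_pow, Complex.norm_real, Real.norm_of_nonneg hs.1]
    exact pow_le_one₀ hs.1 hs.2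
  refine (norm_sum_le _ _).trans ?_
  calc _ ≤ ∑ i ∈ Finset.range n, ((n : ℝ) + 1) * x ^ (n + 1) := by
        refine Finset.sum_le_sum fun i hi => ?_
        rw [norm_neg]
        refine (norm_sum_le _ _).trans ?_
        calc _ ≤ ∑ q ∈ Finset.Ico (n - i) (n + 1), x ^ (n + 1) := by
              refine Finset.sum_le_sum fun q hq => ?_
              have hq' := (Finset.mem_Ico.1 hq).1
              calc ‖g i q‖ ≤ 1 * (x ^ (i + 1) * x ^ q) := by
                    rw [hg, norm_smul]
                    refine mul_le_mul (hs1 _) ((norm_mul_le _ _).trans ?_) (norm_nonneg _) zero_le_one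
                    exact mul_le_mul (h i) (norm_odeCoeff_le hx h q) (norm_nonneg _) (by positivity)
                _ = x ^ (i + 1 + q) := by rw [one_mul, ← pow_add]
                _ ≤ x ^ (n + 1) := pow_le_pow_of_le_one hx.le (by linarith) (by omega)
          _ ≤ _ := by
              rw [Finset.sum_const, nsmul_eq_mul, Nat.card_Ico]
              gcongr
              exact_mod_cast Nat.sub_le _ _
    _ = _ := by simp; ring

lemma sum_pow_le_two {x : ℝ} (hx : 0 < x) (hx2 : x ≤ 1 / 2) (n : ℕ) :
    ∑ p ∈ Finset.range n, x ^ p ≤ 2 := by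
  have h1 : ∑ p ∈ Finset.range n, x ^ p ≤ ∑' p, x ^ p :=
    (summable_geometric_of_lt_one hx.le (by linarith)).sum_le_tsum _ fun p _ => by positivity
  rw [tsum_geometric_of_lt_one hx.le (by linarith)] at h1
  refine h1.trans ?_
  rw [inv_le_comm₀ (by linarith) (by norm_num)]; linarith

/-- The Taylor polynomial approximates the solution of the differential equation. -/
theorem norm_ode_sub_taylor_le {A : ℕ → V} {x : ℝ} (hx : 0 < x) (hx2 : x ≤ 1 / 2)
    (h : ∀ i, ‖A i‖ ≤ x ^ (i + 1)) (n : ℕ) {F : ℝ → V} {U : ℝ → V}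
    (hF : ∀ s ∈ Set.Icc (0 : ℝ) 1, ‖F s - ∑ i ∈ Finset.range n, (s : ℂ) ^ i • A i‖ ≤ x ^ (n + 1))
    (hU : ∀ s ∈ Set.Icc (0 : ℝ) 1, HasDerivWithinAt U (F s * U s) (Set.Icc 0 1) s)
    (hU0 : U 0 = 1) :
    ‖U 1 - ∑ p ∈ Finset.range (n + 1), odeCoeff A p‖ ≤ (n * (n + 1) + 2) * x ^ (n + 1) * 4 := by
  set u := odeCoeff A
  set P : ℝ → V := fun s => ∑ p ∈ Finset.range (n + 1), (s : ℂ) ^ p • u p with hP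
  set P' : ℝ → V := fun s => ∑ p ∈ Finset.range n, (s : ℂ) ^ p • (((p : ℂ) + 1) • u (p + 1)) with hP'
  have hPd : ∀ s : ℝ, HasDerivAt P (P' s) s := by
    intro s
    have h1 : ∀ p ∈ Finset.range (n + 1), HasDerivAt (fun s : ℝ => (s : ℂ) ^ p • u p)
        (((p : ℂ) * (s : ℂ) ^ (p - 1)) • u p) s := fun p _ =>
      ((hasDerivAt_pow p (s : ℂ)).comp_ofReal).smul_const (u p)
    refine (HasDerivAt.fun_sum h1).congr_deriv ?_
    rw [Finset.sum_range_succ']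
    simp only [hP', smul_smul]
    simp [mul_comm]
  set c : Set ℝ := Set.Icc (0 : ℝ) 1
  -- Gronwall's inequality asks for a Lipschitz field at all times, while `F` is controlled on `[0,
  -- 1]` only; outside it is replaced by zero.
  set F' : ℝ → V := fun s => if s ∈ c then F s else 0 with hF'
  have hs1 : ∀ s ∈ c, ∀ m, ‖(s : ℂ) ^ m‖ ≤ 1 := fun s hs m => by
    rw [norm_pow, Complex.norm_real, Real.norm_of_nonneg hs.1]
    exact pow_le_one₀ hs.1 hs.2
  have hFn : ∀ s, ‖F' s‖ ≤ 2 := by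
    intro s
    simp only [hF']
    split_ifs with hs
    · have h1 : ‖∑ i ∈ Finset.range n, (s : ℂ) ^ i • A i‖ ≤ 1 := by
        refine (norm_sum_le _ _).trans ?_
        calc _ ≤ ∑ i ∈ Finset.range n, x * x ^ i := by
              refine Finset.sum_le_sum fun i _ => ?_
              rw [norm_smul, ← pow_succ']
              exact (mul_le_mul (hs1 s hs i) (h i) (norm_nonneg _) zero_le_one).trans (one_mul _).le
          _ ≤ (1 / 2) * 2 := by
              rw [← Finset.mul_sum]
              exact mul_le_mul hx2 (sum_pow_le_two hx hx2 n) (by positivity) (by norm_num)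
          _ = 1 := by norm_num
      have h2 : x ^ (n + 1) ≤ 1 := pow_le_one₀ hx.le (by linarith)
      calc ‖F s‖ = ‖(F s - ∑ i ∈ Finset.range n, (s : ℂ) ^ i • A i)
              + ∑ i ∈ Finset.range n, (s : ℂ) ^ i • A i‖ := by rw [sub_add_cancel]
        _ ≤ _ := (norm_add_le _ _).trans (by linarith [hF s hs])
    · simp
  have hLip : ∀ s, LipschitzWith 2 (fun Y : V => F' s * Y) := by
    intro s
    refine LipschitzWith.of_dist_le_mul fun Y Z => ?_
    rw [dist_eq_norm, dist_eq_norm, ← mul_sub]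
    refine (norm_mul_le _ _).trans ?_
    exact mul_le_mul_of_nonneg_right (hFn s) (norm_nonneg _)
  have hPn : ∀ s ∈ c, ‖P s‖ ≤ 2 := by
    intro s hs
    refine (norm_sum_le _ _).trans ((Finset.sum_le_sum fun p _ => ?_).trans
      (sum_pow_le_two hx hx2 (n + 1)))
    rw [norm_smul]
    exact (mul_le_mul (hs1 s hs p) (norm_odeCoeff_le hx h p) (norm_nonneg _) zero_le_one).trans
      (one_mul _).le
  have key := dist_le_of_approx_trajectories_ODE (v := fun s Y => F' s * Y) (K := 2) (a := 0) (b := 1)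
    (f := U) (g := P) (f' := fun s => F s * U s) (g' := P') (εf := 0)
    (εg := (n * (n + 1) + 2) * x ^ (n + 1)) (δ := 0) hLip
    (fun s hs => (hU s hs).continuousWithinAt)
    (fun s hs => (hU s (Set.Ico_subset_Icc_self hs)).mono_of_mem_nhdsWithin
      (Icc_mem_nhdsGE_of_mem hs))
    (fun s hs => by simp only [hF', if_pos (show s ∈ c from Set.Ico_subset_Icc_self hs), dist_self]; rfl)
    (fun s _ => (hPd s).continuousAt.continuousWithinAt)
    (fun s _ => (hPd s).hasDerivWithinAt)
    (fun s hs => ?_) ?_ 1 (by simp)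
  · rw [dist_eq_norm] at key
    have hP1 : P 1 = ∑ p ∈ Finset.range (n + 1), u p := by simp [hP]
    rw [hP1, NNReal.coe_ofNat, gronwallBound_of_K_ne_0 two_ne_zero] at key
    refine key.trans ?_
    beta_reduce
    -- With Lipschitz constant `2` on unit time the Gronwall factor is `(e ^ 2 - 1) / 2 ≤ 4`.
    have he : Real.exp (2 * (1 - 0)) ≤ 9 := by
      have := Real.exp_one_lt_d9
      rw [sub_zero, mul_one, show (2 : ℝ) = 1 + 1 by norm_num, Real.exp_add]
      nlinarith [Real.exp_pos 1]
    have h0 : 0 ≤ ((n : ℝ) * (n + 1) + 2) * x ^ (n + 1) := by positivity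
    generalize Real.exp (2 * (1 - 0)) = E at he ⊢
    generalize ((n : ℝ) * (n + 1) + 2) * x ^ (n + 1) = W at h0 ⊢
    nlinarith
  · have hs' : s ∈ c := Set.Ico_subset_Icc_self hs
    rw [dist_eq_norm]
    simp only [hF', if_pos hs']
    have h1 := norm_ode_residual_le hx hx2 h n hs'
    have h2 : ‖(F s - ∑ i ∈ Finset.range n, (s : ℂ) ^ i • A i) * P s‖ ≤ x ^ (n + 1) * 2 :=
      (norm_mul_le _ _).trans (mul_le_mul (hF s hs') (hPn s hs') (norm_nonneg _) (by positivity))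
    calc ‖P' s - F s * P s‖ = ‖(P' s - (∑ i ∈ Finset.range n, (s : ℂ) ^ i • A i) * P s)
          - (F s - ∑ i ∈ Finset.range n, (s : ℂ) ^ i • A i) * P s‖ := by rw [sub_mul]; congr 1; abel
      _ ≤ _ := (norm_sub_le _ _).trans (by linarith [add_le_add h1 h2])
  · rw [hU0, dist_eq_norm]
    have : P 0 = 1 := by
      simp only [hP]
      rw [Finset.sum_range_succ']
      simp [u, odeCoeff]
    simp [this]

end Strang

/-! ### Well-conditioned multiproduct coefficients -/

section Coefficients

lemma prod_range_erase {R : Type*} [CommMonoid R] (f : ℕ → R) {M j : ℕ} (hj : j < M) :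
    ∏ i ∈ (Finset.range M).erase j, f i
      = (∏ i ∈ Finset.range j, f i) * ∏ d ∈ Finset.range (M - 1 - j), f (j + 1 + d) := by
  have h : (Finset.range M).erase j
      = Finset.range j ∪ (Finset.range (M - 1 - j)).map (addLeftEmbedding (j + 1)) := by
    ext i
    simp only [Finset.mem_erase, Finset.mem_range, Finset.mem_union, Finset.mem_map,
      addLeftEmbedding_apply]
    constructor
    · rintro ⟨h1, h2⟩
      rcases lt_or_gt_of_ne h1 with h | h
      · exact Or.inl h
      · exact Or.inr ⟨i - (j + 1), by omega, by omega⟩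
    · rintro (h | ⟨d, hd, rfl⟩) <;> omega
  rw [h, Finset.prod_union, Finset.prod_map]
  · rfl
  · rw [Finset.disjoint_left]
    intro i hi hi'
    simp only [Finset.mem_range, Finset.mem_map, addLeftEmbedding_apply] at hi hi'
    obtain ⟨d, _, rfl⟩ := hi'
    omega

lemma sum_range_erase {R : Type*} [AddCommMonoid R] (f : ℕ → R) {M j : ℕ} (hj : j < M) :
    ∑ i ∈ (Finset.range M).erase j, f i
      = (∑ i ∈ Finset.range j, f i) + ∑ d ∈ Finset.range (M - 1 - j), f (j + 1 + d) :=
  prod_range_erase (R := Multiplicative R) f hj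

lemma prod_add_succ_mul_factorial (M j : ℕ) :
    (∏ i ∈ Finset.range M, ((i : ℝ) + j + 1)) * (j.factorial : ℝ) = ((M + j).factorial : ℝ) := by
  induction M with
  | zero => simp
  | succ M ih =>
    rw [Finset.prod_range_succ, mul_right_comm, ih, show M + 1 + j = (M + j) + 1 by ring,
      Nat.factorial_succ]
    push_cast; ring

lemma prod_abs_sub_erase {M j : ℕ} (hj : j < M) :
    ∏ i ∈ (Finset.range M).erase j, |(i : ℝ) - j|
      = (j.factorial : ℝ) * ((M - 1 - j).factorial : ℝ) := by
  rw [prod_range_erase _ hj, ← Finset.prod_range_reflect, ← Finset.prod_range_add_one_eq_factorial,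
    ← Finset.prod_range_add_one_eq_factorial]
  push_cast
  congr 1
  · refine Finset.prod_congr rfl fun i hi => ?_
    have := Finset.mem_range.1 hi
    rw [show ((j - 1 - i : ℕ) : ℝ) = j - 1 - i by
      rw [Nat.cast_sub (by omega), Nat.cast_sub (by omega)]; simp]
    rw [abs_of_neg (by linarith [(Nat.cast_nonneg i : (0:ℝ) ≤ i)])]; ring
  · refine Finset.prod_congr rfl fun i hi => ?_
    rw [abs_of_nonneg (by linarith [(Nat.cast_nonneg i : (0:ℝ) ≤ i)])]; ring

lemma sum_inv_abs_sub_erase_le {M j : ℕ} (hj : j < M) :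
    ∑ i ∈ (Finset.range M).erase j, |(i : ℝ) - j|⁻¹ ≤ 2 * (1 + Real.log M) := by
  have hH : ∑ i ∈ Finset.range M, ((i : ℝ) + 1)⁻¹ ≤ 1 + Real.log M := by
    have := harmonic_le_one_add_log M
    rw [harmonic] at this
    push_cast at this
    exact this
  have hmono : ∀ n ≤ M, ∑ i ∈ Finset.range n, ((i : ℝ) + 1)⁻¹ ≤ 1 + Real.log M := fun n hn =>
    (Finset.sum_le_sum_of_subset_of_nonneg (Finset.range_mono hn)
      fun i _ _ => by positivity).trans hH
  rw [sum_range_erase _ hj, ← Finset.sum_range_reflect]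
  have h1 : ∑ i ∈ Finset.range j, |((j - 1 - i : ℕ) : ℝ) - j|⁻¹
      = ∑ i ∈ Finset.range j, ((i : ℝ) + 1)⁻¹ := by
    refine Finset.sum_congr rfl fun i hi => ?_
    have := Finset.mem_range.1 hi
    rw [show ((j - 1 - i : ℕ) : ℝ) = j - 1 - i by
      rw [Nat.cast_sub (by omega), Nat.cast_sub (by omega)]; simp]
    rw [abs_of_neg (by linarith [(Nat.cast_nonneg i : (0:ℝ) ≤ i)])]; ring
  have h2 : ∑ d ∈ Finset.range (M - 1 - j), |((j + 1 + d : ℕ) : ℝ) - j|⁻¹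
      = ∑ i ∈ Finset.range (M - 1 - j), ((i : ℝ) + 1)⁻¹ := by
    refine Finset.sum_congr rfl fun i hi => ?_
    push_cast
    rw [abs_of_nonneg (by linarith [(Nat.cast_nonneg i : (0:ℝ) ≤ i)])]; ring
  rw [h1, h2]
  linarith [hmono j hj.le, hmono (M - 1 - j) (by omega)]

/-- A Wallis product: the quotient by `4 ^ m * m! * (m + 1)!` increases but stays bounded. The
factor `2 - 1 / (m + 1)` in place of `2` supplies the room the induction needs. -/
lemma prod_odd_sq_le (m : ℕ) : ∏ i ∈ Finset.range (m + 1), (2 * (i : ℝ) + 1) ^ 2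
    ≤ (2 - 1 / ((m : ℝ) + 1)) * (4 ^ m * m.factorial * (m + 1).factorial) := by
  induction m with
  | zero => simp; norm_num
  | succ m ih =>
    rw [Finset.prod_range_succ]
    refine (mul_le_mul_of_nonneg_right ih (by positivity)).trans ?_
    have h1 : ((m + 1 + 1).factorial : ℝ) = (m + 2) * (m + 1).factorial := by
      rw [Nat.factorial_succ]; push_cast; ring
    have h2 : ((m + 1).factorial : ℝ) = (m + 1) * m.factorial := by
      rw [Nat.factorial_succ]; push_cast; ring
    rw [h1, h2]
    have hp : (0 : ℝ) < 4 ^ m * (m.factorial : ℝ) ^ 2 * (m + 1) := by positivity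
    have hm : (0 : ℝ) < (m : ℝ) + 1 := by positivity
    have key : (2 - 1 / ((m : ℝ) + 1)) * (2 * ((m : ℝ) + 1) + 1) ^ 2
        ≤ (2 - 1 / ((m : ℝ) + 1 + 1)) * (4 * (m + 1) * (m + 2)) := by
      have h3 : (2 - 1 / ((m : ℝ) + 1)) = (2 * m + 1) / (m + 1) := by field_simp; ring
      have h4 : (2 - 1 / ((m : ℝ) + 1 + 1)) * (4 * (m + 1) * (m + 2)) = (2 * m + 3) * (4 * (m + 1)) := by
        field_simp; ring
      rw [h3, h4, div_mul_eq_mul_div, div_le_iff₀ hm]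
      nlinarith [(Nat.cast_nonneg m : (0:ℝ) ≤ m)]
    have := mul_le_mul_of_nonneg_left key hp.le
    push_cast
    calc _ = 4 ^ m * (m.factorial : ℝ) ^ 2 * (m + 1)
          * ((2 - 1 / ((m : ℝ) + 1)) * (2 * ((m : ℝ) + 1) + 1) ^ 2) := by ring
      _ ≤ _ := this
      _ = _ := by ring

/-- Gaussian decay away from the centre of a binomial row. Going from `j` to `j + 1` costs a factor
`(M - 1 - j) / (M + j + 1) ≤ 1 - (j + 1) / M ≤ exp (-(j + 1) / M)`, and the exponents sum to `j (j +
1) / (2 M)`. -/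
lemma factorial_mul_le {M j : ℕ} (hj : j < M) :
    ((M - 1).factorial : ℝ) * M.factorial ≤ Real.exp (-(j * (j + 1) / (2 * M)))
      * (((M - 1 - j).factorial : ℝ) * (M + j).factorial) := by
  have hM : (0 : ℝ) < M := by exact_mod_cast (Nat.zero_le j).trans_lt hj
  induction j with
  | zero => simp
  | succ j ih =>
    refine (ih (by omega)).trans ?_
    obtain ⟨q, hq⟩ : ∃ q, M = j + 2 + q := ⟨M - (j + 2), by omega⟩
    have h1 : M - 1 - j = q + 1 := by omega
    have h2 : M - 1 - (j + 1) = q := by omega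
    rw [h1, h2, show M + (j + 1) = (M + j) + 1 by ring, Nat.factorial_succ, Nat.factorial_succ]
    have h3 : ((q : ℝ) + 1) ≤ Real.exp (-((j + 1 : ℝ) / M)) * (M + j + 1) := by
      have h4 : 1 - (j + 1 : ℝ) / M ≤ Real.exp (-((j + 1 : ℝ) / M)) := by
        linarith [Real.add_one_le_exp (-((j + 1 : ℝ) / M))]
      have h5 : (1 - (j + 1 : ℝ) / M) * M = q + 1 := by
        have : (M : ℝ) = j + 2 + q := by rw [hq]; push_cast; ring
        field_simp; rw [this]; ring
      calc (q : ℝ) + 1 = (1 - (j + 1 : ℝ) / M) * M := h5.symm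
        _ ≤ Real.exp (-((j + 1 : ℝ) / M)) * M := by gcongr
        _ ≤ _ := by gcongr; linarith [(Nat.cast_nonneg j : (0:ℝ) ≤ j)]
    have h6 : Real.exp (-(((j + 1 : ℕ) : ℝ) * (((j + 1 : ℕ) : ℝ) + 1) / (2 * M)))
        = Real.exp (-(j * (j + 1) / (2 * M))) * Real.exp (-((j + 1 : ℝ) / M)) := by
      rw [← Real.exp_add]; congr 1; push_cast; field_simp; ring
    rw [h6]
    push_cast
    have h7 : 0 ≤ Real.exp (-(j * (j + 1) / (2 * M))) * (q.factorial * (M + j).factorial : ℝ) := by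
      positivity
    have := mul_le_mul_of_nonneg_left h3 h7
    calc _ = Real.exp (-(j * (j + 1) / (2 * M))) * (q.factorial * (M + j).factorial : ℝ) * (q + 1) := by ring
      _ ≤ _ := this
      _ = _ := by ring

/-- Extrapolation weights for the nodes `1 / (2 i + 1) ^ 2` up to perturbation. -/
lemma prod_odd_ratio_le {M j : ℕ} (hj : j < M) :
    ∏ i ∈ (Finset.range M).erase j,
        ((2 * (i : ℝ) + 1) ^ 2 / |(2 * (i : ℝ) + 1) ^ 2 - (2 * (j : ℝ) + 1) ^ 2|)
      ≤ 2 / (2 * (j : ℝ) + 1) * Real.exp (-(j * (j + 1) / (2 * M))) := by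
  have hjM : j ∈ Finset.range M := Finset.mem_range.2 hj
  have hcard : ((Finset.range M).erase j).card = M - 1 := by
    rw [Finset.card_erase_of_mem hjM, Finset.card_range]
  -- Each difference is `4 (i - j) (i + j + 1)`, so both products are factorials; the divisor `2 j +
  -- 1` is the factor `i = j` missing from the second one.
  have hden : ∏ i ∈ (Finset.range M).erase j, |(2 * (i : ℝ) + 1) ^ 2 - (2 * (j : ℝ) + 1) ^ 2|
      = 4 ^ (M - 1) * (((M - 1 - j).factorial : ℝ) * (M + j).factorial / (2 * j + 1)) := by
    have h1 : ∀ i ∈ (Finset.range M).erase j, |(2 * (i : ℝ) + 1) ^ 2 - (2 * (j : ℝ) + 1) ^ 2|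
        = 4 * (|(i : ℝ) - j| * ((i : ℝ) + j + 1)) := by
      intro i _
      rw [show (2 * (i : ℝ) + 1) ^ 2 - (2 * (j : ℝ) + 1) ^ 2
        = 4 * (((i : ℝ) - j) * ((i : ℝ) + j + 1)) by ring, abs_mul, abs_mul,
        abs_of_pos (by norm_num : (0:ℝ) < 4), abs_of_pos (by positivity : (0 : ℝ) < (i : ℝ) + j + 1)]
    rw [Finset.prod_congr rfl h1, Finset.prod_mul_distrib, Finset.prod_const, hcard,
      Finset.prod_mul_distrib, prod_abs_sub_erase hj]
    have h2 := Finset.mul_prod_erase _ (fun i : ℕ => (i : ℝ) + j + 1) hjM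
    have h3 := prod_add_succ_mul_factorial M j
    rw [← h2] at h3
    rw [← h3]
    field_simp
    ring
  have hnum := Finset.mul_prod_erase _ (fun i : ℕ => (2 * (i : ℝ) + 1) ^ 2) hjM
  obtain ⟨m, rfl⟩ : ∃ m, M = m + 1 := ⟨M - 1, by omega⟩
  have h4 := prod_odd_sq_le m
  rw [← hnum] at h4
  have h5 := factorial_mul_le hj
  rw [Finset.prod_div_distrib, hden]
  simp only [Nat.add_sub_cancel] at h5 ⊢
  set X := ∏ i ∈ (Finset.range (m + 1)).erase j, (2 * (i : ℝ) + 1) ^ 2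
  set E := Real.exp (-(j * (j + 1) / (2 * ((m + 1 : ℕ) : ℝ))))
  set G := ((m - j).factorial : ℝ) * (m + 1 + j).factorial
  have hG : 0 < G := by positivity
  have ho : (0 : ℝ) < 2 * j + 1 := by positivity
  rw [div_le_iff₀ (by positivity)]
  have h6 : (2 * (j : ℝ) + 1) ^ 2 * X ≤ 2 * (4 ^ m * (E * G)) := by
    refine h4.trans ?_
    have h7 : (2 - 1 / ((m : ℝ) + 1)) ≤ 2 := by
      have : 0 < 1 / ((m : ℝ) + 1) := by positivity
      linarith
    have h8 : (0:ℝ) ≤ 4 ^ m * m.factorial * (m + 1).factorial := by positivity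
    refine (mul_le_mul_of_nonneg_right h7 h8).trans ?_
    rw [mul_assoc (4 ^ m)]
    gcongr
  have h9 : 2 / (2 * (j : ℝ) + 1) * E * (4 ^ m * (G / (2 * j + 1)))
      = 2 * (4 ^ m * (E * G)) / (2 * (j : ℝ) + 1) ^ 2 := by field_simp
  rw [h9, le_div_iff₀ (by positivity)]
  linarith

/-! ### Step numbers, and the effect of rounding on the weights -/

/-- Step numbers of the multiproduct formula. -/
def mpfStep (M j : ℕ) : ℕ := 3 * M ^ 2 / (2 * j + 1)

lemma mpfStep_le (M j : ℕ) : mpfStep M j ≤ 3 * M ^ 2 := Nat.div_le_self _ _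

lemma mpfStep_pos {M j : ℕ} (hj : j < M) : 0 < mpfStep M j := by
  refine Nat.div_pos ?_ (by omega)
  nlinarith

lemma mpfStep_bounds (M j : ℕ) : (mpfStep M j : ℝ) ≤ 3 * M ^ 2 / (2 * j + 1) ∧
    3 * (M : ℝ) ^ 2 / (2 * j + 1) < mpfStep M j + 1 := by
  constructor
  · have := @Nat.cast_div_le ℝ _ _ _ (3 * M ^ 2) (2 * j + 1)
    push_cast at this
    exact this
  · rw [div_lt_iff₀ (by positivity)]
    have : 3 * M ^ 2 < (mpfStep M j + 1) * (2 * j + 1) := by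
      rw [mul_comm (mpfStep M j + 1)]; exact Nat.lt_mul_div_succ _ (by omega)
    exact_mod_cast this

/-- The constant `3` in the step numbers is chosen for this. The unrounded gap is at least `3 / 2`
and at least three times the left side; rounding loses at most `1`, hence at most two thirds of the
gap. -/
lemma mpfStep_gap {M i j : ℕ} (hi : i < M) (hj : j < M) (hij : i ≠ j) :
    (M : ℝ) * |(i : ℝ) - j| / (2 * j + 1) ≤ |(mpfStep M i : ℝ) - mpfStep M j| := by
  have hi' : (i : ℝ) + 1 ≤ M := by exact_mod_cast hi
  have hj' : (j : ℝ) + 1 ≤ M := by exact_mod_cast hj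
  have hi0 : (0 : ℝ) ≤ i := Nat.cast_nonneg i
  have hj0 : (0 : ℝ) ≤ j := Nat.cast_nonneg j
  have hd : (1 : ℝ) ≤ |(i : ℝ) - j| := by
    have : (1 : ℤ) ≤ |(i : ℤ) - j| := Int.one_le_abs (sub_ne_zero.2 (by exact_mod_cast hij))
    exact_mod_cast this
  have hM : (0 : ℝ) < M := by linarith
  obtain ⟨h1, h2⟩ := mpfStep_bounds M i
  obtain ⟨h3, h4⟩ := mpfStep_bounds M j
  set x := 3 * (M : ℝ) ^ 2 / (2 * i + 1)
  set y := 3 * (M : ℝ) ^ 2 / (2 * j + 1)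
  have hxy : |x - y| = 6 * M ^ 2 * |(i : ℝ) - j| / ((2 * i + 1) * (2 * j + 1)) := by
    have : x - y = 6 * M ^ 2 * (j - i) / ((2 * i + 1) * (2 * j + 1)) := by
      simp only [x, y]; field_simp; ring
    rw [this, abs_div, abs_mul, abs_of_nonneg (by positivity : (0:ℝ) ≤ 6 * M ^ 2),
      abs_of_nonneg (by positivity : (0:ℝ) ≤ (2 * i + 1) * (2 * j + 1)), abs_sub_comm]
  have h5 : |x - y| - 1 ≤ |(mpfStep M i : ℝ) - mpfStep M j| := by
    have : |x - y| ≤ |(mpfStep M i : ℝ) - mpfStep M j| + 1 := by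
      have ha := le_abs_self ((mpfStep M i : ℝ) - mpfStep M j)
      have hb := neg_abs_le ((mpfStep M i : ℝ) - mpfStep M j)
      rw [abs_le]; constructor <;> linarith
    linarith
  have h6 : 3 * (M * |(i : ℝ) - j| / (2 * j + 1)) ≤ |x - y| := by
    rw [hxy, mul_div_assoc', div_le_div_iff₀ (by positivity) (by positivity)]
    have h8 : 0 ≤ 3 * M * |(i : ℝ) - j| * (2 * j + 1) := by positivity
    have h9 : (2 * (i : ℝ) + 1) ≤ 2 * M := by linarith
    have := mul_le_mul_of_nonneg_left h9 h8
    nlinarith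
  have h7 : 3 / 2 ≤ |x - y| := by
    rw [hxy, le_div_iff₀ (by positivity)]
    have h9 : (2 * (i : ℝ) + 1) * (2 * j + 1) ≤ (2 * M) * (2 * M) := by
      apply mul_le_mul <;> linarith
    have h10 : 6 * (M : ℝ) ^ 2 * 1 ≤ 6 * M ^ 2 * |(i : ℝ) - j| := by gcongr
    nlinarith
  linarith

/-- With `d` and `s` the distance and the sum of the two step numbers, rounding changes the
difference of squares by a factor at most `(1 + 1 / d) (1 + 2 / s) ≤ exp (3 / d)`, and the gap bound
controls `1 / d`. The sum of these exponents over `i` is harmonic. -/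
lemma mpfStep_ratio_le {M i j : ℕ} (hi : i < M) (hj : j < M) (hij : i ≠ j) :
    (mpfStep M j : ℝ) ^ 2 / |(mpfStep M i : ℝ) ^ 2 - (mpfStep M j : ℝ) ^ 2|
      ≤ (2 * (i : ℝ) + 1) ^ 2 / |(2 * (i : ℝ) + 1) ^ 2 - (2 * (j : ℝ) + 1) ^ 2|
        * Real.exp (3 * (2 * j + 1) / M * |(i : ℝ) - j|⁻¹) := by
  have hgap := mpfStep_gap hi hj hij
  have hk : (0 : ℝ) < mpfStep M j := by exact_mod_cast mpfStep_pos hj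
  have hk' : (0 : ℝ) < mpfStep M i := by exact_mod_cast mpfStep_pos hi
  have hM : (0 : ℝ) < M := by exact_mod_cast (Nat.zero_le j).trans_lt hj
  have hij' : (i : ℝ) - j ≠ 0 := sub_ne_zero.2 (by exact_mod_cast hij)
  obtain ⟨h1, h2⟩ := mpfStep_bounds M i
  obtain ⟨h3, h4⟩ := mpfStep_bounds M j
  set x := 3 * (M : ℝ) ^ 2 / (2 * i + 1) with hx
  set y := 3 * (M : ℝ) ^ 2 / (2 * j + 1) with hy
  have hx0 : 0 < x := by positivity
  have hy0 : 0 < y := by positivity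
  set d := |(mpfStep M i : ℝ) - mpfStep M j| with hd
  have hd0 : 0 < d := lt_of_lt_of_le (by positivity) hgap
  set s := (mpfStep M i : ℝ) + mpfStep M j with hs
  have hds : d ≤ s := by
    rw [hd, abs_le]; constructor <;> linarith
  have hprod : |(mpfStep M i : ℝ) ^ 2 - (mpfStep M j : ℝ) ^ 2| = d * s := by
    rw [sq_sub_sq, abs_mul, mul_comm, abs_of_pos (by positivity : 0 < s)]
  have hxy : |x ^ 2 - y ^ 2| ≤ (d + 1) * (s + 2) := by
    rw [sq_sub_sq, abs_mul, mul_comm, abs_of_pos (by positivity : 0 < x + y)]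
    refine mul_le_mul ?_ (by linarith) (by positivity) (by linarith)
    have ha := le_abs_self ((mpfStep M i : ℝ) - mpfStep M j)
    have hb := neg_abs_le ((mpfStep M i : ℝ) - mpfStep M j)
    rw [abs_le]; constructor <;> linarith
  have hne : x ^ 2 - y ^ 2 ≠ 0 := by
    rw [sq_sub_sq]
    refine mul_ne_zero (by positivity) ?_
    have : x - y = 6 * M ^ 2 * (j - i) / ((2 * i + 1) * (2 * j + 1)) := by
      simp only [x, y]; field_simp; ring
    rw [this]
    refine div_ne_zero (mul_ne_zero (by positivity) ?_) (by positivity)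
    rwa [← neg_ne_zero, neg_sub]
  have hT : (2 * (i : ℝ) + 1) ^ 2 / |(2 * (i : ℝ) + 1) ^ 2 - (2 * (j : ℝ) + 1) ^ 2|
      = y ^ 2 / |x ^ 2 - y ^ 2| := by
    have h5 : x ^ 2 - y ^ 2 = (-(9 * M ^ 4 / ((2 * (i : ℝ) + 1) ^ 2 * (2 * j + 1) ^ 2)))
        * ((2 * (i : ℝ) + 1) ^ 2 - (2 * (j : ℝ) + 1) ^ 2) := by
      simp only [x, y]; field_simp; ring
    have h6 : (2 * (i : ℝ) + 1) ^ 2 - (2 * (j : ℝ) + 1) ^ 2 ≠ 0 := by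
      intro h; rw [h, mul_zero] at h5; exact hne h5
    have h7 := abs_pos.2 h6
    rw [h5, abs_mul, abs_neg,
      abs_of_pos (by positivity : 0 < 9 * (M:ℝ) ^ 4 / ((2 * (i : ℝ) + 1) ^ 2 * (2 * j + 1) ^ 2)), hy]
    field_simp
    norm_num
  have hexp : (1 + 1 / d) * (1 + 2 / s) ≤ Real.exp (3 * (2 * j + 1) / M * |(i : ℝ) - j|⁻¹) := by
    have h5 : 2 / s ≤ 2 / d := by gcongr
    have h6 : 1 / d ≤ (2 * j + 1) / M * |(i : ℝ) - j|⁻¹ := by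
      rw [div_le_iff₀ hd0]
      have := abs_pos.2 hij'
      calc (1 : ℝ) = (2 * j + 1) / M * |(i : ℝ) - j|⁻¹ * (M * |(i : ℝ) - j| / (2 * j + 1)) := by
            field_simp
        _ ≤ _ := by gcongr
    calc (1 + 1 / d) * (1 + 2 / s) ≤ Real.exp (1 / d) * Real.exp (2 / d) := by
          refine mul_le_mul ?_ ?_ (by positivity) (Real.exp_pos _).le
          · linarith [Real.add_one_le_exp (1 / d)]
          · linarith [Real.add_one_le_exp (2 / d)]
      _ = Real.exp (3 * (1 / d)) := by rw [← Real.exp_add]; congr 1; ring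
      _ ≤ _ := by
          refine Real.exp_le_exp.2 ?_
          calc 3 * (1 / d) ≤ 3 * ((2 * j + 1) / M * |(i : ℝ) - j|⁻¹) := by gcongr
            _ = _ := by ring
  rw [hT, hprod]
  have hxy0 := abs_pos.2 hne
  have hs0 : 0 < s := by positivity
  calc (mpfStep M j : ℝ) ^ 2 / (d * s) ≤ y ^ 2 / (d * s) := by gcongr
    _ = y ^ 2 / ((d + 1) * (s + 2)) * ((1 + 1 / d) * (1 + 2 / s)) := by field_simp
    _ ≤ y ^ 2 / |x ^ 2 - y ^ 2| * ((1 + 1 / d) * (1 + 2 / s)) := by gcongr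
    _ ≤ _ := by gcongr

lemma one_add_log_sq_le {M : ℕ} (hM : 1 ≤ M) : (1 + Real.log M) ^ 2 ≤ 4 * M := by
  have h1 : (1 : ℝ) ≤ M := by exact_mod_cast hM
  have h0 : 0 ≤ Real.log M := Real.log_nonneg h1
  have h2 : Real.log M = 2 * Real.log (Real.sqrt M) := by
    rw [Real.log_sqrt (by linarith)]; ring
  have h3 : Real.log (Real.sqrt M) ≤ Real.sqrt M - 1 :=
    Real.log_le_sub_one_of_pos (Real.sqrt_pos.2 (by linarith))
  have h4 : 1 + Real.log M ≤ 2 * Real.sqrt M := by linarith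
  have h5 : (1 + Real.log M) ^ 2 ≤ (2 * Real.sqrt M) ^ 2 := by gcongr
  rwa [mul_pow, Real.sq_sqrt (by linarith), show (2 : ℝ) ^ 2 = 4 by norm_num] at h5

/-- The weights `∏ i ≠ j, k j ^ 2 / (k j ^ 2 - k i ^ 2)` decay like `1 / (2 j + 1)`. -/
lemma mpf_weight_le {M j : ℕ} (hj : j < M) :
    ∏ i ∈ (Finset.range M).erase j,
      ((mpfStep M j : ℝ) ^ 2 / |(mpfStep M i : ℝ) ^ 2 - (mpfStep M j : ℝ) ^ 2|)
      ≤ 2 * Real.exp 312 * (2 * (j : ℝ) + 1)⁻¹ := by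
  have hM : 1 ≤ M := by omega
  have hM' : (0 : ℝ) < M := by exact_mod_cast hM
  set l := 1 + Real.log M with hl
  have hl1 : 1 ≤ l := by
    have : 0 ≤ Real.log M := Real.log_nonneg (by exact_mod_cast hM)
    linarith
  calc _ ≤ ∏ i ∈ (Finset.range M).erase j,
        ((2 * (i : ℝ) + 1) ^ 2 / |(2 * (i : ℝ) + 1) ^ 2 - (2 * (j : ℝ) + 1) ^ 2|
        * Real.exp (3 * (2 * j + 1) / M * |(i : ℝ) - j|⁻¹)) := by
        refine Finset.prod_le_prod (fun i _ => by positivity) fun i hi => ?_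
        rw [Finset.mem_erase, Finset.mem_range] at hi
        exact mpfStep_ratio_le hi.2 hj hi.1
    _ = (∏ i ∈ (Finset.range M).erase j,
        ((2 * (i : ℝ) + 1) ^ 2 / |(2 * (i : ℝ) + 1) ^ 2 - (2 * (j : ℝ) + 1) ^ 2|))
        * Real.exp (3 * (2 * j + 1) / M * ∑ i ∈ (Finset.range M).erase j, |(i : ℝ) - j|⁻¹) := by
        rw [Finset.prod_mul_distrib, ← Real.exp_sum, Finset.mul_sum]
    _ ≤ (2 / (2 * (j : ℝ) + 1) * Real.exp (-(j * (j + 1) / (2 * M))))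
        * Real.exp (3 * (2 * j + 1) / M * (2 * l)) := by
        gcongr
        · exact prod_odd_ratio_le hj
        · exact sum_inv_abs_sub_erase_le hj
    _ = 2 * (2 * (j : ℝ) + 1)⁻¹ *
        Real.exp (-(j * (j + 1) / (2 * M)) + 3 * (2 * j + 1) / M * (2 * l)) := by
        rw [Real.exp_add]; ring
    _ ≤ 2 * (2 * (j : ℝ) + 1)⁻¹ * Real.exp 312 := by
        gcongr
        -- The Gaussian decay absorbs the rounding loss: `-j ^ 2 / 2 + 12 j l ≤ 72 l ^ 2`, and with
        -- `l ≤ l ^ 2 ≤ 4 M` the numerator is at most `(72 * 4 + 6 * 4) M = 312 M`.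
        have h1 : -((j : ℝ) * (j + 1) / (2 * M)) + 3 * (2 * j + 1) / M * (2 * l)
            = (-(j * (j + 1) / 2) + 6 * (2 * j + 1) * l) / M := by field_simp; ring
        rw [h1, div_le_iff₀ hM']
        have h2 := one_add_log_sq_le hM
        nlinarith [sq_nonneg ((j : ℝ) - 12 * l), (Nat.cast_nonneg j : (0:ℝ) ≤ j)]
    _ = _ := by ring

lemma mpfStep_injective {M : ℕ} : Function.Injective (fun j : Fin M => (mpfStep M j : ℝ)) := by
  intro i j h
  by_contra hne
  have hne' : (i : ℕ) ≠ j := fun h => hne (Fin.ext h)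
  have := mpfStep_gap i.2 j.2 hne'
  simp only at h
  rw [h, sub_self, abs_zero] at this
  have h1 : 0 < |((i : ℕ) : ℝ) - (j : ℕ)| := abs_pos.2 (sub_ne_zero.2 (by exact_mod_cast hne'))
  have hM : (0 : ℝ) < M := by exact_mod_cast (Nat.zero_le _).trans_lt i.2
  have : 0 < (M : ℝ) * |((i : ℕ) : ℝ) - (j : ℕ)| / (2 * (j : ℕ) + 1) := by positivity
  linarith

open Polynomial in
/-- Lagrange extrapolation to `0` annihilates the powers. -/
lemma sum_lagrange_basis_eval_zero {M : ℕ} {x : Fin M → ℝ} (hx : Function.Injective x) {i : ℕ}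
    (hi : i < M) : ∑ j, (Lagrange.basis Finset.univ x j).eval 0 * x j ^ i
      = if i = 0 then 1 else 0 := by
  have h := Lagrange.eq_interpolate (s := Finset.univ) (v := x) (f := (X ^ i : ℝ[X])) hx.injOn
    (by rw [degree_X_pow, Finset.card_univ, Fintype.card_fin]; exact_mod_cast hi)
  have h2 := congrArg (Polynomial.eval 0) h
  rw [Lagrange.interpolate_apply, Polynomial.eval_finsetSum] at h2
  simp only [eval_pow, eval_X, eval_mul, eval_C, zero_pow_eq] at h2
  rw [h2]
  exact Finset.sum_congr rfl fun j _ => mul_comm _ _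

/-- Multiproduct formulas of order `2 M` with step numbers at most `3 M ^ 2` and weights of
`ℓ¹`-norm `O(log M)`. -/
theorem exists_wellConditioned_mpf (M : ℕ) :
    ∃ (k : Fin M → ℕ) (a : Fin M → ℝ), IsMPF k a ∧ (∀ j, k j ≤ 3 * M ^ 2) ∧
      l1norm a ≤ 2 * Real.exp 312 * (1 + Real.log M) := by
  set k : Fin M → ℕ := fun j => mpfStep M j with hk
  have hk0 : ∀ j, (0 : ℝ) < k j := fun j => by exact_mod_cast mpfStep_pos j.2
  set x : Fin M → ℝ := fun j => ((k j : ℝ) ^ 2)⁻¹ with hx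
  have hxi : Function.Injective x := by
    intro i j h
    have h1 := inv_injective h
    rw [pow_left_inj₀ (hk0 i).le (hk0 j).le two_ne_zero] at h1
    exact mpfStep_injective h1
  set a : Fin M → ℝ := fun j => (Lagrange.basis Finset.univ x j).eval 0 with ha
  refine ⟨k, a, ⟨fun j => mpfStep_pos j.2, fun i hi => ?_⟩, fun j => mpfStep_le M j, ?_⟩
  · rw [← sum_lagrange_basis_eval_zero hxi hi]
    refine Finset.sum_congr rfl fun j _ => ?_
    rw [hx]; simp only; rw [inv_pow, ← pow_mul]
  · have habs : ∀ j : Fin M, |a j| ≤ 2 * Real.exp 312 * (2 * ((j : ℕ) : ℝ) + 1)⁻¹ := by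
      intro j
      refine le_trans (le_of_eq ?_) (mpf_weight_le j.2)
      have h1 : (Finset.range M).erase j = ((Finset.univ : Finset (Fin M)).erase j).map Fin.valEmbedding := by
        ext i
        simp only [Finset.mem_erase, Finset.mem_range, Finset.mem_map, Finset.mem_univ, and_true,
          Fin.valEmbedding_apply]
        constructor
        · rintro ⟨h1, h2⟩
          exact ⟨⟨i, h2⟩, fun h => h1 (congrArg Fin.val h), rfl⟩
        · rintro ⟨i, h1, rfl⟩
          exact ⟨fun h => h1 (Fin.ext h), i.2⟩
      simp only [ha]
      rw [h1, Finset.prod_map, Lagrange.basis, Polynomial.eval_prod, Finset.abs_prod]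
      refine Finset.prod_congr rfl fun i hi => ?_
      have hij : x j ≠ x i := fun h => (Finset.mem_erase.1 hi).1 (hxi h).symm
      have h2 := hk0 i
      have h3 := hk0 j
      have hne : (k i : ℝ) ^ 2 - (k j : ℝ) ^ 2 ≠ 0 := by
        intro h
        apply hij
        simp only [hx]; rw [sub_eq_zero.1 h]
      change |Polynomial.eval 0 (Lagrange.basisDivisor (x j) (x i))|
        = (k j : ℝ) ^ 2 / |(k i : ℝ) ^ 2 - (k j : ℝ) ^ 2|
      have h4 : Polynomial.eval 0 (Lagrange.basisDivisor (x j) (x i))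
          = -((k j : ℝ) ^ 2 / ((k i : ℝ) ^ 2 - (k j : ℝ) ^ 2)) := by
        simp only [Lagrange.basisDivisor, Polynomial.eval_mul, Polynomial.eval_C,
          Polynomial.eval_sub, Polynomial.eval_X, hx]
        have h5 : ((k j : ℝ) ^ 2)⁻¹ - ((k i : ℝ) ^ 2)⁻¹
            = ((k i : ℝ) ^ 2 - (k j : ℝ) ^ 2) / ((k i : ℝ) ^ 2 * (k j : ℝ) ^ 2) := by
          field_simp
        rw [h5]
        field_simp
        ring
      rw [h4, abs_neg, abs_div, abs_of_nonneg (by positivity : (0:ℝ) ≤ (k j : ℝ) ^ 2)]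
    rw [l1norm]
    refine (Finset.sum_le_sum fun j _ => habs j).trans ?_
    rw [← Finset.mul_sum]
    gcongr
    have := harmonic_le_one_add_log M
    rw [harmonic] at this
    push_cast at this
    refine le_trans ?_ this
    rw [Finset.sum_range]
    refine Finset.sum_le_sum fun j _ => ?_
    gcongr
    linarith [(Nat.cast_nonneg (j : ℕ) : (0:ℝ) ≤ (j : ℕ))]

end Coefficients

/-! ### Unitary evolutions -/

section Unitary

variable {n : ℕ}

lemma exp_hermitian_mem_unitary {H : QOp n} (hH : H.IsHermitian) (θ : ℝ) :
    (NormedSpace.exp ((-(Complex.I * (θ : ℂ))) • H) : QOp n) ∈ unitary (QOp n) := by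
  let _ : NormedAlgebra ℚ (QOp n) := .restrictScalars ℚ ℂ _
  refine NormedSpace.exp_mem_unitary_of_mem_skewAdjoint ?_
  rw [skewAdjoint.mem_iff, star_smul, show star H = H from hH]
  simp

lemma norm_exp_hermitian_le {H : QOp n} (hH : H.IsHermitian) (θ : ℝ) :
    ‖(NormedSpace.exp ((-(Complex.I * (θ : ℂ))) • H) : QOp n)‖ ≤ 1 :=
  (CStarRing.norm_of_mem_unitary (exp_hermitian_mem_unitary hH θ)).le

lemma norm_exp_hermitian_sub_le {H : QOp n} (hH : H.IsHermitian) (θ φ : ℝ) :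
    ‖(NormedSpace.exp ((-(Complex.I * (θ : ℂ))) • H) : QOp n)
      - NormedSpace.exp ((-(Complex.I * (φ : ℂ))) • H)‖ ≤ |θ - φ| * ‖H‖ := by
  have hd : ∀ u : ℝ, HasDerivAt
      (fun u : ℝ => (NormedSpace.exp ((-(Complex.I * (u : ℂ))) • H) : QOp n))
      ((-Complex.I) • (H * NormedSpace.exp ((-(Complex.I * (u : ℂ))) • H))) u := by
    intro u
    have h1 : HasDerivAt (fun u : ℝ => -(Complex.I * (u : ℂ))) (-Complex.I) u := by
      simpa using (((hasDerivAt_id u).ofReal_comp).const_mul Complex.I).fun_neg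
    exact (hasDerivAt_exp_smul_const' (𝕂 := ℂ) H (-(Complex.I * (u : ℂ)))).scomp u h1
  have := Convex.norm_image_sub_le_of_norm_hasDerivWithin_le (s := Set.univ) (C := ‖H‖)
    (fun u _ => (hd u).hasDerivWithinAt) (fun u _ => ?_) convex_univ (Set.mem_univ φ) (Set.mem_univ θ)
  · rwa [mul_comm ‖H‖, Real.norm_eq_abs] at this
  · rw [norm_smul, norm_neg, Complex.norm_I, one_mul]
    refine (norm_mul_le _ _).trans ?_
    exact mul_le_of_le_one_right (norm_nonneg _) (norm_exp_hermitian_le hH u)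

lemma norm_list_prod_le_one {ι : Type*} {f : ι → QOp n} (hf : ∀ i, ‖f i‖ ≤ 1) (l : List ι) :
    ‖(l.map f).prod‖ ≤ 1 := by
  induction l with
  | nil => simp
  | cons i l ih =>
    rw [List.map_cons, List.prod_cons]
    exact (norm_mul_le _ _).trans (mul_le_one₀ (hf i) (norm_nonneg _) ih)

lemma norm_mul_sub_mul_le {A B C D : QOp n} (hB : ‖B‖ ≤ 1) (hC : ‖C‖ ≤ 1) :
    ‖A * B - C * D‖ ≤ ‖A - C‖ + ‖B - D‖ := by
  calc ‖A * B - C * D‖ = ‖(A - C) * B + C * (B - D)‖ := by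
        rw [sub_mul, mul_sub]; congr 1; abel
    _ ≤ ‖A - C‖ * ‖B‖ + ‖C‖ * ‖B - D‖ :=
        (norm_add_le _ _).trans (add_le_add (norm_mul_le _ _) (norm_mul_le _ _))
    _ ≤ _ := add_le_add (mul_le_of_le_one_right (norm_nonneg _) hB)
        (mul_le_of_le_one_left (norm_nonneg _) hC)

/-- Exchange the factors one at a time; the others are contractions, so the errors add without
amplification. -/
lemma norm_list_prod_sub_le {ι : Type*} {f g : ι → QOp n} (hf : ∀ i, ‖f i‖ ≤ 1)
    (hg : ∀ i, ‖g i‖ ≤ 1) (l : List ι) :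
    ‖(l.map f).prod - (l.map g).prod‖ ≤ (l.map fun i => ‖f i - g i‖).sum := by
  induction l with
  | nil => simp
  | cons i l ih =>
    simp only [List.map_cons, List.prod_cons, List.sum_cons]
    exact (norm_mul_sub_mul_le (norm_list_prod_le_one hf l) (hg i)).trans (by gcongr)

/-- `f (k - 1) * ⋯ * f 0`. -/
def prodDown (f : ℕ → QOp n) : ℕ → QOp n
  | 0 => 1
  | k + 1 => f k * prodDown f k

lemma norm_prodDown_le_one {f : ℕ → QOp n} {k : ℕ} (hf : ∀ r < k, ‖f r‖ ≤ 1) :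
    ‖prodDown f k‖ ≤ 1 := by
  induction k with
  | zero => simp [prodDown]
  | succ k ih =>
    exact (norm_mul_le _ _).trans
      (mul_le_one₀ (hf k (by omega)) (norm_nonneg _) (ih fun r hr => hf r (by omega)))

lemma norm_prodDown_sub_le {f g : ℕ → QOp n} {k : ℕ} {ε : ℝ} (hf : ∀ r < k, ‖f r‖ ≤ 1)
    (hg : ∀ r < k, ‖g r‖ ≤ 1) (h : ∀ r < k, ‖f r - g r‖ ≤ ε) :
    ‖prodDown f k - prodDown g k‖ ≤ k * ε := by
  induction k with
  | zero => simp [prodDown]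
  | succ k ih =>
    have h1 := ih (fun r hr => hf r (by omega)) (fun r hr => hg r (by omega))
      (fun r hr => h r (by omega))
    have h2 := norm_mul_sub_mul_le (A := f k) (B := prodDown f k) (C := g k) (D := prodDown g k)
      (norm_prodDown_le_one fun r hr => hf r (by omega)) (hg k (by omega))
    refine h2.trans ?_
    push_cast
    linarith [h k (by omega)]

lemma stepProd_eq_prodDown (S : ℤ → ℂ → QOp n) (k : ℕ) (z : ℂ) :
    stepProd S k z = prodDown (fun r => S r z) k := by
  induction k with
  | zero => rfl
  | succ k ih => rw [stepProd, Pi.mul_apply, ih, prodDown]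

/-- Since `H` is Hermitian, the derivative of `U* U` vanishes. -/
lemma propagator_star_mul_self {H : ℝ → QOp n} {t₀ t : ℝ} (h : t₀ ≤ t) {U : ℝ → QOp n}
    (hH : ∀ τ, (H τ).IsHermitian) (hU : IsPropagator H t₀ t U) : star (U t) * U t = 1 := by
  have hd : ∀ τ ∈ Set.Icc t₀ t,
      HasDerivWithinAt (fun τ => star (U τ) * U τ) 0 (Set.Icc t₀ t) τ := by
    intro τ hτ
    have h1 := hU.2 τ hτ
    refine (h1.star.mul h1).congr_deriv ?_
    have : star (H τ) = H τ := hH τ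
    simp [this, mul_assoc]
  have hc := constant_of_derivWithin_zero (f := fun τ => star (U τ) * U τ)
    (fun τ hτ => (hd τ hτ).differentiableWithinAt)
    (fun τ hτ => by
      rcases h.eq_or_lt with rfl | hlt
      · simp at hτ
      · exact (hd τ (Set.Ico_subset_Icc_self hτ)).derivWithin
          (uniqueDiffOn_Icc hlt τ (Set.Ico_subset_Icc_self hτ))) t ⟨h, le_rfl⟩
  simpa only [hU.1, star_one, one_mul] using hc

lemma norm_propagator_le_one {H : ℝ → QOp n} {t₀ t : ℝ} (h : t₀ ≤ t) {U : ℝ → QOp n}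
    (hH : ∀ τ, (H τ).IsHermitian) (hU : IsPropagator H t₀ t U) : ‖U t‖ ≤ 1 := by
  have h1 := CStarRing.norm_star_mul_self (x := U t)
  rw [propagator_star_mul_self h hH hU, CStarRing.norm_one] at h1
  nlinarith [norm_nonneg (U t)]

lemma hamiltonian_isHermitian {L : ℕ} {Hs : Fin L → QOp n} (hH : ∀ j, (Hs j).IsHermitian)
    (α : Fin L → ℝ → ℝ) (τ : ℝ) : (hamiltonian Hs α τ).IsHermitian := by
  rw [Matrix.IsHermitian, ← Matrix.star_eq_conjTranspose, hamiltonian, star_sum]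
  refine Finset.sum_congr rfl fun j _ => ?_
  rw [star_smul, show star (Hs j) = Hs j from hH j]
  simp

end Unitary

/-! ### Taylor expansion of the coefficients -/

section Coeff

variable {L : ℕ}

/-- Taylor coefficients of `s ↦ (t - t₀) α (t₀ + s (t - t₀))`. -/
def scaledCoeff (α : ℝ → ℝ) (t₀ t : ℝ) (i : ℕ) : ℝ :=
  (t - t₀) ^ (i + 1) / i.factorial * iteratedDerivWithin i α (Set.Icc t₀ t) t₀

/-- The derivatives are bounded only after summation over `j`, at each time separately, so termwise
remainders would lead to a sum of maxima. Taylor's theorem is applied instead to one signed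
combination of the `α j`, with the signs of the remainders at the given `τ`. -/
lemma sum_taylor_remainder_le {α : Fin L → ℝ → ℝ} {t₀ t : ℝ} (h : t₀ < t)
    (hα : ∀ j, ContDiffOn ℝ ∞ (α j) (Set.Icc t₀ t)) {w : Fin L → ℝ} (hw : ∀ j, 0 ≤ w j) (N : ℕ)
    {Y : ℝ} (hY : ∀ τ ∈ Set.Icc t₀ t,
      ∑ j, |iteratedDerivWithin (N + 1) (α j) (Set.Icc t₀ t) τ| * w j ≤ Y) {τ : ℝ}
    (hτ : τ ∈ Set.Icc t₀ t) :
    ∑ j, |α j τ - taylorWithinEval (α j) N (Set.Icc t₀ t) t₀ τ| * w j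
      ≤ Y * (τ - t₀) ^ (N + 1) := by
  set D := Set.Icc t₀ t
  have hD : UniqueDiffOn ℝ D := uniqueDiffOn_Icc h
  set R : Fin L → ℝ := fun j => α j τ - taylorWithinEval (α j) N D t₀ τ
  set c : Fin L → ℝ := fun j => (if 0 ≤ R j then 1 else -1) * w j
  have hc : ∀ j, |c j| = w j := fun j => by
    simp only [c, abs_mul, abs_of_nonneg (hw j)]
    split_ifs <;> simp
  have hcR : ∀ j, c j * R j = |R j| * w j := fun j => by
    simp only [c]
    split_ifs with h
    · rw [abs_of_nonneg h]; ring
    · rw [abs_of_neg (not_le.1 h)]; ring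
  set f : ℝ → ℝ := ∑ j, fun τ => c j * α j τ
  have hcd : ∀ j, ContDiffOn ℝ ∞ (fun τ => c j * α j τ) D := fun j => contDiffOn_const.mul (hα j)
  have hfd : ∀ i, ∀ y ∈ D, iteratedDerivWithin i f D y
      = ∑ j, c j * iteratedDerivWithin i (α j) D y := by
    intro i y hy
    rw [iteratedDerivWithin_sum hy hD fun j _ =>
      ((hcd j).of_le (by exact_mod_cast le_top)) y hy]
    exact Finset.sum_congr rfl fun j _ => iteratedDerivWithin_const_mul_field _ _
  have hfC : ContDiffOn ℝ (N + 1) f D := by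
    have : ContDiffOn ℝ ∞ f D := by
      have := ContDiffOn.sum (s := Finset.univ) fun j _ => hcd j
      refine this.congr fun x _ => ?_
      simp [f]
    exact this.of_le (by exact_mod_cast le_top)
  have hY0 : 0 ≤ Y := le_trans (Finset.sum_nonneg fun j _ => mul_nonneg (abs_nonneg _) (hw j)) (hY τ hτ)
  have h1 := taylor_mean_remainder_bound h.le hfC hτ (C := Y) fun y hy => by
    rw [hfd _ y hy]
    refine (norm_sum_le _ _).trans (le_trans (le_of_eq ?_) (hY y hy))
    refine Finset.sum_congr rfl fun j _ => ?_
    rw [norm_mul, Real.norm_eq_abs, hc, Real.norm_eq_abs, mul_comm]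
  have h2 : f τ - taylorWithinEval f N D t₀ τ = ∑ j, |R j| * w j := by
    rw [← Finset.sum_congr rfl fun j _ => hcR j]
    simp only [R, taylor_within_apply, mul_sub, Finset.sum_sub_distrib, smul_eq_mul]
    congr 1
    · simp [f]
    · simp only [Finset.mul_sum]
      rw [Finset.sum_comm]
      refine Finset.sum_congr rfl fun i _ => ?_
      rw [hfd i t₀ ⟨le_rfl, h.le⟩, Finset.mul_sum]
      refine Finset.sum_congr rfl fun j _ => by ring
  rw [h2] at h1
  refine ((le_abs_self _).trans h1).trans ?_
  have h3 : 0 ≤ Y * (τ - t₀) ^ (N + 1) := mul_nonneg hY0 (pow_nonneg (by linarith [hτ.1]) _)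
  exact div_le_self h3 (by exact_mod_cast Nat.factorial_pos N)

lemma sum_scaledCoeff_eq {α : ℝ → ℝ} {t₀ t : ℝ} (N : ℕ) (s : ℝ) :
    ∑ i ∈ Finset.range (N + 1), scaledCoeff α t₀ t i * s ^ i
      = (t - t₀) * taylorWithinEval α N (Set.Icc t₀ t) t₀ (t₀ + s * (t - t₀)) := by
  rw [taylor_within_apply, Finset.mul_sum]
  refine Finset.sum_congr rfl fun i _ => ?_
  rw [scaledCoeff, smul_eq_mul, add_sub_cancel_left, mul_pow, pow_succ]
  ring

variable {n M : ℕ} {Hs : Fin L → QOp n} {α : Fin L → ℝ → ℝ} {Λ : ℝ → ℝ} {t₀ t κ : ℝ}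

lemma sum_scaledCoeff_le (h : t₀ < t) (hκ : IsTermRatio M Hs α Λ t₀ t κ) {i : ℕ} (hi : i ≤ 2 * M + 1) :
    ∑ j, |scaledCoeff (α j) t₀ t i| * ‖Hs j‖ ≤ (κ * lambdaMax Λ t₀ t * (t - t₀)) ^ (i + 1) := by
  have h0 : 0 < t - t₀ := sub_pos.2 h
  have h1 := hκ.2.2 i hi t₀ ⟨le_rfl, h.le⟩
  have hf : (1 : ℝ) ≤ i.factorial := by exact_mod_cast Nat.factorial_pos i
  have h2 : ∑ j, |scaledCoeff (α j) t₀ t i| * ‖Hs j‖ = (t - t₀) ^ (i + 1) / i.factorial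
      * ∑ j, |iteratedDerivWithin i (α j) (Set.Icc t₀ t) t₀| * ‖Hs j‖ := by
    rw [Finset.mul_sum]
    refine Finset.sum_congr rfl fun j _ => ?_
    rw [scaledCoeff, abs_mul, abs_of_pos (by positivity), mul_assoc]
  rw [h2, mul_pow _ (t - t₀), mul_comm]
  have h3 : 0 ≤ ∑ j, |iteratedDerivWithin i (α j) (Set.Icc t₀ t) t₀| * ‖Hs j‖ :=
    Finset.sum_nonneg fun j _ => by positivity
  refine mul_le_mul h1 ?_ (by positivity) (h3.trans h1)
  exact div_le_self (by positivity) hf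

lemma sum_scaled_remainder_le (hM : 1 ≤ M) (h : t₀ < t)
    (hα : ∀ j, ContDiffOn ℝ ∞ (α j) (Set.Icc t₀ t)) (hκ : IsTermRatio M Hs α Λ t₀ t κ)
    (hx : 0 ≤ κ * lambdaMax Λ t₀ t) {s : ℝ} (hs : s ∈ Set.Icc (0 : ℝ) 1) :
    ∑ j, |(t - t₀) * α j (t₀ + s * (t - t₀))
        - ∑ i ∈ Finset.range (2 * M), scaledCoeff (α j) t₀ t i * s ^ i| * ‖Hs j‖
      ≤ (κ * lambdaMax Λ t₀ t * (t - t₀)) ^ (2 * M + 1) := by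
  have h0 : 0 < t - t₀ := sub_pos.2 h
  -- A Taylor polynomial with `2 M` terms has degree `2 M - 1`; its remainder involves the
  -- derivative of order `2 M`.
  obtain ⟨N, hN⟩ : ∃ N, 2 * M = N + 1 := ⟨2 * M - 1, by omega⟩
  have hτ : t₀ + s * (t - t₀) ∈ Set.Icc t₀ t := by
    constructor
    · nlinarith [hs.1]
    · nlinarith [hs.2]
  have h1 := sum_taylor_remainder_le h hα (w := fun j => ‖Hs j‖) (fun j => norm_nonneg _) N
    (Y := (κ * lambdaMax Λ t₀ t) ^ (2 * M + 1)) (fun τ hτ => by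
      have := hκ.2.2 (2 * M) (by omega) τ hτ
      rwa [← hN]) hτ
  have h2 : ∀ j, |(t - t₀) * α j (t₀ + s * (t - t₀))
        - ∑ i ∈ Finset.range (2 * M), scaledCoeff (α j) t₀ t i * s ^ i| * ‖Hs j‖
      = (t - t₀) * (|α j (t₀ + s * (t - t₀))
        - taylorWithinEval (α j) N (Set.Icc t₀ t) t₀ (t₀ + s * (t - t₀))| * ‖Hs j‖) := by
    intro j
    rw [hN, sum_scaledCoeff_eq, ← mul_sub, abs_mul, abs_of_pos h0, mul_assoc]
  rw [Finset.sum_congr rfl fun j _ => h2 j, ← Finset.mul_sum]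
  refine (mul_le_mul_of_nonneg_left h1 h0.le).trans ?_
  rw [add_sub_cancel_left, ← hN, mul_pow _ (t - t₀) (2 * M + 1), mul_pow s, pow_succ (t - t₀)]
  have h3 : s ^ (2 * M) ≤ 1 := pow_le_one₀ hs.1 hs.2
  have h4 : 0 ≤ (t - t₀) * (κ * lambdaMax Λ t₀ t) ^ (2 * M + 1) * (t - t₀) ^ (2 * M) := by positivity
  calc _ = (t - t₀) * (κ * lambdaMax Λ t₀ t) ^ (2 * M + 1) * (t - t₀) ^ (2 * M) * s ^ (2 * M) := by ring
    _ ≤ (t - t₀) * (κ * lambdaMax Λ t₀ t) ^ (2 * M + 1) * (t - t₀) ^ (2 * M) * 1 := by gcongr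
    _ = _ := by ring

lemma lambdaMax_pos (h : t₀ < t) {H : ℝ → QOp n} (hΛ : IsLambdaBound H t₀ t Λ) :
    0 < lambdaMax Λ t₀ t := by
  have hb : BddAbove (Λ '' Set.Icc t₀ t) := (isCompact_Icc.image_of_continuousOn hΛ.1).bddAbove
  exact (hΛ.2 t₀ ⟨le_rfl, h.le⟩).1.trans_le (le_csSup hb ⟨t₀, ⟨le_rfl, h.le⟩, rfl⟩)

lemma bddAbove_deriv (h : t₀ < t) (hα : ∀ j, ContDiffOn ℝ ∞ (α j) (Set.Icc t₀ t)) :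
    BddAbove {x | ∃ j, ∃ τ ∈ Set.Icc t₀ t, x = |derivWithin (α j) (Set.Icc t₀ t) τ|} := by
  have h1 : {x | ∃ j, ∃ τ ∈ Set.Icc t₀ t, x = |derivWithin (α j) (Set.Icc t₀ t) τ|}
      = ⋃ j, (fun τ => |derivWithin (α j) (Set.Icc t₀ t) τ|) '' Set.Icc t₀ t := by
    ext x; simp [eq_comm]
  rw [h1, ← Set.biUnion_univ, Set.finite_univ.bddAbove_biUnion]
  intro j _
  refine (isCompact_Icc.image_of_continuousOn ?_).bddAbove
  exact ((hα j).continuousOn_derivWithin (uniqueDiffOn_Icc h) (by exact_mod_cast le_top)).abs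

lemma maxDeriv_nonneg : 0 ≤ maxDeriv α t₀ t := by
  refine Real.sSup_nonneg ?_
  rintro x ⟨j, τ, _, rfl⟩
  exact abs_nonneg _

lemma abs_sub_le_maxDeriv (h : t₀ < t) (hα : ∀ j, ContDiffOn ℝ ∞ (α j) (Set.Icc t₀ t)) (j : Fin L)
    {σ τ : ℝ} (hσ : σ ∈ Set.Icc t₀ t) (hτ : τ ∈ Set.Icc t₀ t) :
    |α j σ - α j τ| ≤ maxDeriv α t₀ t * |σ - τ| := by
  have := Convex.norm_image_sub_le_of_norm_derivWithin_le (C := maxDeriv α t₀ t)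
    ((hα j).differentiableOn (by simp)) (fun x hx => ?_) (convex_Icc t₀ t) hτ hσ
  · simpa using this
  · exact le_csSup (bddAbove_deriv h hα) ⟨j, x, hx, rfl⟩

lemma meshPoint_mem (h : t₀ < t) (nt : ℕ) (q : Fin (2 ^ nt)) : meshPoint t₀ t nt q ∈ Set.Icc t₀ t := by
  have h0 : 0 < t - t₀ := sub_pos.2 h
  have hq : (q : ℝ) ≤ 2 ^ nt - 1 := by
    have : ((q : ℕ) : ℝ) + 1 ≤ 2 ^ nt := by exact_mod_cast q.2
    linarith
  have h1 : (0 : ℝ) ≤ 2 ^ nt - 1 := (Nat.cast_nonneg (q : ℕ)).trans hq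
  rw [meshPoint]
  constructor
  · have : 0 ≤ (q : ℝ) * ((t - t₀) / (2 ^ nt - 1)) := by positivity
    linarith
  · have : (q : ℝ) * ((t - t₀) / (2 ^ nt - 1)) ≤ t - t₀ := by
      rw [← mul_div_assoc]
      exact div_le_of_le_mul₀ h1 h0.le (by rw [mul_comm]; gcongr)
    linarith

lemma exists_meshPoint_near (h : t₀ < t) (nt : ℕ) {τ : ℝ} (hτ : τ ∈ Set.Icc t₀ t) :
    ∃ q, |meshPoint t₀ t nt q - τ| ≤ 2 * (t - t₀) / 2 ^ nt := by
  have h0 : 0 < t - t₀ := sub_pos.2 h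
  -- For `nt = 0` division by zero makes `t₀` the only mesh point, and the bound `2 Δt` is clear.
  -- Otherwise rounding down loses at most one spacing `Δt / (2 ^ nt - 1) ≤ 2 Δt / 2 ^ nt`.
  rcases Nat.eq_zero_or_pos nt with rfl | hnt
  · refine ⟨0, ?_⟩
    simp only [meshPoint, pow_zero, sub_self, div_zero, mul_zero, add_zero, div_one]
    rw [abs_le]; constructor <;> linarith [hτ.1, hτ.2]
  · have h2 : (2 : ℝ) ≤ 2 ^ nt := by
      calc (2 : ℝ) = 2 ^ 1 := by norm_num
        _ ≤ _ := pow_le_pow_right₀ (by norm_num) hnt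
    set N : ℝ := 2 ^ nt - 1 with hN
    have hN1 : 1 ≤ N := by linarith
    have hy : 0 ≤ (τ - t₀) / (t - t₀) * N := by
      have := sub_nonneg.2 hτ.1
      positivity
    have hyN : (τ - t₀) / (t - t₀) * N ≤ N := by
      have : (τ - t₀) / (t - t₀) ≤ 1 := by rw [div_le_one h0]; linarith [hτ.2]
      nlinarith
    have hfl := Nat.floor_le hy
    have hfl2 := Nat.lt_floor_add_one ((τ - t₀) / (t - t₀) * N)
    set m := ⌊(τ - t₀) / (t - t₀) * N⌋₊
    have hm : m < 2 ^ nt := by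
      have : (m : ℝ) < 2 ^ nt := by linarith
      exact_mod_cast this
    refine ⟨⟨m, hm⟩, ?_⟩
    have h3 : meshPoint t₀ t nt ⟨m, hm⟩ - τ
        = (m - (τ - t₀) / (t - t₀) * N) * ((t - t₀) / N) := by
      rw [meshPoint, ← hN]; simp only; field_simp; ring
    rw [h3, abs_mul, abs_of_pos (by positivity : 0 < (t - t₀) / N)]
    have h4 : |(m : ℝ) - (τ - t₀) / (t - t₀) * N| ≤ 1 := by
      rw [abs_le]; constructor <;> linarith
    calc _ ≤ 1 * ((t - t₀) / N) := by gcongr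
      _ ≤ 2 * (t - t₀) / 2 ^ nt := by
        rw [one_mul, div_le_div_iff₀ (by positivity) (by positivity)]
        nlinarith

end Coeff

/-! ### Error of the multiproduct formula with coefficients at mesh points -/

section Error

variable {n L M : ℕ} {Hs : Fin L → QOp n} {α : Fin L → ℝ → ℝ} {Λ : ℝ → ℝ} {t₀ t κ : ℝ}

/-- One symmetric product step with the phases `θ l`. -/
def phaseStep (Hs : Fin L → QOp n) (θ : Fin L → ℝ) : QOp n :=
  ((palindrome L).map fun l =>
    (NormedSpace.exp ((-(Complex.I * ((θ l : ℝ) : ℂ))) • Hs l) : QOp n)).prod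

lemma norm_phaseStep_le_one (hH : ∀ j, (Hs j).IsHermitian) (θ : Fin L → ℝ) :
    ‖phaseStep Hs θ‖ ≤ 1 :=
  norm_list_prod_le_one (fun l => norm_exp_hermitian_le (hH l) (θ l)) _

lemma norm_phaseStep_sub_le (hH : ∀ j, (Hs j).IsHermitian) (θ φ : Fin L → ℝ) :
    ‖phaseStep Hs θ - phaseStep Hs φ‖ ≤ 2 * ∑ l, |θ l - φ l| * ‖Hs l‖ := by
  refine (norm_list_prod_sub_le (fun l => norm_exp_hermitian_le (hH l) (θ l))
    (fun l => norm_exp_hermitian_le (hH l) (φ l)) _).trans ?_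
  rw [sum_palindrome, nsmul_eq_mul]
  push_cast
  gcongr
  exact norm_exp_hermitian_sub_le (hH _) _ _

/-- At the real point `z = 1 / k` the analytic step is a product of unitaries, so it can be compared
with the circuit's step phase by phase. -/
lemma symStep_eq_phaseStep (N : ℕ) (a : Fin L → ℕ → ℝ) (r k : ℕ) :
    symStep N (fun l i => ((a l i : ℝ) : ℂ)) (fun l => (-Complex.I) • Hs l) r ((k : ℂ)⁻¹)
      = phaseStep Hs fun l =>
        (∑ i ∈ Finset.range N, a l i * (((r : ℝ) + 1 / 2) / k) ^ i) / (2 * k) := by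
  rw [symStep, list_map_prod_apply₂, phaseStep]
  congr 1
  refine List.map_congr_left fun l _ => ?_
  rw [polyExp, smul_smul, smul_smul]
  congr 2
  push_cast
  rw [Finset.sum_mul, Finset.sum_mul, Finset.sum_div, Finset.mul_sum, ← Finset.sum_neg_distrib]
  refine Finset.sum_congr rfl fun i _ => ?_
  rw [div_pow, inv_pow, pow_succ]
  by_cases hk : (k : ℂ) = 0
  · simp [hk]
  · field_simp

/-- The mesh is fine enough for the rounding of the midpoints. -/
lemma mesh_error_le (hM : 1 ≤ M) (h : t₀ < t) {lam : ℝ} (hlam : 0 < lam) (hκ : 1 ≤ κ) {nt : ℕ} {D : ℝ}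
    (hD : 0 ≤ D) (hnt : Real.logb 2 (10 * (M : ℝ) ^ 2 * L * D * (t - t₀) ^ 2 /
        (41 * lam * (t - t₀)) ^ (2 * M + 1)) ≤ (nt : ℝ)) :
    2 * L * κ * D * (t - t₀) ^ 2 / 2 ^ nt ≤ 41 ^ (2 * M + 1) * (κ * lam * (t - t₀)) ^ (2 * M + 1) := by
  have h0 : 0 < t - t₀ := sub_pos.2 h
  have hM' : (1 : ℝ) ≤ M := by exact_mod_cast hM
  set Z := (41 * lam * (t - t₀)) ^ (2 * M + 1) with hZ
  have hZ0 : 0 < Z := by positivity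
  set X := 10 * (M : ℝ) ^ 2 * L * D * (t - t₀) ^ 2 / Z with hX
  have hXle : X ≤ 2 ^ nt := by
    -- At `X = 0` (for instance for constant coefficients) the logarithm has a default value, and
    -- the inequality holds anyway.
    rcases (show 0 ≤ X by positivity).eq_or_lt with h1 | h1
    · rw [← h1]; positivity
    · rw [Real.logb_le_iff_le_rpow (by norm_num) h1, Real.rpow_natCast] at hnt
      exact hnt
  have h2 : 10 * (M : ℝ) ^ 2 * L * D * (t - t₀) ^ 2 ≤ 2 ^ nt * Z := by
    rwa [hX, div_le_iff₀ hZ0] at hXle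
  have h3 : 41 ^ (2 * M + 1) * (κ * lam * (t - t₀)) ^ (2 * M + 1) = κ ^ (2 * M + 1) * Z := by
    rw [hZ, ← mul_pow, ← mul_pow]; congr 1; ring
  have h4 : κ ≤ κ ^ (2 * M + 1) := le_self_pow₀ hκ (by omega)
  rw [h3, div_le_iff₀ (by positivity)]
  have h5 : 0 ≤ L * D * (t - t₀) ^ 2 := by positivity
  have h7 : (1 : ℝ) ≤ (M : ℝ) ^ 2 := one_le_pow₀ hM'
  have h8 := mul_le_mul_of_nonneg_right h7 h5
  have h6 : 2 * (L * D * (t - t₀) ^ 2) ≤ 2 ^ nt * Z := by linarith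
  calc 2 * L * κ * D * (t - t₀) ^ 2 = κ * (2 * (L * D * (t - t₀) ^ 2)) := by ring
    _ ≤ κ ^ (2 * M + 1) * (2 ^ nt * Z) := by gcongr
    _ = _ := by ring

/-- The error constant of the multiproduct formula. -/
def mpfConst (M : ℕ) : ℝ :=
  -- In this order: mesh rounding and truncation of the coefficients, Cauchy remainder, Gronwall
  -- comparison.
  (41 ^ (2 * M + 1) + 1) + 2 * Real.exp (2 * M) + ((2 * M) * (2 * M + 1) + 2) * 4

lemma one_le_l1norm {k : Fin M → ℕ} {a : Fin M → ℝ} (hM : 1 ≤ M) (ha : IsMPF k a) : 1 ≤ l1norm a := by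
  have h := ha.2 0 (by omega)
  simp only [mul_zero, pow_zero, inv_one, mul_one, if_true] at h
  rw [← h]
  exact Finset.sum_le_sum fun j _ => le_abs_self _

/-- A triangle inequality through two intermediate operators: the formula `P` with Taylor-truncated
coefficients at exact midpoints, and the Taylor polynomial `T` shared by `P` and the exact
evolution. -/
theorem norm_mpf_mesh_sub_propagator_le (hM : 1 ≤ M) (h : t₀ < t) {k : Fin M → ℕ} {a : Fin M → ℝ}
    (ha : IsMPF k a) (hH : ∀ j, (Hs j).IsHermitian)
    (hα : ∀ j, ContDiffOn ℝ ∞ (α j) (Set.Icc t₀ t))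
    (hΛ : IsLambdaBound (hamiltonian Hs α) t₀ t Λ) (hκ : IsTermRatio M Hs α Λ t₀ t κ)
    {U : ℝ → QOp n} (hU : IsPropagator (hamiltonian Hs α) t₀ t U) {nt : ℕ}
    (hnt : Real.logb 2 (10 * (M : ℝ) ^ 2 * L * maxDeriv α t₀ t * (t - t₀) ^ 2 /
        (41 * lambdaMax Λ t₀ t * (t - t₀)) ^ (2 * M + 1)) ≤ (nt : ℝ))
    (hx2 : κ * lambdaMax Λ t₀ t * (t - t₀) ≤ 1 / 2) {q : Fin M → ℕ → Fin (2 ^ nt)}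
    (hq : ∀ j, ∀ r < k j, |meshPoint t₀ t nt (q j r)
      - (t₀ + ((r : ℝ) + 1 / 2) / k j * (t - t₀))| ≤ 2 * (t - t₀) / 2 ^ nt) :
    ‖∑ j, (a j : ℂ) • prodDown (fun r => phaseStep Hs fun l =>
        α l (meshPoint t₀ t nt (q j r)) * ((t - t₀) / (2 * k j))) (k j) - U t‖
      ≤ mpfConst M * (l1norm a * (κ * lambdaMax Λ t₀ t * (t - t₀)) ^ (2 * M + 1)) := by
  have h0 : 0 < t - t₀ := sub_pos.2 h
  have hlam := lambdaMax_pos h hΛ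
  have hκ1 := hκ.1
  set lam := lambdaMax Λ t₀ t
  set x := κ * lam * (t - t₀) with hxdef
  have hx : 0 < x := by positivity
  set N := 2 * M with hN
  set c : Fin L → ℕ → ℝ := fun l i => scaledCoeff (α l) t₀ t i with hc
  set c' : Fin L → ℕ → ℂ := fun l i => ((c l i : ℝ) : ℂ) with hc'
  set B : Fin L → QOp n := fun l => (-Complex.I) • Hs l with hB
  have hBn : ∀ l, ‖B l‖ = ‖Hs l‖ := fun l => by simp [hB, norm_smul]
  have hsum : ∀ i < 2 * M, ∑ l, ‖c' l i‖ * ‖B l‖ ≤ x ^ (i + 1) := by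
    intro i hi
    simp only [hBn, hc', Complex.norm_real, Real.norm_eq_abs]
    exact sum_scaledCoeff_le h hκ (by omega)
  have hl1 := one_le_l1norm hM ha
  have hxN : 0 < x ^ (N + 1) := by positivity
  have hA := norm_mpf_sub_taylor_le hM ha hx hx2 hsum
  -- the propagator
  have hBd : ‖U t - ∑ p ∈ Finset.range (N + 1), odeCoeff (genCoeff N c' B) p‖
      ≤ (N * (N + 1) + 2) * x ^ (N + 1) * 4 := by
    have hmem : ∀ s ∈ Set.Icc (0 : ℝ) 1, t₀ + s * (t - t₀) ∈ Set.Icc t₀ t := fun s hs => by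
      constructor
      · nlinarith [hs.1]
      · nlinarith [hs.2]
    have := norm_ode_sub_taylor_le hx hx2 (norm_genCoeff_le hx hsum) N
      (F := fun s => ((t - t₀ : ℝ) : ℂ) • ((-Complex.I) • hamiltonian Hs α (t₀ + s * (t - t₀))))
      (U := fun s => U (t₀ + s * (t - t₀))) (fun s hs => ?_) (fun s hs => ?_) (by simp [hU.1])
    · simpa using this
    · have h1 : ((t - t₀ : ℝ) : ℂ) • ((-Complex.I) • hamiltonian Hs α (t₀ + s * (t - t₀)))
          - ∑ i ∈ Finset.range N, (s : ℂ) ^ i • genCoeff N c' B i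
          = ∑ l, ((((t - t₀) * α l (t₀ + s * (t - t₀))
            - ∑ i ∈ Finset.range N, c l i * s ^ i : ℝ)) : ℂ) • B l := by
        have h2 : ∑ i ∈ Finset.range N, (s : ℂ) ^ i • genCoeff N c' B i
            = ∑ l, (∑ i ∈ Finset.range N, c' l i * (s : ℂ) ^ i) • B l := by
          simp only [Finset.sum_smul]
          rw [Finset.sum_comm]
          refine Finset.sum_congr rfl fun i hi => ?_
          rw [genCoeff, if_pos (Finset.mem_range.1 hi), Finset.smul_sum]
          refine Finset.sum_congr rfl fun l _ => ?_
          rw [smul_smul, mul_comm]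
        rw [h2, hamiltonian, Finset.smul_sum, Finset.smul_sum, ← Finset.sum_sub_distrib]
        refine Finset.sum_congr rfl fun l _ => ?_
        simp only [hB, hc']
        rw [smul_comm (-Complex.I), smul_smul, ← sub_smul]
        congr 1
        push_cast
        rfl
      rw [h1]
      refine (norm_sum_le _ _).trans (le_trans (le_of_eq ?_)
        (sum_scaled_remainder_le hM h hα hκ (by positivity) hs))
      refine Finset.sum_congr rfl fun l _ => ?_
      rw [norm_smul, hBn, Complex.norm_real, Real.norm_eq_abs]
    · have h1 := hU.2 _ (hmem s hs)
      have h2 : HasDerivWithinAt (fun s : ℝ => t₀ + s * (t - t₀)) (t - t₀) (Set.Icc 0 1) s := by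
        simpa using (((hasDerivAt_id s).mul_const (t - t₀)).const_add t₀).hasDerivWithinAt
      refine (h1.scomp s h2 (fun s hs => hmem s hs)).congr_deriv ?_
      rw [← Complex.coe_smul, smul_mul_assoc, smul_mul_assoc, neg_smul]
  -- mesh points and Taylor truncation
  have hstep : ∀ j, ∀ r < k j,
      ‖phaseStep Hs (fun l => α l (meshPoint t₀ t nt (q j r)) * ((t - t₀) / (2 * k j)))
        - symStep N c' B r ((k j : ℂ)⁻¹)‖ ≤ (41 ^ (N + 1) + 1) * x ^ (N + 1) / k j := by
    intro j r hr
    have hk : (0 : ℝ) < k j := by exact_mod_cast ha.1 j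
    rw [symStep_eq_phaseStep]
    refine (norm_phaseStep_sub_le hH _ _).trans ?_
    set s : ℝ := ((r : ℝ) + 1 / 2) / k j with hs
    have hs01 : s ∈ Set.Icc (0 : ℝ) 1 := by
      refine ⟨by positivity, ?_⟩
      rw [hs, div_le_one hk]
      have : (r : ℝ) + 1 ≤ k j := by exact_mod_cast hr
      linarith
    have hmid : t₀ + s * (t - t₀) ∈ Set.Icc t₀ t := by
      constructor
      · nlinarith [hs01.1]
      · nlinarith [hs01.2]
    have h1 : ∀ l, |α l (meshPoint t₀ t nt (q j r)) * ((t - t₀) / (2 * k j))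
          - (∑ i ∈ Finset.range N, c l i * s ^ i) / (2 * k j)| * ‖Hs l‖
        ≤ (1 / (2 * k j)) * (2 * κ * maxDeriv α t₀ t * (t - t₀) ^ 2 / 2 ^ nt
          + |(t - t₀) * α l (t₀ + s * (t - t₀)) - ∑ i ∈ Finset.range N, c l i * s ^ i| * ‖Hs l‖) := by
      intro l
      have h2 : α l (meshPoint t₀ t nt (q j r)) * ((t - t₀) / (2 * k j))
          - (∑ i ∈ Finset.range N, c l i * s ^ i) / (2 * k j)
          = (1 / (2 * k j)) * ((t - t₀) * (α l (meshPoint t₀ t nt (q j r)) - α l (t₀ + s * (t - t₀)))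
            + ((t - t₀) * α l (t₀ + s * (t - t₀)) - ∑ i ∈ Finset.range N, c l i * s ^ i)) := by
        field_simp; ring
      rw [h2, abs_mul, abs_of_pos (by positivity : 0 < 1 / (2 * (k j : ℝ))), mul_assoc]
      refine mul_le_mul_of_nonneg_left ?_ (by positivity)
      refine (mul_le_mul_of_nonneg_right (abs_add_le _ _) (norm_nonneg _)).trans ?_
      rw [add_mul]
      gcongr
      rw [abs_mul, abs_of_pos h0]
      have h3 := abs_sub_le_maxDeriv h hα l (meshPoint_mem h nt (q j r)) hmid
      have hD := maxDeriv_nonneg (α := α) (t₀ := t₀) (t := t)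
      calc (t - t₀) * |α l (meshPoint t₀ t nt (q j r)) - α l (t₀ + s * (t - t₀))| * ‖Hs l‖
          ≤ (t - t₀) * (maxDeriv α t₀ t * (2 * (t - t₀) / 2 ^ nt)) * κ := by
            have h4 := h3.trans (mul_le_mul_of_nonneg_left (hq j r hr) hD)
            have h5 := hκ.2.1 l
            gcongr
        _ = _ := by ring
    have h2 := Finset.sum_le_sum fun l (_ : l ∈ Finset.univ) => h1 l
    rw [← Finset.mul_sum, Finset.sum_add_distrib] at h2
    have h3 := sum_scaled_remainder_le hM h hα hκ (by positivity) hs01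
    have h4 := mesh_error_le (L := L) hM h hlam hκ1 (maxDeriv_nonneg (α := α) (t₀ := t₀) (t := t)) hnt
    have h5 : ∑ _l : Fin L, 2 * κ * maxDeriv α t₀ t * (t - t₀) ^ 2 / 2 ^ nt
        = 2 * L * κ * maxDeriv α t₀ t * (t - t₀) ^ 2 / 2 ^ nt := by
      rw [Finset.sum_const, Finset.card_univ, Fintype.card_fin, nsmul_eq_mul]; ring
    rw [h5] at h2
    calc _ ≤ 2 * ((1 / (2 * k j)) * (41 ^ (N + 1) * x ^ (N + 1) + x ^ (N + 1))) := by
          gcongr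
          refine h2.trans ?_
          gcongr
      _ = _ := by field_simp
  -- The error of one step carries a factor `1 / k j`, which the `k j` steps use up.
  have hprod : ∀ j, ‖prodDown (fun r => phaseStep Hs fun l =>
        α l (meshPoint t₀ t nt (q j r)) * ((t - t₀) / (2 * k j))) (k j)
      - stepProd (symStep N c' B) (k j) ((k j : ℂ)⁻¹)‖ ≤ (41 ^ (N + 1) + 1) * x ^ (N + 1) := by
    intro j
    have hk : (k j : ℝ) ≠ 0 := by exact_mod_cast (ha.1 j).ne'
    rw [stepProd_eq_prodDown]
    refine (norm_prodDown_sub_le (fun r _ => norm_phaseStep_le_one hH _) (fun r _ => ?_)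
      (hstep j)).trans (le_of_eq ?_)
    · rw [symStep_eq_phaseStep]
      exact norm_phaseStep_le_one hH _
    · field_simp
  have hC : ‖∑ j, (a j : ℂ) • prodDown (fun r => phaseStep Hs fun l =>
        α l (meshPoint t₀ t nt (q j r)) * ((t - t₀) / (2 * k j))) (k j)
      - ∑ j, (a j : ℂ) • stepProd (symStep N c' B) (k j) ((k j : ℂ)⁻¹)‖
      ≤ l1norm a * ((41 ^ (N + 1) + 1) * x ^ (N + 1)) := by
    rw [← Finset.sum_sub_distrib, l1norm, Finset.sum_mul]
    refine (norm_sum_le _ _).trans (Finset.sum_le_sum fun j _ => ?_)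
    rw [← smul_sub, norm_smul, Complex.norm_real, Real.norm_eq_abs]
    have := hprod j
    gcongr
  rw [mpfConst]
  set P := ∑ j, (a j : ℂ) • stepProd (symStep N c' B) (k j) ((k j : ℂ)⁻¹)
  set T := ∑ p ∈ Finset.range (N + 1), odeCoeff (genCoeff N c' B) p
  refine (norm_sub_le_norm_sub_add_norm_sub _ P _).trans ?_
  have h6 : ‖P - U t‖ ≤ ‖P - T‖ + ‖U t - T‖ := by
    rw [norm_sub_rev (U t)]; exact norm_sub_le_norm_sub_add_norm_sub _ _ _
  -- The Gronwall term carries no weights; `1 ≤ ‖a‖₁` brings it to the common form.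
  have h7 : (N * (N + 1) + 2) * x ^ (N + 1) * 4
      ≤ ((N : ℝ) * (N + 1) + 2) * (l1norm a * x ^ (N + 1)) * 4 := by
    gcongr
    exact le_mul_of_one_le_left hxN.le hl1
  have hNr : (N : ℝ) = 2 * M := by rw [hN]; push_cast; ring
  rw [hNr] at h7 hBd
  nlinarith [hC, hA, hBd, h6, h7]

end Error

/-! ### Query circuits -/

section Circuits

variable {w L nt m b n : ℕ}

lemma Circuit.eval_append (Uα : Matrix (CoeffIdx L nt m b) (CoeffIdx L nt m b) ℂ)
    (UH : Matrix (HamIdx L b n) (HamIdx L b n) ℂ) (c d : Circuit w L nt m b n) :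
    Circuit.eval Uα UH (c ++ d) = Circuit.eval Uα UH d * Circuit.eval Uα UH c := by
  induction c with
  | nil => simp [Circuit.eval]
  | cons g c ih => simp only [List.cons_append, Circuit.eval, ih, mul_assoc]

lemma Circuit.eval_singleton (Uα : Matrix (CoeffIdx L nt m b) (CoeffIdx L nt m b) ℂ)
    (UH : Matrix (HamIdx L b n) (HamIdx L b n) ℂ) (g : Gate w L nt m b n) :
    Circuit.eval Uα UH [g] = g.eval Uα UH := by
  simp [Circuit.eval]

lemma Circuit.queries_append (c d : Circuit w L nt m b n) :
    Circuit.queries (c ++ d) = Circuit.queries c + Circuit.queries d := by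
  simp [Circuit.queries]

/-- The inverse gate. -/
def Gate.adj : Gate w L nt m b n → Gate w L nt m b n
  | .free G => .free G⁻¹
  | .coeff => .coeff
  | .ham => .hamInv
  | .hamInv => .ham

/-- The inverse circuit. -/
def Circuit.adj (c : Circuit w L nt m b n) : Circuit w L nt m b n := (c.map Gate.adj).reverse

lemma Circuit.queries_adj (c : Circuit w L nt m b n) : Circuit.queries c.adj = Circuit.queries c := by
  have h : ∀ g : Gate w L nt m b n, g.adj.queries = g.queries := by rintro (_ | _ | _ | _) <;> rfl
  rw [Circuit.queries, Circuit.adj, List.map_reverse, List.sum_reverse, List.map_map, Circuit.queries]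
  congr 1
  exact List.map_congr_left fun g _ => h g

lemma liftCoeff_conjTranspose (U : Matrix (CoeffIdx L nt m b) (CoeffIdx L nt m b) ℂ) :
    (liftCoeff w n U).conjTranspose = liftCoeff w n U.conjTranspose := by
  ext ⟨w₁, j, q, s, v, x⟩ ⟨w₂, j', q', s', v', x'⟩
  simp only [Matrix.conjTranspose_apply, liftCoeff, Matrix.of_apply, eq_comm (a := w₂),
    eq_comm (a := x')]
  split_ifs <;> simp

lemma liftHam_conjTranspose (U : Matrix (HamIdx L b n) (HamIdx L b n) ℂ) :
    (liftHam w nt m U).conjTranspose = liftHam w nt m U.conjTranspose := by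
  ext ⟨w₁, j, q, s, v, x⟩ ⟨w₂, j', q', s', v', x'⟩
  simp only [Matrix.conjTranspose_apply, liftHam, Matrix.of_apply, eq_comm (a := w₂),
    eq_comm (a := q'), eq_comm (a := s')]
  split_ifs <;> simp

/-- Reordering of the registers for `U_α`. -/
def coeffEquiv (w L nt m b n : ℕ) :
    FullIdx w L nt m b n ≃ (Fin (2 ^ w) × Fin (2 ^ n)) × CoeffIdx L nt m b where
  toFun f := ((f.1, f.2.2.2.2.2), (f.2.1, f.2.2.1, f.2.2.2.1, f.2.2.2.2.1))
  invFun g := (g.1.1, g.2.1, g.2.2.1, g.2.2.2.1, g.2.2.2.2, g.1.2)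
  left_inv _ := rfl
  right_inv _ := rfl

/-- Reordering of the registers for `U_H`. -/
def hamEquiv (w L nt m b n : ℕ) :
    FullIdx w L nt m b n ≃ (Fin (2 ^ w) × Fin (2 ^ nt) × Fin (2 ^ m)) × HamIdx L b n where
  toFun f := ((f.1, f.2.2.1, f.2.2.2.1), (f.2.1, f.2.2.2.2.1, f.2.2.2.2.2))
  invFun g := (g.1.1, g.2.1, g.1.2.1, g.1.2.2, g.2.2.1, g.2.2.2)
  left_inv _ := rfl
  right_inv _ := rfl

open scoped Kronecker in
lemma submatrix_kronecker_mem_unitary {ι κ ν : Type*} [Fintype ι] [DecidableEq ι] [Fintype κ]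
    [DecidableEq κ] [Fintype ν] [DecidableEq ν] (e : ι ≃ κ × ν) {U : Matrix ν ν ℂ}
    (hU : U ∈ Matrix.unitaryGroup ν ℂ) :
    ((1 : Matrix κ κ ℂ) ⊗ₖ U).submatrix e e ∈ Matrix.unitaryGroup ι ℂ := by
  have h := Matrix.kronecker_mem_unitary (one_mem (Matrix.unitaryGroup κ ℂ)) hU
  rw [Matrix.mem_unitaryGroup_iff] at h ⊢
  rw [Matrix.star_eq_conjTranspose, Matrix.conjTranspose_submatrix, Matrix.submatrix_mul_equiv,
    ← Matrix.star_eq_conjTranspose, h, Matrix.submatrix_one_equiv]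

lemma liftCoeff_mem_unitary {U : Matrix (CoeffIdx L nt m b) (CoeffIdx L nt m b) ℂ}
    (hU : U ∈ Matrix.unitaryGroup _ ℂ) :
    liftCoeff w n U ∈ Matrix.unitaryGroup (FullIdx w L nt m b n) ℂ := by
  convert submatrix_kronecker_mem_unitary (coeffEquiv w L nt m b n) hU using 1
  ext ⟨w₁, j, q, s, v, x⟩ ⟨w₂, j', q', s', v', x'⟩
  simp [liftCoeff, coeffEquiv, Matrix.one_apply]

lemma liftHam_mem_unitary {U : Matrix (HamIdx L b n) (HamIdx L b n) ℂ}
    (hU : U ∈ Matrix.unitaryGroup _ ℂ) :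
    liftHam w nt m U ∈ Matrix.unitaryGroup (FullIdx w L nt m b n) ℂ := by
  convert submatrix_kronecker_mem_unitary (hamEquiv w L nt m b n) hU using 1
  ext ⟨w₁, j, q, s, v, x⟩ ⟨w₂, j', q', s', v', x'⟩
  simp [liftHam, hamEquiv, Matrix.one_apply]

variable {Uα : Matrix (CoeffIdx L nt m b) (CoeffIdx L nt m b) ℂ}
  {UH : Matrix (HamIdx L b n) (HamIdx L b n) ℂ}

lemma Gate.eval_mem_unitary (hα : Uα ∈ Matrix.unitaryGroup _ ℂ) (hH : UH ∈ Matrix.unitaryGroup _ ℂ)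
    (g : Gate w L nt m b n) : g.eval Uα UH ∈ Matrix.unitaryGroup (FullIdx w L nt m b n) ℂ := by
  cases g with
  | free G => exact G.2
  | coeff => exact liftCoeff_mem_unitary hα
  | ham => exact liftHam_mem_unitary hH
  | hamInv => exact liftHam_mem_unitary (Unitary.star_mem hH)

lemma Circuit.eval_mem_unitary (hα : Uα ∈ Matrix.unitaryGroup _ ℂ)
    (hH : UH ∈ Matrix.unitaryGroup _ ℂ) (c : Circuit w L nt m b n) :
    Circuit.eval Uα UH c ∈ Matrix.unitaryGroup (FullIdx w L nt m b n) ℂ := by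
  induction c with
  | nil => exact one_mem _
  | cons g c ih => exact mul_mem ih (Gate.eval_mem_unitary hα hH g)

lemma Gate.eval_adj (hα : Uα.conjTranspose = Uα) (g : Gate w L nt m b n) :
    g.adj.eval Uα UH = (g.eval Uα UH).conjTranspose := by
  cases g with
  | free G => rfl
  | coeff => simp only [Gate.adj, Gate.eval, liftCoeff_conjTranspose, hα]
  | ham => simp only [Gate.adj, Gate.eval, liftHam_conjTranspose]
  | hamInv => simp only [Gate.adj, Gate.eval, liftHam_conjTranspose, Matrix.conjTranspose_conjTranspose]

lemma Circuit.eval_adj (hα : Uα.conjTranspose = Uα) (c : Circuit w L nt m b n) :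
    Circuit.eval Uα UH c.adj = (Circuit.eval Uα UH c).conjTranspose := by
  induction c with
  | nil => simp [Circuit.adj, Circuit.eval]
  | cons g c ih =>
    have : Circuit.adj (g :: c) = Circuit.adj c ++ [g.adj] := by simp [Circuit.adj]
    rw [this, Circuit.eval_append, ih, Circuit.eval_singleton, Gate.eval_adj hα, Circuit.eval,
      Matrix.conjTranspose_mul]

lemma IsCoeffOracle.conjTranspose_eq {enc : Fin L → Fin (2 ^ nt) → Fin (2 ^ m) → Fin (2 ^ b)}
    (h : IsCoeffOracle enc Uα) : Uα.conjTranspose = Uα := by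
  have h1 : star Uα * Uα = 1 := Matrix.mem_unitaryGroup_iff'.1 h.1
  calc Uα.conjTranspose = star Uα * (Uα * Uα) := by rw [h.2.1, mul_one]; rfl
    _ = Uα := by rw [← mul_assoc, h1, one_mul]

/-! ### Slices of the state space -/

/-- The isometry `|ψ⟩ ↦ |w⟩|j⟩|q⟩|s⟩|v⟩|ψ⟩`. -/
def slice (n : ℕ) (w₀ : Fin (2 ^ w)) (j : Fin L) (q : Fin (2 ^ nt)) (s : Fin (2 ^ m)) (v : Fin (2 ^ b)) :
    Matrix (FullIdx w L nt m b n) (Fin (2 ^ n)) ℂ :=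
  Matrix.of fun f x => if f = (w₀, j, q, s, v, x) then 1 else 0

lemma mul_slice_apply (A : Matrix (FullIdx w L nt m b n) (FullIdx w L nt m b n) ℂ)
    (w₀ : Fin (2 ^ w)) (j : Fin L) (q : Fin (2 ^ nt)) (s : Fin (2 ^ m)) (v : Fin (2 ^ b))
    (f : FullIdx w L nt m b n) (x : Fin (2 ^ n)) :
    (A * slice n w₀ j q s v) f x = A f (w₀, j, q, s, v, x) := by
  simp only [Matrix.mul_apply, slice, Matrix.of_apply, mul_ite, mul_one, mul_zero]
  rw [Finset.sum_ite_eq' Finset.univ]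
  simp

lemma slice_mul_apply (E : QOp n) (w₀ : Fin (2 ^ w)) (j : Fin L) (q : Fin (2 ^ nt))
    (s : Fin (2 ^ m)) (v : Fin (2 ^ b)) (f : FullIdx w L nt m b n) (x : Fin (2 ^ n)) :
    (slice n w₀ j q s v * E) f x = if f = (w₀, j, q, s, v, f.2.2.2.2.2) then E f.2.2.2.2.2 x else 0 := by
  obtain ⟨w₁, j', q', s', v', y⟩ := f
  simp only [Matrix.mul_apply, slice, Matrix.of_apply, Prod.mk.injEq, ite_mul, one_mul, zero_mul,
    and_true]
  by_cases h : w₁ = w₀ ∧ j' = j ∧ q' = q ∧ s' = s ∧ v' = v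
  · obtain ⟨rfl, rfl, rfl, rfl, rfl⟩ := h
    simp
  · rw [if_neg h]
    refine Finset.sum_eq_zero fun z _ => if_neg fun hz => h ⟨hz.1, hz.2.1, hz.2.2.1, hz.2.2.2.1, hz.2.2.2.2.1⟩

lemma conjTranspose_slice_mul_slice (w₁ w₂ : Fin (2 ^ w)) (j : Fin L) (q : Fin (2 ^ nt))
    (s : Fin (2 ^ m)) (v : Fin (2 ^ b)) :
    (slice n w₁ j q s v : Matrix (FullIdx w L nt m b n) _ ℂ).conjTranspose * slice n w₂ j q s v
      = if w₁ = w₂ then 1 else 0 := by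
  refine Matrix.ext fun x y => ?_
  simp only [Matrix.mul_apply, slice, Matrix.conjTranspose_apply, Matrix.of_apply, mul_ite, mul_one,
    mul_zero]
  rw [Finset.sum_ite_eq' Finset.univ]
  by_cases h : w₁ = w₂
  · subst h
    simp only [Finset.mem_univ, if_true, Prod.mk.injEq, true_and, Matrix.one_apply]
    rw [apply_ite star]
    simp [eq_comm]
  · simp [h, Ne.symm h]

section Block

variable [NeZero L]

/-- The isometry `|ψ⟩ ↦ |w⟩|0⟩|0⟩|0⟩|0⟩|ψ⟩`. -/
def slice₀ (w L nt m b n : ℕ) [NeZero L] (w₀ : Fin (2 ^ w)) :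
    Matrix (FullIdx w L nt m b n) (Fin (2 ^ n)) ℂ :=
  slice n w₀ 0 0 0 0

lemma conjTranspose_slice₀_mul_slice₀ (w₁ w₂ : Fin (2 ^ w)) :
    (slice₀ w L nt m b n w₁).conjTranspose * slice₀ w L nt m b n w₂ = if w₁ = w₂ then 1 else 0 :=
  conjTranspose_slice_mul_slice ..

lemma block_eq (A : Matrix (FullIdx w L nt m b n) (FullIdx w L nt m b n) ℂ) :
    block A = (slice₀ w L nt m b n 0).conjTranspose * A * slice₀ w L nt m b n 0 := by
  refine Matrix.ext fun x y => ?_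
  rw [Matrix.mul_assoc, Matrix.mul_apply]
  simp only [slice₀, mul_slice_apply]
  simp only [Matrix.conjTranspose_apply, slice, Matrix.of_apply, block]
  rw [Finset.sum_eq_single (0, 0, 0, 0, 0, x)]
  · simp
  · intro f _ hf
    rw [if_neg hf]; simp
  · simp

lemma norm_slice_le : ‖slice₀ w L nt m b n 0‖ ≤ 1 := by
  have h := Matrix.l2_opNorm_conjTranspose_mul_self (slice₀ w L nt m b n 0)
  rw [conjTranspose_slice₀_mul_slice₀, if_pos rfl, CStarRing.norm_one] at h
  nlinarith [norm_nonneg (slice₀ w L nt m b n 0)]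

lemma norm_block_le_one {A : Matrix (FullIdx w L nt m b n) (FullIdx w L nt m b n) ℂ}
    (hA : A ∈ Matrix.unitaryGroup _ ℂ) : ‖block A‖ ≤ 1 := by
  have hA1 : ‖A‖ ≤ 1 := (CStarRing.norm_of_mem_unitary hA).le
  rw [block_eq]
  refine (Matrix.l2_opNorm_mul _ _).trans (mul_le_one₀ ?_ (norm_nonneg _) norm_slice_le)
  refine (Matrix.l2_opNorm_mul _ _).trans (mul_le_one₀ ?_ (norm_nonneg _) hA1)
  rw [Matrix.l2_opNorm_conjTranspose]
  exact norm_slice_le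

/-! ### Oblivious amplitude amplification -/

/-- The projection onto the all-zero state of all registers but the system. -/
def zeroProj (w L nt m b n : ℕ) [NeZero L] : Matrix (FullIdx w L nt m b n) (FullIdx w L nt m b n) ℂ :=
  slice₀ w L nt m b n 0 * (slice₀ w L nt m b n 0).conjTranspose

lemma zeroProj_isHermitian : (zeroProj w L nt m b n).conjTranspose = zeroProj w L nt m b n := by
  rw [zeroProj, Matrix.conjTranspose_mul, Matrix.conjTranspose_conjTranspose]

lemma zeroProj_mul_self : zeroProj w L nt m b n * zeroProj w L nt m b n = zeroProj w L nt m b n := by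
  rw [zeroProj, Matrix.mul_assoc, ← Matrix.mul_assoc _ (slice₀ w L nt m b n 0),
    conjTranspose_slice₀_mul_slice₀, if_pos rfl, Matrix.one_mul]

lemma reflection_mem_unitary :
    1 - 2 * zeroProj w L nt m b n ∈ Matrix.unitaryGroup (FullIdx w L nt m b n) ℂ := by
  have h : star (1 - 2 * zeroProj w L nt m b n) = 1 - 2 * zeroProj w L nt m b n := by
    rw [star_sub, star_one, star_mul, Matrix.star_eq_conjTranspose, zeroProj_isHermitian]
    simp [two_mul, mul_two]
  rw [Matrix.mem_unitaryGroup_iff, h]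
  calc _ = 1 - 4 * zeroProj w L nt m b n + 4 * (zeroProj w L nt m b n * zeroProj w L nt m b n) := by
        noncomm_ring
    _ = 1 := by rw [zeroProj_mul_self]; abel

/-- The reflection about the all-zero state. -/
def reflection (w L nt m b n : ℕ) [NeZero L] : Matrix.unitaryGroup (FullIdx w L nt m b n) ℂ :=
  ⟨1 - 2 * zeroProj w L nt m b n, reflection_mem_unitary⟩

/-- One round of amplification. -/
def amplify (c : Circuit w L nt m b n) : Circuit w L nt m b n :=
  c ++ ([.free (-reflection w L nt m b n)] ++ (c.adj ++ ([.free (reflection w L nt m b n)] ++ c)))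

lemma queries_amplify (c : Circuit w L nt m b n) : (amplify c).queries = 3 * c.queries := by
  simp only [amplify, Circuit.queries_append, Circuit.queries_adj]
  simp only [Circuit.queries, List.map_cons, List.map_nil, Gate.queries, List.sum_cons, List.sum_nil]
  ring

/-- Expand the two reflections in `V (1 - 2 P) V* (-(1 - 2 P)) V`: in the block, `2 P V + 2 V P - V`
leaves three copies of the block of `V`, and the term with two projections gives the cubic one. On
`sin θ • U` with `U` unitary this is the triple-angle formula. -/
lemma block_amplify {enc : Fin L → Fin (2 ^ nt) → Fin (2 ^ m) → Fin (2 ^ b)}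
    (hα : IsCoeffOracle enc Uα) (hH : UH ∈ Matrix.unitaryGroup _ ℂ) (c : Circuit w L nt m b n) :
    block ((amplify c).eval Uα UH) = (3 : ℂ) • block (c.eval Uα UH)
      - (4 : ℂ) • (block (c.eval Uα UH) * star (block (c.eval Uα UH)) * block (c.eval Uα UH)) := by
  have hV := Circuit.eval_mem_unitary hα.1 hH c
  simp only [amplify, Circuit.eval_append, Circuit.eval_singleton, Circuit.eval_adj hα.conjTranspose_eq]
  have hR : (Gate.free (reflection w L nt m b n)).eval Uα UH = 1 - 2 * zeroProj w L nt m b n := rfl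
  have hR' : (Gate.free (-reflection w L nt m b n)).eval Uα UH = -(1 - 2 * zeroProj w L nt m b n) := rfl
  rw [hR, hR']
  set V := Circuit.eval Uα UH c
  set P := zeroProj w L nt m b n
  have h1 : V.conjTranspose * V = 1 := Matrix.mem_unitaryGroup_iff'.1 hV
  have h2 : V * V.conjTranspose = 1 := Matrix.mem_unitaryGroup_iff.1 hV
  have h3 : V * (1 - 2 * P) * V.conjTranspose * -(1 - 2 * P) * V
      = (2 : ℂ) • (P * V) + (2 : ℂ) • (V * P) - V - (4 : ℂ) • (V * (P * (V.conjTranspose * (P * V)))) := by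
    calc _ = -(V * V.conjTranspose * V) + 2 * (V * V.conjTranspose * (P * V))
          + 2 * (V * P * (V.conjTranspose * V))
          - 4 * (V * (P * (V.conjTranspose * (P * V)))) := by noncomm_ring
      _ = _ := by
        rw [h2, h1, one_mul, one_mul, mul_one]
        simp only [ofNat_smul_eq_nsmul, nsmul_eq_mul]
        push_cast
        abel
  rw [h3]
  have hPs : P * slice₀ w L nt m b n 0 = slice₀ w L nt m b n 0 := by
    simp only [P, zeroProj]
    rw [Matrix.mul_assoc, conjTranspose_slice₀_mul_slice₀, if_pos rfl, Matrix.mul_one]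
  have hsP : (slice₀ w L nt m b n 0).conjTranspose * P = (slice₀ w L nt m b n 0).conjTranspose := by
    simp only [P, zeroProj]
    rw [← Matrix.mul_assoc, conjTranspose_slice₀_mul_slice₀, if_pos rfl, Matrix.one_mul]
  have e1 : block (P * V) = block V := by
    rw [block_eq, block_eq, ← Matrix.mul_assoc, hsP]
  have e2 : block (V * P) = block V := by
    rw [block_eq, block_eq, Matrix.mul_assoc, Matrix.mul_assoc V, hPs, Matrix.mul_assoc]
  have e3 : block (V * (P * (V.conjTranspose * (P * V))))
      = block V * star (block V) * block V := by
    simp only [block_eq, P, zeroProj, Matrix.star_eq_conjTranspose, Matrix.conjTranspose_mul,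
      Matrix.conjTranspose_conjTranspose, Matrix.mul_assoc]
  have hlin : ∀ A B C D : Matrix (FullIdx w L nt m b n) (FullIdx w L nt m b n) ℂ,
      block ((2 : ℂ) • A + (2 : ℂ) • B - C - (4 : ℂ) • D)
        = (2 : ℂ) • block A + (2 : ℂ) • block B - block C - (4 : ℂ) • block D := by
    intro A B C D; refine Matrix.ext fun x y => ?_; simp [block]
  rw [hlin, e1, e2, e3]
  module

/-- On contractions the map `A ↦ 3 A - 4 A A* A` is Lipschitz with constant `3 + 4 * 3 = 15`. -/
lemma norm_amplify_step_le {A U : QOp n} (hA : ‖A‖ ≤ 1) (hU : star U * U = 1) {σ ε : ℝ}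
    (hσ : |σ| ≤ 1) (h : ‖A - (σ : ℂ) • U‖ ≤ ε) :
    ‖((3 : ℂ) • A - (4 : ℂ) • (A * star A * A)) - ((3 * σ - 4 * σ ^ 3 : ℝ) : ℂ) • U‖ ≤ 15 * ε := by
  set B := (σ : ℂ) • U with hB
  have hU1 : ‖U‖ ≤ 1 := by
    have h1 := CStarRing.norm_star_mul_self (x := U)
    rw [hU, CStarRing.norm_one] at h1
    nlinarith [norm_nonneg U]
  have hB1 : ‖B‖ ≤ 1 := by
    rw [hB, norm_smul, Complex.norm_real, Real.norm_eq_abs]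
    exact mul_le_one₀ hσ (norm_nonneg _) hU1
  have hBB : B * star B * B = ((σ ^ 3 : ℝ) : ℂ) • U := by
    rw [hB, star_smul, smul_mul_smul_comm, smul_mul_smul_comm, mul_assoc U, hU, mul_one]
    congr 1
    simp; ring
  have h3 : ((3 * σ - 4 * σ ^ 3 : ℝ) : ℂ) • U = (3 : ℂ) • B - (4 : ℂ) • (B * star B * B) := by
    rw [hBB, hB, smul_smul, smul_smul, ← sub_smul]; congr 1; push_cast; ring
  have hs : ‖star A - star B‖ ≤ ε := by rw [← star_sub, norm_star]; exact h
  have h4 : ‖A * star A * A - B * star B * B‖ ≤ ε + ε + ε := by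
    refine (norm_mul_sub_mul_le hA ((norm_mul_le _ _).trans
      (mul_le_one₀ hB1 (norm_nonneg _) (by rwa [norm_star])))).trans (add_le_add ?_ h)
    exact (norm_mul_sub_mul_le (by rwa [norm_star]) hB1).trans (add_le_add h hs)
  rw [h3]
  calc _ = ‖(3 : ℂ) • (A - B) - (4 : ℂ) • (A * star A * A - B * star B * B)‖ := by
        congr 1; module
    _ ≤ ‖(3 : ℂ)‖ * ‖A - B‖ + ‖(4 : ℂ)‖ * ‖A * star A * A - B * star B * B‖ := by
        refine (norm_sub_le _ _).trans ?_
        rw [norm_smul, norm_smul]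
    _ ≤ 3 * ε + 4 * (ε + ε + ε) := by
        rw [show ‖(3 : ℂ)‖ = 3 by simp, show ‖(4 : ℂ)‖ = 4 by simp]
        gcongr
    _ = _ := by ring

lemma queries_iterate_amplify (c : Circuit w L nt m b n) (d : ℕ) :
    (amplify^[d] c).queries = 3 ^ d * c.queries := by
  induction d with
  | zero => simp
  | succ d ih => rw [Function.iterate_succ_apply', queries_amplify, ih]; ring

/-- Robust amplification from `sin (π / (2 * 3 ^ d)) U` to `U`. -/
theorem norm_block_iterate_amplify_sub_le
    {enc : Fin L → Fin (2 ^ nt) → Fin (2 ^ m) → Fin (2 ^ b)}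
    (hα : IsCoeffOracle enc Uα) (hH : UH ∈ Matrix.unitaryGroup _ ℂ) (c : Circuit w L nt m b n)
    {U : QOp n} (hU : star U * U = 1) {ε : ℝ} {d : ℕ}
    (h : ‖block (c.eval Uα UH) - ((Real.sin (Real.pi / (2 * 3 ^ d)) : ℝ) : ℂ) • U‖ ≤ ε) :
    ‖block ((amplify^[d] c).eval Uα UH) - U‖ ≤ 15 ^ d * ε := by
  -- Each round triples the angle, so `d` rounds take `π / (2 * 3 ^ d)` to `π / 2`.
  have key : ∀ i, ‖block ((amplify^[i] c).eval Uα UH)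
      - ((Real.sin (3 ^ i * (Real.pi / (2 * 3 ^ d))) : ℝ) : ℂ) • U‖ ≤ 15 ^ i * ε := by
    intro i
    induction i with
    | zero => simpa using h
    | succ i ih =>
      rw [Function.iterate_succ_apply', block_amplify hα hH, pow_succ', mul_assoc 3,
        Real.sin_three_mul, pow_succ' 15, mul_assoc 15]
      exact norm_amplify_step_le (norm_block_le_one (Circuit.eval_mem_unitary hα.1 hH _)) hU
        (Real.abs_sin_le_one _) ih
  have h1 := key d
  have h2 : (3 : ℝ) ^ d * (Real.pi / (2 * 3 ^ d)) = Real.pi / 2 := by field_simp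
  rw [h2, Real.sin_pi_div_two] at h1
  simpa using h1

end Block

end Circuits

/-! ### The multiplexed product formula -/

section Select

variable {w L nt m b n : ℕ}

/-- A permutation of the basis labels as a gate. -/
def permGate {ι : Type*} [Fintype ι] [DecidableEq ι] (σ : Equiv.Perm ι) : Matrix.unitaryGroup ι ℂ :=
  ⟨(1 : Matrix ι ι ℂ).submatrix id σ, by
    rw [Matrix.mem_unitaryGroup_iff, Matrix.star_eq_conjTranspose, Matrix.conjTranspose_submatrix,
      Matrix.submatrix_mul_equiv, Matrix.conjTranspose_one, one_mul, Matrix.submatrix_id_id]⟩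

lemma permGate_mul_slice {σ : Equiv.Perm (FullIdx w L nt m b n)} {w₀ : Fin (2 ^ w)} {j j' : Fin L}
    {q q' : Fin (2 ^ nt)} {s s' : Fin (2 ^ m)} {v : Fin (2 ^ b)}
    (h : ∀ x, σ (w₀, j, q, s, v, x) = (w₀, j', q', s', v, x)) :
    (permGate σ : Matrix (FullIdx w L nt m b n) (FullIdx w L nt m b n) ℂ) * slice n w₀ j q s v
      = slice n w₀ j' q' s' v := by
  refine Matrix.ext fun f x => ?_
  rw [mul_slice_apply]
  simp only [permGate, Matrix.submatrix_apply, h, slice, Matrix.of_apply, Matrix.one_apply, id]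

lemma liftCoeff_mul_slice {Uα : Matrix (CoeffIdx L nt m b) (CoeffIdx L nt m b) ℂ} {j : Fin L}
    {q : Fin (2 ^ nt)} {s : Fin (2 ^ m)} {v v' : Fin (2 ^ b)}
    (h : Uα.mulVec (Pi.single (j, q, s, v) 1) = Pi.single (j, q, s, v') 1) (w₀ : Fin (2 ^ w)) :
    liftCoeff w n Uα * slice n w₀ j q s v = slice n w₀ j q s v' := by
  refine Matrix.ext fun f x => ?_
  obtain ⟨w₁, j₁, q₁, s₁, v₁, y⟩ := f
  have h1 := congrFun h (j₁, q₁, s₁, v₁)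
  rw [Matrix.mulVec_single_one, Matrix.col_apply] at h1
  rw [mul_slice_apply]
  simp only [liftCoeff, slice, Matrix.of_apply, h1, Pi.single_apply, Prod.mk.injEq, ← ite_and]
  congr 1
  simp only [eq_iff_iff]
  tauto

lemma IsCoeffOracle.mulVec_enc {enc : Fin L → Fin (2 ^ nt) → Fin (2 ^ m) → Fin (2 ^ b)}
    {Uα : Matrix (CoeffIdx L nt m b) (CoeffIdx L nt m b) ℂ} (h : IsCoeffOracle enc Uα) (j : Fin L)
    (q : Fin (2 ^ nt)) (s : Fin (2 ^ m)) :
    Uα.mulVec (Pi.single (j, q, s, enc j q s) 1) = Pi.single (j, q, s, 0) 1 := by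
  rw [← h.2.2 j q s, Matrix.mulVec_mulVec, h.2.1, Matrix.one_mulVec]

lemma liftHam_mul_slice {UH : Matrix (HamIdx L b n) (HamIdx L b n) ℂ} {j : Fin L} {v : Fin (2 ^ b)}
    {E : QOp n} (h : ∀ ψ, UH.mulVec (tensorState j v ψ) = tensorState j v (E.mulVec ψ))
    (w₀ : Fin (2 ^ w)) (q : Fin (2 ^ nt)) (s : Fin (2 ^ m)) :
    liftHam w nt m UH * slice n w₀ j q s v = slice n w₀ j q s v * E := by
  refine Matrix.ext fun f x => ?_
  obtain ⟨w₁, j₁, q₁, s₁, v₁, y⟩ := f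
  have hs : (tensorState j v (Pi.single x 1) : HamIdx L b n → ℂ) = Pi.single (j, v, x) 1 := by
    funext r
    obtain ⟨j', v', x'⟩ := r
    simp only [tensorState, Pi.single_apply, Prod.mk.injEq, ← ite_and, and_assoc]
  have h1 := congrFun (h (Pi.single x 1)) (j₁, v₁, y)
  rw [hs, Matrix.mulVec_single_one, Matrix.mulVec_single_one, Matrix.col_apply] at h1
  rw [mul_slice_apply, slice_mul_apply]
  simp only [liftHam, Matrix.of_apply, h1, tensorState, Matrix.col_apply, Prod.mk.injEq, ← ite_and,
    and_true]
  congr 1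
  simp only [eq_iff_iff]
  tauto

variable [NeZero L]

/-- Exchanges the label `0` of the registers `|j⟩|q⟩|τ⟩` with a label controlled by the work
qubits. -/
def loadPerm (b n : ℕ) (p : Fin (2 ^ w) → Fin L × Fin (2 ^ nt) × Fin (2 ^ m)) :
    Equiv.Perm (FullIdx w L nt m b n) :=
  Function.Involutive.toPerm
    (fun f =>
      let r := Equiv.swap (0, 0, 0) (p f.1) (f.2.1, f.2.2.1, f.2.2.2.1)
      (f.1, r.1, r.2.1, r.2.2, f.2.2.2.2))
    fun f => by simp

lemma loadPerm_apply (p : Fin (2 ^ w) → Fin L × Fin (2 ^ nt) × Fin (2 ^ m))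
    (f : FullIdx w L nt m b n) :
    loadPerm b n p f = (f.1, (Equiv.swap (0, 0, 0) (p f.1) (f.2.1, f.2.2.1, f.2.2.2.1)).1,
      (Equiv.swap (0, 0, 0) (p f.1) (f.2.1, f.2.2.1, f.2.2.2.1)).2.1,
      (Equiv.swap (0, 0, 0) (p f.1) (f.2.1, f.2.2.1, f.2.2.2.1)).2.2, f.2.2.2.2) :=
  rfl

/-- The controlled exponential of one term of the Hamiltonian. -/
def slot (b n : ℕ) (p : Fin (2 ^ w) → Fin L × Fin (2 ^ nt) × Fin (2 ^ m)) :
    Circuit w L nt m b n :=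
  [.free (permGate (loadPerm b n p)), .coeff, .ham, .coeff, .free (permGate (loadPerm b n p))]

/-- `c` applies `T w₀` to the system if the work qubits are in the state `|w₀⟩`, and keeps the other
registers in the state zero. -/
def Acts (Uα : Matrix (CoeffIdx L nt m b) (CoeffIdx L nt m b) ℂ)
    (UH : Matrix (HamIdx L b n) (HamIdx L b n) ℂ) (c : Circuit w L nt m b n)
    (T : Fin (2 ^ w) → QOp n) : Prop :=
  ∀ w₀, Circuit.eval Uα UH c * slice₀ w L nt m b n w₀ = slice₀ w L nt m b n w₀ * T w₀

variable {Uα : Matrix (CoeffIdx L nt m b) (CoeffIdx L nt m b) ℂ}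
  {UH : Matrix (HamIdx L b n) (HamIdx L b n) ℂ}

lemma Acts.nil : Acts Uα UH ([] : Circuit w L nt m b n) fun _ => 1 := fun w₀ => by
  rw [Circuit.eval, Matrix.one_mul, Matrix.mul_one]

lemma Acts.append {c d : Circuit w L nt m b n} {S T : Fin (2 ^ w) → QOp n} (hc : Acts Uα UH c S)
    (hd : Acts Uα UH d T) : Acts Uα UH (c ++ d) fun w₀ => T w₀ * S w₀ := fun w₀ => by
  rw [Circuit.eval_append, Matrix.mul_assoc, hc, ← Matrix.mul_assoc, hd, Matrix.mul_assoc]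

lemma Acts.flatMap {ι : Type*} {f : ι → Circuit w L nt m b n} {T : ι → Fin (2 ^ w) → QOp n}
    (h : ∀ i, Acts Uα UH (f i) (T i)) (l : List ι) :
    Acts Uα UH (l.flatMap f) fun w₀ => (l.reverse.map fun i => T i w₀).prod := by
  induction l with
  | nil => exact Acts.nil
  | cons i l ih => simpa using (h i).append ih

lemma queries_flatMap {ι : Type*} {f : ι → Circuit w L nt m b n} {N : ℕ}
    (h : ∀ i, (f i).queries = N) (l : List ι) : Circuit.queries (l.flatMap f) = l.length * N := by
  induction l with
  | nil => simp [Circuit.queries]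
  | cons i l ih =>
    rw [List.flatMap_cons, Circuit.queries_append, h, ih, List.length_cons]
    ring

variable {Hs : Fin L → QOp n} {val : Fin (2 ^ b) → ℝ}
  {enc : Fin L → Fin (2 ^ nt) → Fin (2 ^ m) → Fin (2 ^ b)}

/-- Load the labels, compute the value, apply the exponential, then undo. `U_H` preserves the labels
and the value, `U_α` is its own inverse and erases the value, and the loading permutation is an
involution. -/
lemma acts_slot (hα : IsCoeffOracle enc Uα) (hH : IsHamOracle Hs val enc UH)
    (p : Fin (2 ^ w) → Fin L × Fin (2 ^ nt) × Fin (2 ^ m)) :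
    Acts Uα UH (slot b n p) fun w₀ =>
      NormedSpace.exp ((-(Complex.I *
        (val (enc (p w₀).1 (p w₀).2.1 (p w₀).2.2) : ℂ))) • Hs (p w₀).1) := by
  intro w₀
  have h1 := permGate_mul_slice (σ := loadPerm b n p) (w₀ := w₀) (j := 0) (q := 0) (s := 0) (v := 0)
    (j' := (p w₀).1) (q' := (p w₀).2.1) (s' := (p w₀).2.2) fun x => by simp [loadPerm_apply]
  have h2 := permGate_mul_slice (σ := loadPerm b n p) (w₀ := w₀) (j' := 0) (q' := 0) (s' := 0)
    (v := 0) (j := (p w₀).1) (q := (p w₀).2.1) (s := (p w₀).2.2) fun x => by simp [loadPerm_apply]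
  have h3 := liftCoeff_mul_slice (n := n) (hα.2.2 (p w₀).1 (p w₀).2.1 (p w₀).2.2) w₀
  have h4 := liftCoeff_mul_slice (n := n) (hα.mulVec_enc (p w₀).1 (p w₀).2.1 (p w₀).2.2) w₀
  have h5 := liftHam_mul_slice (hH.2 (p w₀).1 (p w₀).2.1 (p w₀).2.2) w₀ (p w₀).2.1 (p w₀).2.2
  simp only [slot, Circuit.eval, Gate.eval, slice₀, Matrix.one_mul, Matrix.mul_assoc]
  rw [h1, h3, h5, ← Matrix.mul_assoc (liftCoeff w n Uα), h4, ← Matrix.mul_assoc _ (slice n w₀ _ _ _ _),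
    h2]

/-- One controlled step of the symmetric product formula. -/
def stepCircuit (b n : ℕ) (q : Fin (2 ^ w) → Fin (2 ^ nt)) (s : Fin (2 ^ w) → Fin (2 ^ m)) :
    Circuit w L nt m b n :=
  (palindrome L).flatMap fun l => slot b n fun w₀ => (l, q w₀, s w₀)

/-- Controlled product formulas with `R` steps. -/
def selectCircuit (b n : ℕ) (q : Fin (2 ^ w) → ℕ → Fin (2 ^ nt))
    (s : Fin (2 ^ w) → ℕ → Fin (2 ^ m)) (R : ℕ) : Circuit w L nt m b n :=
  (List.range R).flatMap fun r => stepCircuit b n (fun w₀ => q w₀ r) fun w₀ => s w₀ r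

lemma queries_selectCircuit (q : Fin (2 ^ w) → ℕ → Fin (2 ^ nt))
    (s : Fin (2 ^ w) → ℕ → Fin (2 ^ m)) (R : ℕ) :
    (selectCircuit b n q s R : Circuit w L nt m b n).queries = R * (2 * L * 3) := by
  have h1 : ∀ (q : Fin (2 ^ w) → Fin (2 ^ nt)) (s : Fin (2 ^ w) → Fin (2 ^ m)),
      (stepCircuit b n q s : Circuit w L nt m b n).queries = 2 * L * 3 := fun q s => by
    rw [stepCircuit, queries_flatMap (N := 3) fun _ => rfl, palindrome]
    simp [two_mul]
  rw [selectCircuit, queries_flatMap fun _ => h1 _ _, List.length_range]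

lemma acts_selectCircuit {α : Fin L → ℝ → ℝ} {t₀ t : ℝ} {dur : Fin (2 ^ m) → ℝ}
    (hα : IsCoeffOracle enc Uα) (hH : IsHamOracle Hs val enc UH)
    (henc : IsEncoding α t₀ t dur val enc) (q : Fin (2 ^ w) → ℕ → Fin (2 ^ nt))
    (s : Fin (2 ^ w) → ℕ → Fin (2 ^ m)) (R : ℕ) :
    Acts Uα UH (selectCircuit b n q s R) fun w₀ =>
      prodDown (fun r => phaseStep Hs fun l => α l (meshPoint t₀ t nt (q w₀ r)) * dur (s w₀ r)) R := by
  have h1 : ∀ r, Acts Uα UH (stepCircuit b n (fun w₀ => q w₀ r) fun w₀ => s w₀ r) fun w₀ =>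
      phaseStep Hs fun l => α l (meshPoint t₀ t nt (q w₀ r)) * dur (s w₀ r) := fun r => by
    have := Acts.flatMap (fun l => acts_slot hα hH fun w₀ : Fin (2 ^ w) => (l, q w₀ r, s w₀ r))
      (palindrome L)
    -- Gates are listed in order of application, so the operator product comes out reversed; a
    -- palindrome does not notice.
    simp only [palindrome_reverse, henc _ _ _] at this
    exact this
  induction R with
  | zero => exact Acts.nil
  | succ R ih =>
    rw [selectCircuit, List.range_succ, List.flatMap_append, List.flatMap_singleton]
    exact ih.append (h1 R)

/-! ### Linear combination of unitaries -/

open scoped Kronecker in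
/-- A gate on the work qubits. -/
def workGate (L nt m b n : ℕ) (G : Matrix.unitaryGroup (Fin (2 ^ w)) ℂ) :
    Matrix.unitaryGroup (FullIdx w L nt m b n) ℂ :=
  ⟨G.1 ⊗ₖ 1, Matrix.kronecker_mem_unitary G.2 (one_mem _)⟩

lemma workGate_mul_slice₀ (G : Matrix.unitaryGroup (Fin (2 ^ w)) ℂ) (w₀ : Fin (2 ^ w)) :
    (workGate L nt m b n G).1 * slice₀ w L nt m b n w₀
      = ∑ i, G.1 i w₀ • slice₀ w L nt m b n i := by
  refine Matrix.ext fun f x => ?_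
  obtain ⟨w₁, j, q, s, v, y⟩ := f
  rw [slice₀, mul_slice_apply, Matrix.sum_apply]
  simp only [workGate, slice₀, slice, Matrix.kroneckerMap_apply, Matrix.smul_apply, Matrix.of_apply,
    Matrix.one_apply, Prod.mk.injEq, smul_eq_mul]
  rw [Finset.sum_eq_single w₁]
  · simp
  · intro i _ hi
    simp [hi.symm]
  · simp

/-- Linear combination of unitaries with different preparations at the two ends: the weights are
products of two amplitudes, so they may be negative. -/
lemma block_workGate {c : Circuit w L nt m b n} {T : Fin (2 ^ w) → QOp n} (hc : Acts Uα UH c T)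
    (F G : Matrix.unitaryGroup (Fin (2 ^ w)) ℂ) :
    block (Circuit.eval Uα UH
        ([.free (workGate L nt m b n F)] ++ (c ++ [.free (workGate L nt m b n G)⁻¹])))
      = ∑ i, (star (G.1 i 0) * F.1 i 0) • T i := by
  have hG : (workGate L nt m b n G)⁻¹.1 = (workGate L nt m b n G).1.conjTranspose := rfl
  have h1 : Circuit.eval Uα UH c * ((workGate L nt m b n F).1 * slice₀ w L nt m b n 0)
      = ∑ i, F.1 i 0 • (slice₀ w L nt m b n i * T i) := by
    rw [workGate_mul_slice₀, Matrix.mul_sum]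
    exact Finset.sum_congr rfl fun i _ => by rw [Matrix.mul_smul, hc i]
  have h2 : (slice₀ w L nt m b n 0).conjTranspose * (workGate L nt m b n G).1.conjTranspose
      = ∑ i, star (G.1 i 0) • (slice₀ w L nt m b n i).conjTranspose := by
    rw [← Matrix.conjTranspose_mul, workGate_mul_slice₀, Matrix.conjTranspose_sum]
    exact Finset.sum_congr rfl fun i _ => Matrix.conjTranspose_smul ..
  simp only [Circuit.eval_append, Circuit.eval_singleton, Gate.eval, block_eq, hG]
  rw [← Matrix.mul_assoc, ← Matrix.mul_assoc, h2, Matrix.mul_assoc, Matrix.mul_assoc, h1,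
    Matrix.sum_mul]
  refine Finset.sum_congr rfl fun i _ => ?_
  rw [Matrix.mul_sum, Finset.sum_eq_single i]
  · rw [Matrix.smul_mul, Matrix.mul_smul, ← Matrix.mul_assoc, conjTranspose_slice₀_mul_slice₀,
      if_pos rfl, Matrix.one_mul, smul_smul]
  · intro k _ hk
    rw [Matrix.smul_mul, Matrix.mul_smul, ← Matrix.mul_assoc, conjTranspose_slice₀_mul_slice₀,
      if_neg hk.symm, Matrix.zero_mul, smul_zero, smul_zero]
  · simp


end Select

lemma exists_unitary_column {N : ℕ} [NeZero N] (v : Fin N → ℝ) (hv : ∑ i, v i ^ 2 = 1) :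
    ∃ G : Matrix.unitaryGroup (Fin N) ℂ, ∀ i, G.1 i 0 = v i := by
  set x : EuclideanSpace ℂ (Fin N) := WithLp.toLp 2 fun i => (v i : ℂ)
  have hx : ‖x‖ = 1 := by
    rw [EuclideanSpace.norm_eq, Real.sqrt_eq_one]
    simpa [x] using hv
  have ho : Orthonormal ℂ (({0} : Set (Fin N)).domRestrict fun _ => x) := by
    rw [orthonormal_subsingleton_iff]
    exact fun _ => hx
  obtain ⟨B, hB⟩ := ho.exists_orthonormalBasis_extension_of_card_eq (by simp)
  refine ⟨⟨_, (EuclideanSpace.basisFun (Fin N) ℂ).toMatrix_orthonormalBasis_mem_unitary B⟩,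
    fun i => ?_⟩
  change (EuclideanSpace.basisFun (Fin N) ℂ).toBasis.toMatrix B i 0 = v i
  rw [Module.Basis.toMatrix_apply, hB 0 rfl]
  simp [x]

/-- Amplitudes of two states whose overlaps realize given weights. -/
lemma exists_amplitudes {M w : ℕ} (hw : M + 2 ≤ 2 ^ w) (c : ℕ → ℝ) (hc0 : ∀ i, M ≤ i → c i = 0)
    (hc : ∑ i ∈ Finset.range M, |c i| ≤ 1) :
    ∃ u v : Fin (2 ^ w) → ℝ, ∑ i, u i ^ 2 = 1 ∧ ∑ i, v i ^ 2 = 1 ∧ ∀ i, u i * v i = c i := by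
  set f : ℕ → ℝ := fun i => √|c i|
  set g : ℕ → ℝ := fun i => SignType.sign (c i) * √|c i|
  set r := √(1 - ∑ i ∈ Finset.range M, |c i|)
  have hr : r ^ 2 = 1 - ∑ i ∈ Finset.range M, |c i| := Real.sq_sqrt (by linarith)
  have hf : ∀ i, f i ^ 2 = |c i| := fun i => Real.sq_sqrt (abs_nonneg _)
  have hg : ∀ i, g i ^ 2 = |c i| := fun i => by
    rcases lt_trichotomy (c i) 0 with h | h | h <;> simp [g, h, Real.sq_sqrt]
  have hfg : ∀ i, g i * f i = c i := fun i => by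
    rw [show g i * f i = SignType.sign (c i) * f i ^ 2 by simp only [g, f]; ring, hf]
    exact sign_mul_abs _
  have hsum : ∀ (z : ℕ → ℝ) (k : ℕ), M ≤ k → k < M + 2 → (∀ i, z i ^ 2 = |c i|) →
      ∑ i : Fin (2 ^ w), (if (i : ℕ) = k then r else z i) ^ 2 = 1 := by
    intro z k hk hk2 hz
    have hzi : ∀ i, (if i = k then r else z i) ^ 2 = |c i| + if i = k then r ^ 2 else 0 := by
      intro i
      split_ifs with h
      · rw [hc0 i (h ▸ hk), abs_zero, zero_add]
      · rw [hz, add_zero]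
    rw [Fin.sum_univ_eq_sum_range (fun i => (if i = k then r else z i) ^ 2), 
      Finset.sum_congr rfl fun i _ => hzi i, Finset.sum_add_distrib, Finset.sum_ite_eq',
      if_pos (Finset.mem_range.2 (by omega)), hr,
      ← Finset.sum_subset (Finset.range_subset_range.2 (by omega : M ≤ 2 ^ w)) fun i _ hi => by
        rw [hc0 i (by simpa using hi), abs_zero]]
    ring
  -- Both vectors lack the same mass `r ^ 2`. It is placed at different labels, `M + 1` and `M`,
  -- where the other vector vanishes, so the overlaps are unaffected; hence `M + 2 ≤ 2 ^ w`.
  refine ⟨fun i => if (i : ℕ) = M + 1 then r else g i, fun i => if (i : ℕ) = M then r else f i,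
    hsum g _ (by omega) (by omega) hg, hsum f _ le_rfl (by omega) hf, fun i => ?_⟩
  have hf0 : ∀ i, M ≤ i → f i = 0 := fun i hi => by simp [f, hc0 i hi]
  have hg0 : ∀ i, M ≤ i → g i = 0 := fun i hi => by simp [g, hc0 i hi]
  dsimp only
  split_ifs with h1 h2 h2
  · omega
  · rw [hf0 _ (by omega), hc0 _ (by omega), mul_zero]
  · rw [hg0 _ (by omega), hc0 _ (by omega), zero_mul]
  · exact hfg i

/-! ### The amplified multiproduct circuit -/

lemma phaseStep_zero {n L : ℕ} (Hs : Fin L → QOp n) : (phaseStep Hs fun _ => 0) = 1 := by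
  simp [phaseStep, NormedSpace.exp_zero]

lemma prodDown_eq_of_le {n : ℕ} {f : ℕ → QOp n} {k R : ℕ} (hk : k ≤ R) (h : ∀ r, k ≤ r → f r = 1) :
    prodDown f R = prodDown f k := by
  induction R, hk using Nat.le_induction with
  | base => rfl
  | succ R hR ih => rw [prodDown, ih, h R hR, one_mul]

lemma prodDown_congr {n : ℕ} {f g : ℕ → QOp n} {k : ℕ} (h : ∀ r < k, f r = g r) :
    prodDown f k = prodDown g k := by
  induction k with
  | zero => rfl
  | succ k ih => rw [prodDown, prodDown, ih fun r hr => h r (by omega), h k (by omega)]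

/-- The multiproduct formula, scaled by `σ`, is block-encoded with `18 M ^ 2 L` queries. -/
lemma exists_mpf_circuit {M L nt : ℕ} [NeZero L] {k : Fin M → ℕ} {a : Fin M → ℝ}
    (hk : ∀ j, k j ≤ 3 * M ^ 2) {σ : ℝ} (hσ0 : 0 ≤ σ) (hσ : σ * l1norm a ≤ 1)
    (q : Fin M → ℕ → Fin (2 ^ nt)) (t₀ t : ℝ) (b n : ℕ) :
    ∃ c : Circuit (M + 2) L nt (3 * M ^ 2) b n, c.queries = 18 * M ^ 2 * L ∧
      ∀ (Hs : Fin L → QOp n) (α : Fin L → ℝ → ℝ) (val : Fin (2 ^ b) → ℝ)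
        (enc : Fin L → Fin (2 ^ nt) → Fin (2 ^ (3 * M ^ 2)) → Fin (2 ^ b))
        (Uα : Matrix (CoeffIdx L nt (3 * M ^ 2) b) (CoeffIdx L nt (3 * M ^ 2) b) ℂ)
        (UH : Matrix (HamIdx L b n) (HamIdx L b n) ℂ),
        IsEncoding α t₀ t (fun s => (t - t₀) / (2 * s)) val enc → IsCoeffOracle enc Uα →
        IsHamOracle Hs val enc UH →
        block (c.eval Uα UH) = (σ : ℂ) • ∑ j, (a j : ℂ) • prodDown (fun r => phaseStep Hs fun l =>
          α l (meshPoint t₀ t nt (q j r)) * ((t - t₀) / (2 * k j))) (k j) := by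
  have hk2 : ∀ j, k j < 2 ^ (3 * M ^ 2) := fun j => (hk j).trans_lt Nat.lt_two_pow_self
  set c : ℕ → ℝ := fun i => if h : i < M then σ * a ⟨i, h⟩ else 0 with hc
  set Q : ℕ → ℕ → Fin (2 ^ nt) := fun i r => if h : i < M then q ⟨i, h⟩ r else 0 with hQ
  -- The code of a duration is its step number: `s` stands for `Δt / (2 s)`, and `0` for duration
  -- zero because division by zero is zero. Branch `j` is padded after `k j` steps by code `0`, that
  -- is by identity steps.
  set S : ℕ → ℕ → Fin (2 ^ (3 * M ^ 2)) := fun i r =>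
    if h : i < M then if r < k ⟨i, h⟩ then ⟨k ⟨i, h⟩, hk2 _⟩ else 0 else 0 with hS
  have hcM : ∀ i, M ≤ i → c i = 0 := fun i hi => dif_neg (by omega)
  have hcj : ∀ j : Fin M, c j = σ * a j := fun j => dif_pos j.2
  have hcs : ∑ i ∈ Finset.range M, |c i| ≤ 1 := by
    rw [← Fin.sum_univ_eq_sum_range fun i => |c i|]
    simp only [hcj, abs_mul, abs_of_nonneg hσ0]
    rwa [← Finset.mul_sum]
  obtain ⟨u, v, hu, hv, huv⟩ :=
    exists_amplitudes (w := M + 2) Nat.lt_two_pow_self.le c hcM hcs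
  obtain ⟨F, hF⟩ := exists_unitary_column v hv
  obtain ⟨G, hG⟩ := exists_unitary_column u hu
  refine ⟨[.free (workGate L nt _ b n F)] ++ (selectCircuit b n (fun i => Q i) (fun i => S i)
    (3 * M ^ 2) ++ [.free (workGate L nt _ b n G)⁻¹]), ?_, ?_⟩
  -- `3 M ^ 2` steps of `2 L` exponentials with three queries each.
  · rw [Circuit.queries_append, Circuit.queries_append, queries_selectCircuit]
    simp only [Circuit.queries, List.map_cons, List.map_nil, Gate.queries, List.sum_cons,
      List.sum_nil]
    ring
  intro Hs α val enc Uα UH henc hα hH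
  rw [block_workGate (acts_selectCircuit hα hH henc _ _ _)]
  set g : ℕ → QOp n := fun i => prodDown (fun r => phaseStep Hs fun l =>
    α l (meshPoint t₀ t nt (Q i r)) * ((t - t₀) / (2 * (S i r : ℕ)))) (3 * M ^ 2) with hg
  have h1 : ∀ i : Fin (2 ^ (M + 2)), star (G.1 i 0) * F.1 i 0 = (c i : ℂ) := fun i => by
    rw [hF, hG, ← huv]; simp
  simp only [h1]
  rw [Fin.sum_univ_eq_sum_range fun i => (c i : ℂ) • g i,
    ← Finset.sum_subset (Finset.range_subset_range.2 (by
      have : M + 2 < 2 ^ (M + 2) := Nat.lt_two_pow_self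
      omega : M ≤ 2 ^ (M + 2))) fun i _ hi => by
        rw [hcM i (by simpa using hi), Complex.ofReal_zero, zero_smul],
    ← Fin.sum_univ_eq_sum_range fun i => (c i : ℂ) • g i, Finset.smul_sum]
  refine Finset.sum_congr rfl fun j _ => ?_
  rw [hcj, Complex.ofReal_mul, mul_smul]
  congr 2
  have hQj : ∀ r, Q j r = q j r := fun r => dif_pos j.2
  have hSj : ∀ r, S j r = if r < k j then ⟨k j, hk2 j⟩ else 0 := fun r => dif_pos j.2
  simp only [hg]
  rw [prodDown_eq_of_le (hk j) fun r hr => by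
    rw [hSj, if_neg (by omega)]
    simpa using phaseStep_zero Hs]
  exact prodDown_congr fun r hr => by rw [hQj, hSj, if_pos hr]

/-- Take the first power of three above `2 x`: it is at most `6 x`, and `sin y ≤ y` with `π ≤ 4`
puts the amplitude below `1 / x`. The amplitude is prepared exactly, so amplification does not
overshoot. -/
lemma exists_amplification_depth {x : ℝ} (hx : 1 ≤ x) :
    ∃ d : ℕ, (3 : ℝ) ^ d ≤ 6 * x ∧ Real.sin (Real.pi / (2 * 3 ^ d)) * x ≤ 1 := by
  obtain ⟨d, h1, h2⟩ := exists_nat_pow_near (by linarith : 1 ≤ 2 * x) (by norm_num : (1 : ℝ) < 3)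
  refine ⟨d + 1, by rw [pow_succ]; linarith, ?_⟩
  have h3 : (0 : ℝ) < 3 ^ (d + 1) := by positivity
  calc Real.sin (Real.pi / (2 * 3 ^ (d + 1))) * x ≤ Real.pi / (2 * 3 ^ (d + 1)) * x := by
        gcongr
        exact Real.sin_le (by positivity)
    _ ≤ 4 / (2 * 3 ^ (d + 1)) * (3 ^ (d + 1) / 2) := by
        gcongr
        · exact Real.pi_le_four
        · linarith
    _ = 1 := by field_simp; norm_num

lemma sin_div_nonneg (d : ℕ) : 0 ≤ Real.sin (Real.pi / (2 * 3 ^ d)) := by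
  refine Real.sin_nonneg_of_nonneg_of_le_pi (by positivity) (div_le_self Real.pi_pos.le ?_)
  have : (1 : ℝ) ≤ 3 ^ d := one_le_pow₀ (by norm_num)
  linarith

end TDMPF

end

/-! ### Choice of constants, and the two regimes of `x` -/

theorem mainTheorem7 :
    -- absolute constants
    ∃ (c₁ c₂ : ℝ) (e : ℕ), ∀ M : ℕ, 1 ≤ M →
      -- coefficients and the error constant depend on `M` only
      ∃ (k : Fin M → ℕ) (a : Fin M → ℝ) (C : ℝ),
        TDMPF.IsMPF k a ∧ (∀ j, k j ≤ 3 * M ^ 2) ∧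
        TDMPF.l1norm a ≤ c₁ * (1 + Real.log M) ∧
        ∀ (n L nt : ℕ) [NeZero L] (t₀ t : ℝ), t₀ < t →
          -- the encoded time steps used by the circuit
          ∃ (m : ℕ) (dur : Fin (2 ^ m) → ℝ), (∀ s, 0 ≤ dur s ∧ dur s ≤ t - t₀) ∧
          ∀ b : ℕ,
            -- the circuit, fixed before the Hamiltonian and its oracles
            ∃ (w : ℕ) (circ : TDMPF.Circuit w L nt m b n),
              (circ.queries : ℝ)
                ≤ c₂ * ((M : ℝ) ^ 2 * L) * (1 + Real.log ((M : ℝ) ^ 2 * L)) ^ e ∧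
              ∀ (Hs : Fin L → TDMPF.QOp n) (α : Fin L → ℝ → ℝ) (Λ : ℝ → ℝ) (κ : ℝ)
                (val : Fin (2 ^ b) → ℝ)
                (enc : Fin L → Fin (2 ^ nt) → Fin (2 ^ m) → Fin (2 ^ b))
                (Uα : Matrix (TDMPF.CoeffIdx L nt m b) (TDMPF.CoeffIdx L nt m b) ℂ)
                (UH : Matrix (TDMPF.HamIdx L b n) (TDMPF.HamIdx L b n) ℂ)
                (U : ℝ → TDMPF.QOp n),
                (∀ j, (Hs j).IsHermitian) →
                (∀ j, ContDiffOn ℝ ∞ (α j) (Set.Icc t₀ t)) →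
                TDMPF.IsLambdaBound (TDMPF.hamiltonian Hs α) t₀ t Λ →
                TDMPF.IsTermRatio M Hs α Λ t₀ t κ →
                TDMPF.IsEncoding α t₀ t dur val enc →
                TDMPF.IsCoeffOracle enc Uα →
                TDMPF.IsHamOracle Hs val enc UH →
                TDMPF.IsPropagator (TDMPF.hamiltonian Hs α) t₀ t U →
                Real.logb 2
                    (10 * (M : ℝ) ^ 2 * L * TDMPF.maxDeriv α t₀ t * (t - t₀) ^ 2 /
                      (41 * TDMPF.lambdaMax Λ t₀ t * (t - t₀)) ^ (2 * M + 1)) ≤ (nt : ℝ) →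
                ‖TDMPF.block (circ.eval Uα UH) - U t‖
                  ≤ C * (TDMPF.l1norm a *
                      (κ * TDMPF.lambdaMax Λ t₀ t * (t - t₀)) ^ (2 * M + 1)) := by
  classical
  set c₁ : ℝ := 2 * Real.exp 312 with hc₁
  -- `108 = 6 * 18`: amplification multiplies the `18 M ^ 2 L` queries by `3 ^ d ≤ 6 ‖a‖₁`, whose
  -- logarithm accounts for `e = 1`.
  refine ⟨c₁, 108 * c₁, 1, fun M hM => ?_⟩
  obtain ⟨k, a, ha, hk, hal⟩ := TDMPF.exists_wellConditioned_mpf M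
  have ha1 := TDMPF.one_le_l1norm hM ha
  obtain ⟨d, hd3, hdσ⟩ := TDMPF.exists_amplification_depth ha1
  have hmc : 0 ≤ TDMPF.mpfConst M := by rw [TDMPF.mpfConst]; positivity
  -- The two summands serve `x ≤ 1 / 2` and `x ≥ 1 / 2`. The depth `d` was chosen from `‖a‖₁`, so
  -- the constant depends on `M` only.
  refine ⟨k, a, 15 ^ d * TDMPF.mpfConst M + 2 * 2 ^ (2 * M + 1), ha, hk, hal, ?_⟩
  intro n L nt _ t₀ t h
  have h0 : 0 < t - t₀ := sub_pos.2 h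
  refine ⟨3 * M ^ 2, fun s => (t - t₀) / (2 * s), fun s => ⟨by positivity, ?_⟩, fun b => ?_⟩
  · rcases Nat.eq_zero_or_pos (s : ℕ) with hs | hs
    · simp [hs, h.le]
    · have : (1 : ℝ) ≤ (s : ℕ) := by exact_mod_cast hs
      exact div_le_self h0.le (by linarith)
  -- The mesh points closest to the midpoints depend on the interval and the mesh alone, so the
  -- circuit is fixed before the Hamiltonian.
  have hq : ∀ (j : Fin M) (r : ℕ), ∃ q : Fin (2 ^ nt), r < k j →
      |TDMPF.meshPoint t₀ t nt q - (t₀ + ((r : ℝ) + 1 / 2) / k j * (t - t₀))|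
        ≤ 2 * (t - t₀) / 2 ^ nt := by
    intro j r
    by_cases hr : r < k j
    · have hkj : (0 : ℝ) < k j := by exact_mod_cast ha.1 j
      have hr' : (r : ℝ) + 1 ≤ k j := by exact_mod_cast hr
      have hle : ((r : ℝ) + 1 / 2) / k j ≤ 1 := (div_le_one hkj).2 (by linarith)
      obtain ⟨q, hq⟩ := TDMPF.exists_meshPoint_near h nt
        (τ := t₀ + ((r : ℝ) + 1 / 2) / k j * (t - t₀))
        ⟨le_add_of_nonneg_right (by positivity), by nlinarith⟩
      exact ⟨q, fun _ => hq⟩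
    · exact ⟨0, fun h => absurd h hr⟩
  choose q hq using hq
  obtain ⟨c, hcq, hcb⟩ := TDMPF.exists_mpf_circuit (L := L) hk (TDMPF.sin_div_nonneg d) hdσ q t₀ t b n
  refine ⟨M + 2, TDMPF.amplify^[d] c, ?_, ?_⟩
  · have hM1 : (1 : ℝ) ≤ M := by exact_mod_cast hM
    have hL1 : (1 : ℝ) ≤ L := by exact_mod_cast NeZero.one_le
    have hlog : Real.log M ≤ Real.log ((M : ℝ) ^ 2 * L) :=
      Real.log_le_log (by linarith) (by nlinarith [sq_nonneg (M : ℝ)])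
    rw [TDMPF.queries_iterate_amplify, hcq]
    push_cast
    calc (3 : ℝ) ^ d * (18 * M ^ 2 * L)
        ≤ 6 * (c₁ * (1 + Real.log ((M : ℝ) ^ 2 * L))) * (18 * M ^ 2 * L) := by
          gcongr
          refine hd3.trans ?_
          gcongr
          refine hal.trans ?_
          gcongr
      _ = _ := by ring
  intro Hs α Λ κ val enc Uα UH U hHs hα hΛ hκ henc hUα hUH hU hnt
  have hHH := TDMPF.hamiltonian_isHermitian hHs α
  have hUU := TDMPF.propagator_star_mul_self h.le hHH hU
  set x := κ * TDMPF.lambdaMax Λ t₀ t * (t - t₀) with hx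
  have hx0 : 0 < x := mul_pos (mul_pos (by linarith [hκ.1]) (TDMPF.lambdaMax_pos h hΛ)) h0
  rw [add_mul]
  -- For `x ≥ 1 / 2` the error is at most `2 ≤ 2 * (2 x) ^ (2 M + 1)`, by contractivity alone.
  rcases le_total x (1 / 2) with hx2 | hx2
  · have hmain := TDMPF.norm_mpf_mesh_sub_propagator_le hM h ha hHs hα hΛ hκ hU hnt hx2 hq
    have hblock : ‖TDMPF.block (c.eval Uα UH)
        - ((Real.sin (Real.pi / (2 * 3 ^ d)) : ℝ) : ℂ) • U t‖
          ≤ TDMPF.mpfConst M * (TDMPF.l1norm a * x ^ (2 * M + 1)) := by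
      rw [hcb Hs α val enc Uα UH henc hUα hUH, ← smul_sub, norm_smul, Complex.norm_real,
        Real.norm_eq_abs]
      exact (mul_le_of_le_one_left (norm_nonneg _) (Real.abs_sin_le_one _)).trans hmain
    have := TDMPF.norm_block_iterate_amplify_sub_le hUα hUH.1 c hUU hblock
    rw [← mul_assoc] at this
    exact this.trans (le_add_of_nonneg_right (by positivity))
  · have h1 : ‖TDMPF.block ((TDMPF.amplify^[d] c).eval Uα UH) - U t‖ ≤ 1 + 1 :=
      (norm_sub_le _ _).trans (add_le_add
        (TDMPF.norm_block_le_one (TDMPF.Circuit.eval_mem_unitary hUα.1 hUH.1 _))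
        (TDMPF.norm_propagator_le_one h.le hHH hU))
    have h2 : 1 ≤ (2 * x) ^ (2 * M + 1) := one_le_pow₀ (by linarith)
    rw [mul_pow] at h2
    have h3 : 0 < x ^ (2 * M + 1) := by positivity
    have h4 : (2 : ℝ) * 2 ^ (2 * M + 1) * (1 * x ^ (2 * M + 1))
        ≤ 2 * 2 ^ (2 * M + 1) * (TDMPF.l1norm a * x ^ (2 * M + 1)) := by gcongr
    have h5 : 0 ≤ 15 ^ d * TDMPF.mpfConst M * (TDMPF.l1norm a * x ^ (2 * M + 1)) := by positivity
    linarith
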